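/- All graphs are finite and non-empty. **Galled-trees and GaTEx graphs.** A galled-tree on a leaf set $X$ is a finite DAG $N$ that either consists of a single vertex $x$, with $X=\{x\}$, or satisfies: (N1) there is a unique root $\rho_N$ of indegree $0$, and it has outdegree at least $2$; (N2) $x\in X$ iff $x$ has outdegree $0$ and indegree $1$; (N3) every other vertex has either indegree $1$ and outdegree at least $2$, or indegree $2$ and outdegree at least $1$ (a hybrid-vertex); (N4) each biconnected component contains at most one hybrid-vertex both of whose parents lie in that component. A cycle $C$ of $N$ consists of two different directed paths (its sides) from a vertex $\rho_C$ (its root) to a vertex $\eta_C$ (its hybrid-vertex) with no common inner vertices. A labeling of $N$ is a map $t\colon V(N)\to\{0,1,\odot\}$ with $t(v)=\odot$ iff $v\in X$. The graph explained by $(N,t)$ has vertex set $X$, and $x\ne y$ are adjacent iff $t(\mathrm{lca}_N(x,y))=1$. A graph is GaTEx if it is explained by some labeled galled-tree. A galled-tree on $X$ is elementary if it consists of one cycle $C$ of length $|X|+1$ with $\rho_C=\rho_N$, together with exactly one pendant leaf at each vertex of $C$ other than $\rho_C$. It is strong if no cycle has a side without inner vertices or two sides with exactly one inner vertex each. The labeling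 is quasi-discriminating if $t(u)\neq t(v)$ for every edge $(u,v)$ with $v$ not a hybrid-vertex. **Pvr-networks.** A module of $G$ is a set $M\subseteq V(G)$ all of whose elements have the same neighbors outside $M$; it is strong if for every module $M'$ the set $M\cap M'$ is one of $M,M',\emptyset$. The modular decomposition tree $\mathscr T_G$ has the non-empty strong modules as vertices, ordered by inclusion (its root is $V(G)$, its leaves are the singletons). Its labels are $t_G(M)=\odot$ if $|M|=1$; otherwise $0$ if $G[M]$ is disconnected, $1$ if the complement of $G[M]$ is disconnected, and "prime" in all other cases. A pvr-network $(N,t)$ of $G$ arises from $(\mathscr T_G,t_G)$ as follows: for each prime vertex $M$, choose a labeled strong quasi-discriminating elementary galled-tree $(N_M,t_M)$ that explains the quotient of $G[M]$ by its inclusion-maximal strong modules other than $M$; replace the edges from $M$ to its children by $N_M$, identifying the root of $N_M$ with $M$ and the leaves of $N_M$ with the children of $M$ in $\mathscr T_G$. The label $t$ equals $t_M$ on the non-leaf vertices of $N_M$, and $t_G$ on the non-prime vertices of $\mathscr T_G$. **Algorithm.** Given a GaTEx graph $G$ and a pvr-network $(N,t)$ of $G$, put $\zeta(x):=x$ for each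 leaf $x$ and process the non-leaf vertices $v$ of $\mathscr T_G$ in postorder. If $t_G(v)\in\{0,1\}$, let $\zeta(v)$ be the concatenation, in an arbitrary order, of the sequences $\zeta(v_i)$ of the children $v_i$ of $v$ in $\mathscr T_G$. If $v$ is prime, let $C$ be the unique cycle of $N$ with $\rho_C=v$; for each $w\in V(C)\setminus\{\rho_C\}$ put $\zeta(w):=\zeta(w')$, where $w'$ is the unique child of $w$ in $N$ outside $C$; let $\zeta^*(v)$ be the concatenation, in an arbitrary order, of the sequences $\zeta(w)$ with $w\in V(C)\setminus\{\rho_C,\eta_C\}$; and put $\zeta(v):=\zeta(\eta_C)\zeta^*(v)$ if $t(\rho_C)=0$ and $\zeta(v):=\zeta^*(v)\zeta(\eta_C)$ if $t(\rho_C)=1$. Return $\zeta(v)$ for the root $v$ of $\mathscr T_G$. **Proposition.** The algorithm determines a perfect ordering of every GaTEx graph. That is, let $G$ be a GaTEx graph. Then $G$ has a pvr-network, and for every pvr-network of $G$ the algorithm can be carried out and every sequence $\zeta$ that it can return (whatever arbitrary choices it makes) is a perfect order of $G$: $\zeta$ lists every vertex of $G$ exactly once and, for each induced subgraph $H$ of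 $G$, the greedy coloring that scans the vertices of $H$ in the order given by $\zeta$, giving each vertex the smallest positive integer not assigned to an earlier neighbor, uses exactly $\chi(H)$ colors. -/

import Mathlib

namespace GaTEx

open Set

/-! ### Directed graphs, least common ancestors, biconnected components -/

section Networks

variable {W : Type*}

/-- Number of parents of `v`. -/
noncomputable def indeg (N : Digraph W) (v : W) : ℕ := {u | N.Adj u v}.ncard

/-- Number of children of `v`. -/
noncomputable def outdeg (N : Digraph W) (v : W) : ℕ := {u | N.Adj v u}.ncard

/-- There is no directed cycle (in particular, no loop). -/
def IsDAG (N : Digraph W) : Prop := ∀ v, ¬ Relation.TransGen N.Adj v v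

/-- `IsAncestor N u v`: there is a directed path, possibly of length zero, from `u` to `v`. -/
def IsAncestor (N : Digraph W) (u v : W) : Prop := Relation.ReflTransGen N.Adj u v

/-- `w` is a lowest vertex among the common ancestors of all vertices in `A`. -/
def IsLCA (N : Digraph W) (A : Set W) (w : W) : Prop :=
  (∀ a ∈ A, IsAncestor N w a) ∧
    ∀ w', (∀ a ∈ A, IsAncestor N w' a) → IsAncestor N w w' → w' = w

/-- The subgraph induced by `S` is connected and has no vertex whose removal disconnects it
(edge directions are ignored). -/
def IsBiconnected (N : Digraph W) (S : Set W) : Prop :=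
  ((SimpleGraph.fromRel N.Adj).induce S).Connected ∧
    ∀ v ∈ S, ((SimpleGraph.fromRel N.Adj).induce (S \ {v})).Preconnected

/-- Vertex sets of biconnected components. An inclusion-maximal biconnected subgraph is an
induced subgraph, hence is determined by its vertex set. -/
def IsBiconnectedComponent (N : Digraph W) (S : Set W) : Prop := Maximal (IsBiconnected N) S

def IsHybrid (N : Digraph W) (v : W) : Prop := indeg N v = 2 ∧ 1 ≤ outdeg N v

def IsTreeVertex (N : Digraph W) (v : W) : Prop := indeg N v = 1 ∧ 2 ≤ outdeg N v

/-! ### Galled-trees -/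

/-- Conditions (N1)–(N4), for the vertex set `W` and the leaf set `X`. -/
structure IsProperGalledTree (N : Digraph W) (X : Set W) : Prop where
  root : ∃ ρ, indeg N ρ = 0 ∧ 2 ≤ outdeg N ρ ∧ ∀ v, indeg N v = 0 → v = ρ
  leaves : ∀ x, x ∈ X ↔ outdeg N x = 0 ∧ indeg N x = 1
  inner : ∀ v, v ∉ X → indeg N v ≠ 0 → IsTreeVertex N v ∨ IsHybrid N v
  level_one : ∀ S, IsBiconnectedComponent N S → ∀ v ∈ S, ∀ v' ∈ S,
    IsHybrid N v → IsHybrid N v' →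
    (∀ u, N.Adj u v → u ∈ S) → (∀ u, N.Adj u v' → u ∈ S) → v = v'

/-- `N` is a galled-tree with leaf set `X`. -/
def IsGalledTree (N : Digraph W) (X : Set W) : Prop :=
  IsDAG N ∧ ((∃ x : W, (univ : Set W) = {x} ∧ X = {x}) ∨ IsProperGalledTree N X)

/-- A rooted cycle: two directed paths from `root` to `hybrid` that have no inner vertex in
common. The lists `inner₁`, `inner₂` are the inner vertices of the two paths in their order;
not both are empty, so the two paths are different. -/
structure RootedCycle (N : Digraph W) where
  root : W
  hybrid : W
  inner₁ : List W
  inner₂ : List W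
  path₁ : List.IsChain N.Adj (root :: (inner₁ ++ [hybrid]))
  path₂ : List.IsChain N.Adj (root :: (inner₂ ++ [hybrid]))
  nodup : (root :: hybrid :: (inner₁ ++ inner₂)).Nodup
  nontrivial : inner₁ ≠ [] ∨ inner₂ ≠ []

/-- The vertex set of a rooted cycle. -/
def RootedCycle.verts {N : Digraph W} (C : RootedCycle N) : Set W :=
  {v | v ∈ C.root :: C.hybrid :: (C.inner₁ ++ C.inner₂)}

/-- `(u, v)` is an edge of one of the two sides. -/
def RootedCycle.IsEdge {N : Digraph W} (C : RootedCycle N) (u v : W) : Prop :=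
  [u, v] <:+: C.root :: (C.inner₁ ++ [C.hybrid]) ∨
    [u, v] <:+: C.root :: (C.inner₂ ++ [C.hybrid])

/-- Elementary galled-trees: a single rooted cycle of length `|X| + 1` through the root, plus
one pendant leaf at every vertex of the cycle other than the root. -/
def IsElementary (N : Digraph W) (X : Set W) : Prop :=
  IsGalledTree N X ∧ ∃ C : RootedCycle N,
    indeg N C.root = 0 ∧
    C.verts.ncard = X.ncard + 1 ∧
    C.verts ∪ X = univ ∧
    (∀ v ∈ C.verts, v ≠ C.root → ∃! x, x ∈ X ∧ N.Adj v x) ∧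
    ∀ u v, N.Adj u v → C.IsEdge u v ∨ (u ∈ C.verts ∧ u ≠ C.root ∧ v ∈ X)

/-- No rooted cycle has a side without inner vertices, or two sides with exactly one inner
vertex each. -/
def IsStrong (N : Digraph W) : Prop :=
  ∀ C : RootedCycle N, C.inner₁ ≠ [] ∧ C.inner₂ ≠ [] ∧
    ¬ (C.inner₁.length = 1 ∧ C.inner₂.length = 1)

end Networks

/-! ### Labelings and explained graphs -/

/-- Vertex labels. The label `prime` occurs only in modular decomposition trees. -/
inductive VLabel
  | zero
  | one
  | leaf
  | prime

/-- `t` is a labeling by `0`, `1`, `⊙` whose value is `⊙` exactly on the leaf set `X`. -/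
def IsLabeling {W : Type*} (X : Set W) (t : W → VLabel) : Prop :=
  (∀ v, t v = VLabel.leaf ↔ v ∈ X) ∧ ∀ v, t v ≠ VLabel.prime

def IsQuasiDiscriminating {W : Type*} (N : Digraph W) (t : W → VLabel) : Prop :=
  ∀ u v, N.Adj u v → ¬ IsHybrid N v → t u ≠ t v

/-- The graph explained by `(N, t)`, where `ℓ` identifies the vertices of the graph with the
leaves of `N`. -/
def explainedGraph {W X : Type*} (N : Digraph W) (t : W → VLabel) (ℓ : X → W) :
    SimpleGraph X :=
  SimpleGraph.fromRel fun x y => ∃ w, IsLCA N {ℓ x, ℓ y} w ∧ t w = VLabel.one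

/-- `G` is galled-tree explainable. -/
def IsGaTEx {X : Type*} (G : SimpleGraph X) : Prop :=
  ∃ (W : Type) (_ : Finite W) (N : Digraph W) (t : W → VLabel) (ℓ : X → W),
    Function.Injective ℓ ∧ IsGalledTree N (range ℓ) ∧ IsLabeling (range ℓ) t ∧
      explainedGraph N t ℓ = G

/-! ### Modular decomposition -/

section Modules

variable {X : Type*}

/-- `S` is a module of the induced subgraph `G[M]`. -/
def IsModuleOn (G : SimpleGraph X) (M S : Set X) : Prop :=
  S ⊆ M ∧ ∀ x ∈ S, ∀ y ∈ S, ∀ z ∈ M, z ∉ S → (G.Adj x z ↔ G.Adj y z)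

/-- `S` is a strong module of the induced subgraph `G[M]`. -/
def IsStrongModuleOn (G : SimpleGraph X) (M S : Set X) : Prop :=
  IsModuleOn G M S ∧ ∀ S', IsModuleOn G M S' → S ∩ S' = S ∨ S ∩ S' = S' ∨ S ∩ S' = ∅

/-- Vertices of the modular decomposition tree of `G`: the nonempty strong modules of `G`,
ordered by inclusion. `c` is a child of `M` in the tree iff `c ⋖ M`. -/
abbrev MDVertex (G : SimpleGraph X) : Type _ :=
  {M : Set X // M.Nonempty ∧ IsStrongModuleOn G univ M}

open Classical in
/-- The labels of the modular decomposition tree. -/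
noncomputable def mdLabel (G : SimpleGraph X) (M : MDVertex G) : VLabel :=
  if M.1.ncard = 1 then VLabel.leaf
  else if ¬ (G.induce M.1).Connected then VLabel.zero
  else if ¬ (G.induce M.1)ᶜ.Connected then VLabel.one
  else VLabel.prime

/-- The inclusion-maximal strong modules of `G[M]` other than `M`. -/
def maxStrong (G : SimpleGraph X) (M : Set X) : Set (Set X) :=
  {S | Maximal (fun S => S.Nonempty ∧ IsStrongModuleOn G M S ∧ S ≠ M) S}

/-- The quotient of `G[M]` by its maximal strong modules. -/
def quotientGraph (G : SimpleGraph X) (M : Set X) : SimpleGraph (maxStrong G M) :=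
  SimpleGraph.fromRel fun S T => ∃ x ∈ S.1, ∃ y ∈ T.1, G.Adj x y

/-- Strong modules of `G[M]`, for `M` a strong module of `G`, are strong modules of `G`. -/
theorem IsStrongModuleOn.trans {G : SimpleGraph X} {M S : Set X}
    (hM : IsStrongModuleOn G univ M) (hS : IsStrongModuleOn G M S) :
    IsStrongModuleOn G univ S := by
  refine ⟨⟨subset_univ _, fun x hx y hy z _ hz => ?_⟩, fun S' hS' => ?_⟩
  · by_cases hzM : z ∈ M
    · exact hS.1.2 x hx y hy z hzM hz
    · exact hM.1.2 x (hS.1.1 hx) y (hS.1.1 hy) z (mem_univ _) hzM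
  · rcases hM.2 S' hS' with h | h | h
    · exact Or.inl (inter_eq_left.2 (hS.1.1.trans (inter_eq_left.1 h)))
    · exact hS.2 S' ⟨inter_eq_right.1 h,
        fun x hx y hy z _ hz => hS'.2 x hx y hy z (mem_univ _) hz⟩
    · refine Or.inr (Or.inr (subset_eq_empty ?_ h))
      exact inter_subset_inter_left _ hS.1.1

/-- A maximal strong module of `G[M]` as a vertex of the modular decomposition tree of `G`. -/
def childVertex {G : SimpleGraph X} (M : MDVertex G) (S : maxStrong G M.1) : MDVertex G :=
  ⟨S.1, S.2.1.1, M.2.2.trans S.2.1.2.1⟩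

/-- Prime vertices of the modular decomposition tree. -/
abbrev PrimeVertex (G : SimpleGraph X) : Type _ :=
  {M : MDVertex G // mdLabel G M = VLabel.prime}

end Modules

/-! ### Prime-vertex replacement networks -/

section Pvr

variable {X : Type*} {G : SimpleGraph X}

/-- A strong quasi-discriminating elementary galled-tree, together with its root, that explains
the quotient of `G[M]` by its maximal strong modules. -/
structure Replacement (G : SimpleGraph X) (M : Set X) where
  W : Type
  finite : Finite W
  N : Digraph W
  t : W → VLabel
  root : W
  leaf : maxStrong G M → W
  leaf_injective : Function.Injective leaf
  indeg_root : indeg N root = 0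
  elementary : IsElementary N (range leaf)
  strong : IsStrong N
  labeling : IsLabeling (range leaf) t
  quasiDiscriminating : IsQuasiDiscriminating N t
  explains : explainedGraph N t leaf = quotientGraph G M

/-- The choices made in building a prime-vertex replacement (pvr) network of `G`: one
replacement for every prime vertex of the modular decomposition tree. -/
def PvrChoice (G : SimpleGraph X) : Type _ := ∀ P : PrimeVertex G, Replacement G P.1.1

/-- Vertices of the pvr-network: those of the modular decomposition tree, and those vertices of
the replacements that are neither the root nor a leaf. -/
abbrev PvrVertex (R : PvrChoice G) : Type _ :=
  MDVertex G ⊕ (Σ P : PrimeVertex G, {w : (R P).W // w ≠ (R P).root ∧ w ∉ range (R P).leaf})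

/-- `Glue R P w a`: the vertex `w` of the replacement of `P` becomes the vertex `a` of the
pvr-network. The root is identified with `P`, and a leaf with the child of `P` that is the same
module. -/
inductive Glue (R : PvrChoice G) (P : PrimeVertex G) : (R P).W → PvrVertex R → Prop
  | root : Glue R P (R P).root (Sum.inl P.1)
  | leaf (S : maxStrong G P.1.1) : Glue R P ((R P).leaf S) (Sum.inl (childVertex P.1 S))
  | inner (w : {w : (R P).W // w ≠ (R P).root ∧ w ∉ range (R P).leaf}) :
      Glue R P w.1 (Sum.inr ⟨P, w⟩)

/-- Edges of the pvr-network: the tree edges below non-prime vertices, and the edges of the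
replacements. -/
inductive PvrAdj (R : PvrChoice G) : PvrVertex R → PvrVertex R → Prop
  | tree (M c : MDVertex G) : mdLabel G M ≠ VLabel.prime → c ⋖ M →
      PvrAdj R (Sum.inl M) (Sum.inl c)
  | replaced (P : PrimeVertex G) (w w' : (R P).W) (a b : PvrVertex R) :
      (R P).N.Adj w w' → Glue R P w a → Glue R P w' b → PvrAdj R a b

/-- The pvr-network as a directed graph. -/
def pvrNetwork (R : PvrChoice G) : Digraph (PvrVertex R) where
  Adj := PvrAdj R

open Classical in
/-- The labeling of the pvr-network. -/
noncomputable def pvrLabel (R : PvrChoice G) : PvrVertex R → VLabel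
  | Sum.inl M =>
      if h : mdLabel G M = VLabel.prime then (R ⟨M, h⟩).t (R ⟨M, h⟩).root else mdLabel G M
  | Sum.inr ⟨P, w⟩ => (R P).t w.1

end Pvr

/-! ### The algorithm -/

section Algorithm

variable {X : Type*} {G : SimpleGraph X}

/-- The list `l` contains every element of `s` exactly once, and nothing else. -/
def Enumerates {α : Type*} (l : List α) (s : Set α) : Prop := l.Nodup ∧ ∀ a, a ∈ l ↔ a ∈ s

/-- `Postorder M l`: the list `l` is a postorder of the subtree of the modular decomposition
tree that is rooted at `M` (the children are visited in an arbitrary order). -/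
inductive Postorder : MDVertex G → List (MDVertex G) → Prop
  | mk (M : MDVertex G) (cs : List (MDVertex G)) (f : MDVertex G → List (MDVertex G)) :
      Enumerates cs {c | c ⋖ M} → (∀ c ∈ cs, Postorder c (f c)) →
      Postorder M (cs.flatMap f ++ [M])

/-- The state of the algorithm: the current value of `ζ(w)` for every vertex `w` of the
pvr-network. -/
abbrev AlgState (R : PvrChoice G) : Type _ := PvrVertex R → List X

open Classical in
/-- `Step R M ζ ζ'`: processing the vertex `M` can turn the state `ζ` into `ζ'`. Leaves are
skipped. At a prime vertex, `C` is the cycle of the network with root `M`, the state `ζ₁` is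
reached after copying to each vertex `w ≠ M` of `C` the value at its child outside `C`, and `vs`
is the arbitrary order of the vertices of `C` other than its root and its hybrid-vertex. -/
inductive Step (R : PvrChoice G) : MDVertex G → AlgState R → AlgState R → Prop
  | leaf (M : MDVertex G) (ζ : AlgState R) : mdLabel G M = VLabel.leaf → Step R M ζ ζ
  | nonprime (M : MDVertex G) (ζ : AlgState R) (cs : List (MDVertex G)) :
      (mdLabel G M = VLabel.zero ∨ mdLabel G M = VLabel.one) →
      Enumerates cs {c | c ⋖ M} →
      Step R M ζ (Function.update ζ (Sum.inl M) (cs.flatMap fun c => ζ (Sum.inl c)))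
  | prime (M : MDVertex G) (ζ ζ₁ : AlgState R) (C : RootedCycle (pvrNetwork R))
      (vs : List (PvrVertex R)) :
      mdLabel G M = VLabel.prime →
      C.root = Sum.inl M →
      (∀ w ∈ C.verts, w ≠ C.root →
        ∃ w', (pvrNetwork R).Adj w w' ∧ w' ∉ C.verts ∧ ζ₁ w = ζ w') →
      (∀ w, ¬ (w ∈ C.verts ∧ w ≠ C.root) → ζ₁ w = ζ w) →
      Enumerates vs (C.verts \ {C.root, C.hybrid}) →
      Step R M ζ (Function.update ζ₁ (Sum.inl M)
        (if pvrLabel R C.root = VLabel.zero then ζ₁ C.hybrid ++ vs.flatMap ζ₁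
          else vs.flatMap ζ₁ ++ ζ₁ C.hybrid))

/-- The loop over a list of vertices. -/
inductive Loop (R : PvrChoice G) : List (MDVertex G) → AlgState R → AlgState R → Prop
  | nil (ζ : AlgState R) : Loop R [] ζ ζ
  | cons (M : MDVertex G) (l : List (MDVertex G)) (ζ ζ' ζ'' : AlgState R) :
      Step R M ζ ζ' → Loop R l ζ' ζ'' → Loop R (M :: l) ζ ζ''

/-- `AlgReturns R o`: the algorithm, run with the pvr-network given by `R`, can return the
sequence `o`. Initially `ζ(x) = x` for every leaf `x`; the other values are arbitrary. The root
of the modular decomposition tree is the module of all vertices. -/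
def AlgReturns (R : PvrChoice G) (o : List X) : Prop :=
  ∃ (root : MDVertex G) (l : List (MDVertex G)) (ζ ζ' : AlgState R),
    root.1 = univ ∧ Postorder root l ∧
    (∀ (x : X) (M : MDVertex G), M.1 = {x} → ζ (Sum.inl M) = [x]) ∧
    Loop R l ζ ζ' ∧ o = ζ' (Sum.inl root)

end Algorithm

/-! ### Perfect orders -/

section PerfectOrder

open Classical in
/-- Greedy coloring of `H` along a sequence of vertices. Colors are positive integers; the value
`0` stands for a vertex that is not colored yet. -/
noncomputable def greedyColoring {Y : Type*} (H : SimpleGraph Y) (l : List Y) : Y → ℕ :=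
  l.foldl (fun c v => Function.update c v (sInf {k | 0 < k ∧ ∀ w, H.Adj v w → c w ≠ k}))
    fun _ => 0

open Classical in
/-- The restriction of a sequence of vertices to the elements of `Y`. -/
noncomputable def restrictOrder {X : Type*} (o : List X) (Y : Set X) : List Y :=
  o.filterMap fun x => if h : x ∈ Y then some ⟨x, h⟩ else none

/-- The sequence `o` is a total order of the vertices of `G` along which the greedy algorithm
colors every induced subgraph with the minimum number of colors. -/
def IsPerfectOrder {X : Type*} (G : SimpleGraph X) (o : List X) : Prop :=
  Enumerates o univ ∧ ∀ Y : Set X,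
    ((range (greedyColoring (G.induce Y) (restrictOrder o Y))).ncard : ℕ∞) =
      (G.induce Y).chromaticNumber

end PerfectOrder

end GaTEx

/-!
By Chvátal, an order of the vertices is perfect as soon as no induced path `a b c d` has `a`
before `b` and `d` before `c`. An induced `P₄` of `G` that meets a vertex `M` of the modular
decomposition tree either lies in one child of `M` or meets four distinct children, so obstructions
can only arise at prime vertices. There the quotient is explained by an elementary galled-tree:
leaves on the same side of the cycle are joined according to the label of the upper one, and leaves
on opposite sides according to the label of the root. Hence every induced `P₄` of the quotient uses
the leaf below the hybrid-vertex, as an end if the root has label `1` and as an inner vertex if the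
root has label `0`; placing that leaf last, respectively first, excludes the obstruction.

For the existence of pvr-networks, order the vertices of a galled-tree explaining `G` by ancestry.
A vertex that is incomparable to two others but has common descendants with both meets them in the
same part of its descendants, and no three vertices overlap pairwise. In a prime quotient this
forces the blocks, apart from one common block, to form two chains; their labels alternate because
consecutive blocks with equal labels would form a module. This is the required elementary
galled-tree.
-/

namespace GaTEx

open Set
open scoped List

/-! ### Chvátal's criterion for perfect orders -/

section Lists

variable {α : Type*} {l : List α} {a b c : α}

theorem pair_sublist_iff_idxOf_lt [DecidableEq α] (hl : l.Nodup) :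
    [a, b] <+ l ↔ b ∈ l ∧ l.idxOf a < l.idxOf b := by
  induction l with
  | nil => simp
  | cons x l ih =>
    rw [List.nodup_cons] at hl
    simp only [List.idxOf_cons, List.mem_cons, List.sublist_cons_iff, ih hl.2]
    grind

theorem pair_sublist_trans (hl : l.Nodup) (hab : [a, b] <+ l) (hbc : [b, c] <+ l) :
    [a, c] <+ l := by
  classical
  rw [pair_sublist_iff_idxOf_lt hl] at *
  exact ⟨hbc.1, hab.2.trans hbc.2⟩

theorem not_pair_sublist_swap (hl : l.Nodup) (hab : [a, b] <+ l) : ¬ [b, a] <+ l := fun hba => by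
  simpa using (pair_sublist_trans hl hab hba).nodup hl

theorem pair_sublist_or_of_ne (ha : a ∈ l) (hb : b ∈ l) (hab : a ≠ b) :
    [a, b] <+ l ∨ [b, a] <+ l := by
  induction l with
  | nil => simp at ha
  | cons x l ih => grind

theorem not_pair_sublist_cons (hl : (a :: l).Nodup) : ¬ [b, a] <+ a :: l := by
  rw [List.nodup_cons] at hl
  grind

theorem not_pair_sublist_concat (hl : (l ++ [a]).Nodup) : ¬ [a, b] <+ l ++ [a] := fun h =>
  not_pair_sublist_cons (l := l.reverse) (by simpa using List.nodup_reverse.2 hl)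
    (by simpa using List.reverse_sublist.2 h)

theorem exists_first_mem (hl : l.Nodup) {C : Finset α} (hC : C.Nonempty) (hCl : ∀ x ∈ C, x ∈ l) :
    ∃ v ∈ C, ∀ w ∈ C, w ≠ v → [v, w] <+ l := by
  classical
  obtain ⟨v, hv, hmin⟩ := C.exists_min_image l.idxOf hC
  refine ⟨v, hv, fun w hw hne => (pair_sublist_iff_idxOf_lt hl).2 ⟨hCl w hw, ?_⟩⟩
  exact (hmin w hw).lt_of_ne fun h => hne ((List.idxOf_inj (hCl v hv)).1 h).symm

end Lists

/-- `a - b - c - d` is an induced path. -/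
structure IsP4 {X : Type*} (G : SimpleGraph X) (a b c d : X) : Prop where
  ab : G.Adj a b
  bc : G.Adj b c
  cd : G.Adj c d
  ac : ¬ G.Adj a c
  bd : ¬ G.Adj b d
  ad : ¬ G.Adj a d

/-- No induced path `a - b - c - d` has `a` before `b` and `d` before `c` in `l`: Chvátal's
criterion for a perfect order. That `u` comes before `v` in `l` is encoded as `[u, v] <+ l`. -/
def ObstructionFree {X : Type*} (G : SimpleGraph X) (l : List X) : Prop :=
  ∀ a b c d, IsP4 G a b c d → [a, b] <+ l → ¬ [d, c] <+ l

section Chvatal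

variable {Y : Type*} {H : SimpleGraph Y} {l : List Y}

/-- `p` assigns to the vertices of `C` earlier neighbors, any two of which are non-adjacent. The
earlier neighbors that have one fixed greedy color are of this kind. -/
structure IsEarlierStableChoice (H : SimpleGraph Y) (l : List Y) (C : Finset Y) (p : Y → Y) :
    Prop where
  adj : ∀ w ∈ C, H.Adj w (p w)
  earlier : ∀ w ∈ C, [p w, w] <+ l
  stable : ∀ u ∈ C, ∀ v ∈ C, ¬ H.Adj (p u) (p v)

theorem IsEarlierStableChoice.mono {C D : Finset Y} {p : Y → Y}
    (h : IsEarlierStableChoice H l D p) (hCD : C ⊆ D) : IsEarlierStableChoice H l C p where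
  adj w hw := h.adj w (hCD hw)
  earlier w hw := h.earlier w (hCD hw)
  stable u hu v hv := h.stable u (hCD hu) v (hCD hv)

/-- The map `f` is a permutation of the clique, and an obstruction appears at the clique vertices
`b`, `f b` and `f (f b)` for which `f (f b)` comes first in `l`. -/
theorem not_obstructionFree_of_misses_one (hl : l.Nodup) {C : Finset Y} (hC : C.Nonempty)
    (hclique : H.IsClique (C : Set Y)) {p : Y → Y} (hp : IsEarlierStableChoice H l C p)
    {f : C → C} (hne : ∀ w, f w ≠ w) (hadj : ∀ w v : C, v ≠ w → H.Adj (p (f w)) v)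
    (hnot : ∀ w, ¬ H.Adj (p (f w)) w) : ¬ ObstructionFree H l := by
  intro hH
  have hinj : Function.Injective f := fun w w' e => by
    by_contra hww
    exact hnot w' (e ▸ hadj w w' (Ne.symm hww))
  have hsurj : Function.Surjective f := Finite.surjective_of_injective hinj
  have hmem : ∀ x ∈ C, x ∈ l := fun x hx => (hp.earlier x hx).subset (by simp)
  obtain ⟨v, hv, hfirst⟩ := exists_first_mem hl hC hmem
  obtain ⟨w, hw⟩ := hsurj ⟨v, hv⟩
  obtain ⟨b, hb⟩ := hsurj w
  have hbw : b ≠ w := fun e => hne b (hb.trans e.symm)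
  have hpv : H.Adj (p v) b ∧ ¬ H.Adj (p v) w := by
    simpa only [hw] using And.intro (hadj w b hbw) (hnot w)
  have hpw : ¬ H.Adj (p w) b := by simpa only [hb] using hnot b
  have hpath : IsP4 H (p v) b w (p w) :=
    ⟨hpv.1, hclique b.2 w.2 (Subtype.coe_injective.ne hbw), hp.adj w w.2, hpv.2,
      fun h => hpw h.symm, hp.stable v hv w w.2⟩
  have hearlier : [p v, b.1] <+ l := by
    by_cases hbv : b.1 = v
    · exact hbv ▸ hp.earlier v hv
    · exact pair_sublist_trans hl (hp.earlier v hv) (hfirst b b.2 hbv)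
  exact hH _ _ _ _ hpath hearlier (hp.earlier w w.2)

theorem exists_adj_all_of_obstructionFree (hl : l.Nodup) (hH : ObstructionFree H l) {p : Y → Y}
    {C : Finset Y} (hC : C.Nonempty) (hclique : H.IsClique (C : Set Y))
    (hp : IsEarlierStableChoice H l C p) : ∃ w ∈ C, ∀ v ∈ C, H.Adj (p w) v := by
  classical
  induction C using Finset.strongInduction with
  | H C ih =>
    by_contra! hcon
    have hmiss : ∀ w : C, ∃ u : C, u ≠ w ∧ (∀ v : C, v ≠ w → H.Adj (p u) v) ∧
        ¬ H.Adj (p u) w := by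
      rintro ⟨w, hw⟩
      obtain ⟨v, hv, hwv⟩ := hcon w hw
      have hvw : v ≠ w := fun h => hwv (h ▸ (hp.adj w hw).symm)
      have hsub : C.erase w ⊆ C := Finset.erase_subset w C
      obtain ⟨u, hu, huC⟩ := ih _ (Finset.erase_ssubset hw) ⟨v, Finset.mem_erase.2 ⟨hvw, hv⟩⟩
        (hclique.subset (by exact_mod_cast hsub)) (hp.mono hsub)
      obtain ⟨huw, hu⟩ := Finset.mem_erase.1 hu
      have hadj : ∀ v ∈ C, v ≠ w → H.Adj (p u) v := fun v hv hvw =>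
        huC v (Finset.mem_erase.2 ⟨hvw, hv⟩)
      refine ⟨⟨u, hu⟩, Subtype.coe_ne_coe.1 huw, fun v hv => hadj v v.2 (Subtype.coe_ne_coe.2 hv),
        fun huw' => ?_⟩
      obtain ⟨v, hv, huv⟩ := hcon u hu
      exact huv (if hvw : v = w then hvw ▸ huw' else hadj v hv hvw)
    choose f hfne hfadj hfnot using hmiss
    exact not_obstructionFree_of_misses_one hl hC hclique hp hfne hfadj hfnot hH

/-- The color that the greedy algorithm gives to `v` when the coloring so far is `c`. -/
noncomputable def nextColor (H : SimpleGraph Y) (c : Y → ℕ) (v : Y) : ℕ :=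
  sInf {k | 0 < k ∧ ∀ w, H.Adj v w → c w ≠ k}

theorem nextColor_spec [Finite Y] (c : Y → ℕ) (v : Y) :
    0 < nextColor H c v ∧ ∀ w, H.Adj v w → c w ≠ nextColor H c v := by
  have hne : {k | 0 < k ∧ ∀ w, H.Adj v w → c w ≠ k}.Nonempty := by
    obtain ⟨B, hB⟩ := (Set.finite_range c).bddAbove
    exact ⟨B + 1, B.succ_pos, fun w _ => (Nat.lt_succ_of_le (hB (mem_range_self w))).ne⟩
  exact Nat.sInf_mem hne

theorem exists_adj_of_lt_nextColor {c : Y → ℕ} {v : Y} {k : ℕ} (hk : 0 < k)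
    (h : k < nextColor H c v) : ∃ w, H.Adj v w ∧ c w = k := by
  simpa [hk] using Nat.notMem_of_lt_sInf h

open Classical in
theorem greedyColoring_concat (l : List Y) (v : Y) :
    greedyColoring H (l ++ [v]) =
      Function.update (greedyColoring H l) v (nextColor H (greedyColoring H l) v) := by
  simp [greedyColoring, nextColor, List.foldl_append]

theorem greedyColoring_append_of_notMem {l' : List Y} {v : Y} (hv : v ∉ l') :
    greedyColoring H (l ++ l') v = greedyColoring H l v := by
  classical
  induction l' using List.reverseRecOn with
  | nil => simp
  | append_singleton l' w ih =>
    simp only [List.mem_append, List.mem_singleton, not_or] at hv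
    rw [← List.append_assoc, greedyColoring_concat, Function.update_of_ne hv.2, ih hv.1]

theorem greedyColoring_of_notMem {v : Y} (hv : v ∉ l) : greedyColoring H l v = 0 :=
  greedyColoring_append_of_notMem (l := []) hv

theorem greedyColoring_append_cons {l' : List Y} {v : Y} (hv : v ∉ l') :
    greedyColoring H (l ++ v :: l') v = nextColor H (greedyColoring H l) v := by
  classical
  rw [← List.singleton_append, ← List.append_assoc, greedyColoring_append_of_notMem hv,
    greedyColoring_concat, Function.update_self]

theorem greedyColoring_pos [Finite Y] (hl : l.Nodup) {v : Y} (hv : v ∈ l) :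
    0 < greedyColoring H l v := by
  obtain ⟨l₁, l₂, rfl⟩ := List.append_of_mem hv
  rw [greedyColoring_append_cons (by grind)]
  exact (nextColor_spec _ v).1

theorem greedyColoring_ne_of_pair_sublist [Finite Y] (hl : l.Nodup) {u v : Y} (huv : H.Adj u v)
    (h : [u, v] <+ l) : greedyColoring H l u ≠ greedyColoring H l v := by
  obtain ⟨l₁, l₂, rfl⟩ := List.append_of_mem (h.subset (by simp : v ∈ [u, v]))
  have hv : v ∉ l₁ ∧ v ∉ l₂ := by grind
  have hu : u ∉ v :: l₂ := by
    classical
    rw [pair_sublist_iff_idxOf_lt hl] at h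
    grind
  rw [greedyColoring_append_cons hv.2, greedyColoring_append_of_notMem hu]
  exact (nextColor_spec _ v).2 u huv.symm

theorem greedyColoring_ne_of_adj [Finite Y] (hl : l.Nodup) {u v : Y} (hu : u ∈ l) (hv : v ∈ l)
    (huv : H.Adj u v) : greedyColoring H l u ≠ greedyColoring H l v :=
  (pair_sublist_or_of_ne hu hv huv.ne).elim (greedyColoring_ne_of_pair_sublist hl huv)
    fun h => (greedyColoring_ne_of_pair_sublist hl huv.symm h).symm

theorem exists_earlier_adj_of_lt_greedyColoring (hl : l.Nodup) {v : Y} (hv : v ∈ l) {k : ℕ}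
    (hk : 0 < k) (h : k < greedyColoring H l v) :
    ∃ w, H.Adj v w ∧ greedyColoring H l w = k ∧ [w, v] <+ l := by
  obtain ⟨l₁, l₂, rfl⟩ := List.append_of_mem hv
  rw [greedyColoring_append_cons (by grind)] at h
  obtain ⟨w, hvw, hw⟩ := exists_adj_of_lt_nextColor hk h
  have hwl : w ∈ l₁ := by
    by_contra hwl
    exact hk.ne (by rw [← hw, greedyColoring_of_notMem hwl])
  refine ⟨w, hvw, ?_, ?_⟩
  · rw [greedyColoring_append_of_notMem (by grind), hw]
  · exact (List.singleton_sublist.2 hwl).append (List.singleton_sublist.2 List.mem_cons_self)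

theorem exists_adj_all_of_lt_greedyColoring [Finite Y] (hl : Enumerates l univ)
    (hH : ObstructionFree H l) {C : Finset Y} (hne : C.Nonempty) (hC : H.IsClique (C : Set Y))
    {k : ℕ} (hk : 0 < k) (hCk : ∀ v ∈ C, k < greedyColoring H l v) :
    ∃ u, greedyColoring H l u = k ∧ ∀ v ∈ C, H.Adj u v := by
  have hmem : ∀ u, u ∈ l := fun u => (hl.2 u).2 (mem_univ u)
  choose! p hadj hcolor hearlier using fun v (hv : v ∈ C) =>
    exists_earlier_adj_of_lt_greedyColoring hl.1 (hmem v) hk (hCk v hv)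
  have hp : IsEarlierStableChoice H l C p :=
    ⟨hadj, hearlier, fun u hu v hv huv => greedyColoring_ne_of_adj hl.1 (hmem _) (hmem _) huv
      ((hcolor u hu).trans (hcolor v hv).symm)⟩
  obtain ⟨w, hw, hwC⟩ := exists_adj_all_of_obstructionFree hl.1 hH hne hC hp
  exact ⟨p w, hcolor w hw, hwC⟩

theorem exists_isClique_card_eq_greedyColoring [Finite Y] (hl : Enumerates l univ)
    (hH : ObstructionFree H l) (v : Y) :
    ∃ C : Finset Y, H.IsClique (C : Set Y) ∧ C.card = greedyColoring H l v := by
  classical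
  set n := greedyColoring H l v with hn
  have hgrow : ∀ m < n, ∃ C : Finset Y, H.IsClique (C : Set Y) ∧ C.card = m + 1 ∧
      ∀ u ∈ C, n - m ≤ greedyColoring H l u := by
    intro m hm
    induction m with
    | zero => exact ⟨{v}, by simp, by simp, by simp [hn]⟩
    | succ m ih =>
      obtain ⟨C, hC, hcard, hcolor⟩ := ih (by omega)
      obtain ⟨u, hu, huC⟩ := exists_adj_all_of_lt_greedyColoring hl hH
        (Finset.card_pos.1 (by omega)) hC (k := n - (m + 1)) (by omega)
        fun w hw => by have := hcolor w hw; omega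
      refine ⟨insert u C, ?_, ?_, ?_⟩
      · rw [Finset.coe_insert]
        exact hC.insert fun w hw _ => huC w hw
      · rw [Finset.card_insert_of_notMem fun h => (huC u h).ne rfl, hcard]
      · simp only [Finset.forall_mem_insert]
        exact ⟨hu.ge, fun w hw => by have := hcolor w hw; omega⟩
  have hpos : 0 < n := greedyColoring_pos hl.1 ((hl.2 v).2 (mem_univ v))
  obtain ⟨C, hC, hcard, -⟩ := hgrow (n - 1) (by omega)
  exact ⟨C, hC, by omega⟩

theorem chromaticNumber_le_ncard_range_greedyColoring [Finite Y] (hl : Enumerates l univ) :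
    H.chromaticNumber ≤ (range (greedyColoring H l)).ncard := by
  have hmem : ∀ u, u ∈ l := fun u => (hl.2 u).2 (mem_univ u)
  have := Fintype.ofFinite (range (greedyColoring H l))
  let c : H.Coloring (range (greedyColoring H l)) := SimpleGraph.Coloring.mk
    (rangeFactorization (greedyColoring H l)) fun huv e =>
      greedyColoring_ne_of_adj hl.1 (hmem _) (hmem _) huv (congrArg Subtype.val e)
  have hc := c.colorable.chromaticNumber_le
  rwa [← Nat.card_eq_fintype_card, Nat.card_coe_set_eq] at hc

theorem ncard_range_greedyColoring_le_chromaticNumber [Finite Y] (hl : Enumerates l univ)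
    (hH : ObstructionFree H l) : (range (greedyColoring H l)).ncard ≤ H.chromaticNumber := by
  rcases isEmpty_or_nonempty Y with hY | hY
  · simp [range_eq_empty]
  obtain ⟨v, hv⟩ := Finite.exists_max (greedyColoring H l)
  obtain ⟨C, hC, hcard⟩ := exists_isClique_card_eq_greedyColoring hl hH v
  have hsub : range (greedyColoring H l) ⊆ Finset.Icc 1 (greedyColoring H l v) := by
    rintro _ ⟨u, rfl⟩
    exact Finset.mem_coe.2 <| Finset.mem_Icc.2
      ⟨greedyColoring_pos hl.1 ((hl.2 u).2 (mem_univ u)), hv u⟩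
  have hle : (range (greedyColoring H l)).ncard ≤ C.card := by
    calc (range (greedyColoring H l)).ncard
      _ ≤ (Finset.Icc 1 (greedyColoring H l v)).card :=
        (Set.ncard_le_ncard hsub).trans_eq (Set.ncard_coe_finset _)
      _ = C.card := by rw [Nat.card_Icc, hcard, Nat.add_sub_cancel]
  exact le_trans (by exact_mod_cast hle) hC.card_le_chromaticNumber

end Chvatal

/-- The sequence `l` enumerates `S` without obstructions. -/
def IsGoodOrder {X : Type*} (G : SimpleGraph X) (S : Set X) (l : List X) : Prop :=
  Enumerates l S ∧ ObstructionFree G l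

section PerfectOrder

variable {X : Type*}

theorem restrictOrder_map_val_sublist (o : List X) (Y : Set X) :
    (restrictOrder o Y).map Subtype.val <+ o := by
  induction o with
  | nil => simp [restrictOrder]
  | cons x o ih =>
    by_cases hx : x ∈ Y
    · simpa [restrictOrder, hx] using ih
    · simpa [restrictOrder, hx] using ih.cons x

theorem IsGoodOrder.restrictOrder {G : SimpleGraph X} {o : List X} (h : IsGoodOrder G univ o)
    (Y : Set X) : IsGoodOrder (G.induce Y) univ (restrictOrder o Y) := by
  have hsub := restrictOrder_map_val_sublist o Y
  refine ⟨⟨.of_map _ (hsub.nodup h.1.1), fun a => ?_⟩, fun a b c d hP hab hdc => ?_⟩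
  · simp only [GaTEx.restrictOrder, List.mem_filterMap, mem_univ, iff_true]
    exact ⟨a, (h.1.2 a).2 (mem_univ _), by simp⟩
  · exact h.2 a b c d ⟨hP.ab, hP.bc, hP.cd, hP.ac, hP.bd, hP.ad⟩
      ((hab.map Subtype.val).trans hsub) ((hdc.map Subtype.val).trans hsub)

theorem IsGoodOrder.isPerfectOrder [Finite X] {G : SimpleGraph X} {o : List X}
    (h : IsGoodOrder G univ o) : IsPerfectOrder G o := by
  refine ⟨h.1, fun Y => ?_⟩
  obtain ⟨henum, hfree⟩ := h.restrictOrder Y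
  exact le_antisymm (ncard_range_greedyColoring_le_chromaticNumber henum hfree)
    (chromaticNumber_le_ncard_range_greedyColoring henum)

end PerfectOrder

/-! ### Modules and good orders -/

section Modules

variable {X : Type*} {G : SimpleGraph X} {M S T U : Set X}

theorem isModuleOn_compl_iff : IsModuleOn Gᶜ M S ↔ IsModuleOn G M S := by
  refine and_congr_right fun _ => forall₄_congr fun x hx y hy => forall₃_congr fun z _ hz => ?_
  have hxz : x ≠ z := ne_of_mem_of_not_mem hx hz
  have hyz : y ≠ z := ne_of_mem_of_not_mem hy hz
  simp only [SimpleGraph.compl_adj, ne_eq, hxz, hyz, not_false_eq_true, true_and, not_iff_not]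

theorem IsModuleOn.union (hS : IsModuleOn G M S) (hT : IsModuleOn G M T) (h : (S ∩ T).Nonempty) :
    IsModuleOn G M (S ∪ T) := by
  obtain ⟨i, hiS, hiT⟩ := h
  have hi : ∀ x ∈ S ∪ T, ∀ w ∈ M, w ∉ S ∪ T → (G.Adj x w ↔ G.Adj i w) := by
    rintro x (hx | hx) w hw hwST
    · exact hS.2 x hx i hiS w hw fun h => hwST (Or.inl h)
    · exact hT.2 x hx i hiT w hw fun h => hwST (Or.inr h)
  exact ⟨union_subset hS.1 hT.1,
    fun x hx y hy w hw hwST => (hi x hx w hw hwST).trans (hi y hy w hw hwST).symm⟩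

theorem isStrongModuleOn_iff_of_isStrongModuleOn (hM : IsStrongModuleOn G univ M) :
    IsStrongModuleOn G M S ↔ S ⊆ M ∧ IsStrongModuleOn G univ S := by
  refine ⟨fun h => ⟨h.1.1, hM.trans h⟩, fun ⟨hSM, hS⟩ =>
    ⟨⟨hSM, fun x hx y hy z _ hz => hS.1.2 x hx y hy z (mem_univ _) hz⟩, fun S' hS' => ?_⟩⟩
  refine hS.2 S' ⟨subset_univ _, fun x hx y hy z _ hz => ?_⟩
  by_cases hzM : z ∈ M
  · exact hS'.2 x hx y hy z hzM hz
  · exact hM.1.2 x (hS'.1 hx) y (hS'.1 hy) z (mem_univ _) hzM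

theorem isStrongModuleOn_singleton {x : X} (hx : x ∈ M) : IsStrongModuleOn G M {x} := by
  refine ⟨⟨singleton_subset_iff.2 hx, ?_⟩, fun S' _ => ?_⟩
  · rintro a rfl b rfl z - -
    exact Iff.rfl
  · by_cases h : x ∈ S'
    · exact Or.inl (inter_eq_left.2 (singleton_subset_iff.2 h))
    · exact Or.inr (Or.inr (singleton_inter_eq_empty.2 h))

theorem isStrongModuleOn_self : IsStrongModuleOn G M M :=
  ⟨⟨subset_rfl, fun _ _ _ _ _ hz hz' => absurd hz hz'⟩,
    fun _ hS' => Or.inr (Or.inl (inter_eq_right.2 hS'.1))⟩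

theorem maxStrong_subset (hS : S ∈ maxStrong G M) : S ⊆ M := hS.1.2.1.1.1

theorem maxStrong_nonempty (hS : S ∈ maxStrong G M) : S.Nonempty := hS.1.1

theorem maxStrong_isModuleOn (hS : S ∈ maxStrong G M) : IsModuleOn G M S := hS.1.2.1.1

theorem maxStrong_ne (hS : S ∈ maxStrong G M) : S ≠ M := hS.1.2.2

theorem maxStrong_compl : maxStrong Gᶜ M = maxStrong G M := by
  simp only [maxStrong, IsStrongModuleOn, isModuleOn_compl_iff]

theorem maxStrong_eq_of_mem (hS : S ∈ maxStrong G M) (hT : T ∈ maxStrong G M) {x : X}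
    (hxS : x ∈ S) (hxT : x ∈ T) : S = T := by
  rcases hS.1.2.1.2 T hT.1.2.1.1 with h | h | h
  · exact subset_antisymm (inter_eq_left.1 h) (hS.2 hT.1 (inter_eq_left.1 h))
  · exact subset_antisymm (hT.2 hS.1 (inter_eq_right.1 h)) (inter_eq_right.1 h)
  · exact absurd (h ▸ ⟨hxS, hxT⟩ : x ∈ (∅ : Set X)) (notMem_empty x)

theorem maxStrong_disjoint (hS : S ∈ maxStrong G M) (hT : T ∈ maxStrong G M) (hST : S ≠ T) :
    Disjoint S T :=
  Set.disjoint_left.2 fun _ hxS hxT => hST (maxStrong_eq_of_mem hS hT hxS hxT)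

theorem exists_maxStrong_superset [Finite X] (hne : S.Nonempty) (hS : IsStrongModuleOn G M S)
    (hSM : S ≠ M) : ∃ T ∈ maxStrong G M, S ⊆ T := by
  obtain ⟨T, hST, hT⟩ := (Set.toFinite
    {S | S.Nonempty ∧ IsStrongModuleOn G M S ∧ S ≠ M}).exists_le_maximal ⟨hne, hS, hSM⟩
  exact ⟨T, hT, hST⟩

theorem exists_mem_maxStrong [Finite X] (hM : M.ncard ≠ 1) {x : X} (hx : x ∈ M) :
    ∃ S ∈ maxStrong G M, x ∈ S := by
  obtain ⟨T, hT, hxT⟩ := exists_maxStrong_superset (singleton_nonempty x)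
    (isStrongModuleOn_singleton (G := G) hx) fun h => hM (h ▸ ncard_singleton x)
  exact ⟨T, hT, hxT rfl⟩

theorem covBy_iff_mem_maxStrong (c M : MDVertex G) : c ⋖ M ↔ c.1 ∈ maxStrong G M.1 := by
  have hproper : ∀ d : MDVertex G, d < M ↔
      d.1.Nonempty ∧ IsStrongModuleOn G M.1 d.1 ∧ d.1 ≠ M.1 := fun d => by
    rw [isStrongModuleOn_iff_of_isStrongModuleOn M.2.2, lt_iff_le_and_ne, ← Subtype.coe_ne_coe]
    exact ⟨fun h => ⟨d.2.1, ⟨h.1, d.2.2⟩, h.2⟩, fun h => ⟨h.2.1.1, h.2.2⟩⟩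
  constructor
  · rintro ⟨hcM, hc⟩
    refine ⟨(hproper c).1 hcM, fun S hS hcS => ?_⟩
    by_contra hSc
    exact hc (c := ⟨S, hS.1, M.2.2.trans hS.2.1⟩) (lt_of_le_not_ge hcS hSc) ((hproper _).2 hS)
  · exact fun h => ⟨(hproper c).2 h.1, fun d hcd hdM =>
      hcd.not_ge (h.2 ((hproper d).1 hdM) hcd.le)⟩

end Modules

section Connectivity

variable {X : Type*} {G : SimpleGraph X} {M S T U : Set X}

theorem exists_adj_across_cut {V : Type*} {H : SimpleGraph V} (hH : H.Preconnected) {T : Set V}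
    {x y : V} (hx : x ∈ T) (hy : y ∉ T) : ∃ a b, a ∈ T ∧ b ∉ T ∧ H.Adj a b := by
  obtain ⟨d, -, hd⟩ := (hH x y).some.exists_boundary_dart T hx hy
  exact ⟨d.fst, d.snd, hd.1, hd.2, d.adj⟩

theorem isStrongModuleOn_image_supp (C : (G.induce M).ConnectedComponent) :
    IsStrongModuleOn G M (Subtype.val '' C.supp) := by
  have hadj : ∀ {a b : X}, a ∈ Subtype.val '' C.supp → b ∈ M → G.Adj a b →
      b ∈ Subtype.val '' C.supp := by
    rintro _ b ⟨a, ha, rfl⟩ hb hab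
    exact ⟨⟨b, hb⟩, C.mem_supp_of_adj_mem_supp ha hab, rfl⟩
  refine ⟨⟨Subtype.coe_image_subset M C.supp, fun a ha b hb z hz hzC => ?_⟩, fun B hB => ?_⟩
  · exact iff_of_false (fun h => hzC (hadj ha hz h)) fun h => hzC (hadj hb hz h)
  by_cases hsub : Subtype.val '' C.supp ⊆ B
  · exact Or.inl (inter_eq_left.2 hsub)
  rcases eq_empty_or_nonempty (Subtype.val '' C.supp ∩ B) with hempty | hne
  · exact Or.inr (Or.inr hempty)
  refine Or.inr (Or.inl (inter_eq_right.2 fun s hs => ?_))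
  obtain ⟨_, ⟨k, hk, rfl⟩, hkB⟩ := hne
  obtain ⟨_, ⟨k', hk', rfl⟩, hk'B⟩ := not_subset.1 hsub
  obtain ⟨a, b, haB, hbB, hab⟩ := exists_adj_across_cut C.connected_toSimpleGraph.preconnected
    (T := {c | c.1.1 ∈ B}) (x := ⟨k, hk⟩) (y := ⟨k', hk'⟩) hkB hk'B
  have hsb : G.Adj s b.1.1 := (hB.2 _ haB s hs _ b.1.2 hbB).1 hab
  exact hadj ⟨b.1, b.2, rfl⟩ (hB.1 hs) hsb.symm

theorem not_adj_of_not_connected [Finite X] (hcon : ¬ (G.induce M).Connected)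
    (hS : S ∈ maxStrong G M) (hT : T ∈ maxStrong G M) (hST : S ≠ T) {x y : X} (hx : x ∈ S)
    (hy : y ∈ T) : ¬ G.Adj x y := by
  intro hadj
  let x' : M := ⟨x, maxStrong_subset hS hx⟩
  let y' : M := ⟨y, maxStrong_subset hT hy⟩
  let C := (G.induce M).connectedComponentMk x'
  have hxC : x' ∈ C.supp := rfl
  have hyC : y' ∈ C.supp := C.mem_supp_of_adj_mem_supp hxC hadj
  have hne : Subtype.val '' C.supp ≠ M := fun h => hcon <| by
    have : Nonempty M := ⟨x'⟩
    have hmem : ∀ a : M, a ∈ C.supp := fun a => by simpa using h.ge a.2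
    exact ⟨fun a b => SimpleGraph.ConnectedComponent.exact ((hmem a).trans (hmem b).symm)⟩
  obtain ⟨U, hU, hCU⟩ := exists_maxStrong_superset (Set.Nonempty.image _ ⟨x', hxC⟩)
    (isStrongModuleOn_image_supp C) hne
  exact hST ((maxStrong_eq_of_mem hS hU hx (hCU (mem_image_of_mem _ hxC))).trans
    (maxStrong_eq_of_mem hU hT (hCU (mem_image_of_mem _ hyC)) hy))

theorem induce_compl (G : SimpleGraph X) (M : Set X) : (G.induce M)ᶜ = Gᶜ.induce M := by
  ext a b
  simp [Subtype.ext_iff]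

theorem adj_of_not_compl_connected [Finite X] (hcon : ¬ (G.induce M)ᶜ.Connected)
    (hS : S ∈ maxStrong G M) (hT : T ∈ maxStrong G M) (hST : S ≠ T) {x y : X} (hx : x ∈ S)
    (hy : y ∈ T) : G.Adj x y := by
  have hxy : x ≠ y := fun h => hST (maxStrong_eq_of_mem hS hT hx (h ▸ hy))
  rw [induce_compl] at hcon
  rw [← maxStrong_compl] at hS hT
  simpa [hxy] using not_adj_of_not_connected hcon hS hT hST hx hy

/-- The vertices of `A \ B` see all of `B` alike, so neither `G[M]` nor its complement has both
edges and non-edges between `A \ B` and `B`. -/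
theorem not_connected_of_overlapping_modules {A B : Set X} (hA : IsModuleOn G M A)
    (hB : IsModuleOn G M B) (hAB : (A \ B).Nonempty) (hBA : (B \ A).Nonempty)
    (hM : A ∪ B = M) : ¬ ((G.induce M).Connected ∧ (G.induce M)ᶜ.Connected) := by
  rintro ⟨hcon, hco⟩
  obtain ⟨z, hzA, hzB⟩ := hAB
  obtain ⟨b, hbB, hbA⟩ := hBA
  have huniform : ∀ z' ∈ A \ B, ∀ b' ∈ B, (G.Adj z' b' ↔ G.Adj z b) := fun z' hz' b' hb' =>
    calc G.Adj z' b'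
      _ ↔ G.Adj b z' := (G.adj_comm z' b').trans (hB.2 b' hb' b hbB z' (hA.1 hz'.1) hz'.2)
      _ ↔ G.Adj z b := (G.adj_comm b z').trans (hA.2 z' hz'.1 z hzA b (hB.1 hbB) hbA)
  have hcross : ∀ H : SimpleGraph M, H.Connected → ∃ z' b', z'.1 ∈ A \ B ∧ b'.1 ∈ B ∧
      H.Adj z' b' := by
    intro H hH
    obtain ⟨z', b', hz', hb', hadj⟩ := exists_adj_across_cut hH.preconnected
      (T := {c | c.1 ∈ A \ B}) (x := ⟨z, hA.1 hzA⟩) (y := ⟨b, hB.1 hbB⟩) ⟨hzA, hzB⟩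
      fun h => hbA h.1
    have hb'M : b'.1 ∈ A ∪ B := hM ▸ b'.2
    exact ⟨z', b', hz', by_contra fun h => hb' ⟨hb'M.resolve_right h, h⟩, hadj⟩
  obtain ⟨z₁, b₁, hz₁, hb₁, hadj⟩ := hcross _ hcon
  obtain ⟨z₂, b₂, hz₂, hb₂, hnadj⟩ := hcross _ hco
  rw [SimpleGraph.compl_adj] at hnadj
  exact hnadj.2 ((huniform z₂ hz₂ b₂ hb₂).2 ((huniform z₁ hz₁ b₁ hb₁).1 hadj))

theorem exists_maxStrong_superset_of_isModuleOn [Finite X] (hcon : (G.induce M).Connected)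
    (hco : (G.induce M)ᶜ.Connected) (hne : U.Nonempty) (hU : IsModuleOn G M U) (hUM : U ≠ M) :
    ∃ S ∈ maxStrong G M, U ⊆ S := by
  obtain ⟨A, hUA, hA⟩ := (Set.toFinite
    {S | IsModuleOn G M S ∧ S ≠ M}).exists_le_maximal ⟨hU, hUM⟩
  have hstrong : IsStrongModuleOn G M A := by
    refine ⟨hA.1.1, fun B hB => ?_⟩
    by_contra! hoverlap
    obtain ⟨hnAB, hnBA, hinter⟩ := hoverlap
    have hAB : (A \ B).Nonempty := sdiff_nonempty.2 fun h => hnAB (inter_eq_left.2 h)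
    have hBA : (B \ A).Nonempty := sdiff_nonempty.2 fun h => hnBA (inter_eq_right.2 h)
    have hunion : A ∪ B = M := by
      by_contra hunion
      have hsub : A ∪ B ⊆ A := hA.2 ⟨hA.1.1.union hB hinter, hunion⟩ subset_union_left
      exact sdiff_nonempty.1 hBA (subset_union_right.trans hsub)
    exact not_connected_of_overlapping_modules hA.1.1 hB hAB hBA hunion ⟨hcon, hco⟩
  obtain ⟨S, hS, hAS⟩ := exists_maxStrong_superset (hne.mono hUA) hstrong hA.1.2
  exact ⟨S, hS, hUA.trans hAS⟩

end Connectivity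

section FlatMap

variable {ι X : Type*} {ks : List ι} {g : ι → List X} {i j : ι} {a b : X}

theorem pair_sublist_of_flatMap (hnd : (ks.flatMap g).Nodup) (hi : i ∈ ks) (hj : j ∈ ks)
    (hij : i ≠ j) (ha : a ∈ g i) (hb : b ∈ g j) (h : [a, b] <+ ks.flatMap g) : [i, j] <+ ks := by
  refine (pair_sublist_or_of_ne hi hj hij).resolve_right fun hji => not_pair_sublist_swap hnd h ?_
  have hba : [b, a] <+ [j, i].flatMap g := by
    simpa using (List.singleton_sublist.2 hb).append (List.singleton_sublist.2 ha)
  exact hba.trans (hji.flatMap g)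

theorem pair_sublist_of_flatMap_of_mem (hnd : (ks.flatMap g).Nodup) (hi : i ∈ ks) (ha : a ∈ g i)
    (hb : b ∈ g i) (h : [a, b] <+ ks.flatMap g) : [a, b] <+ g i := by
  have hab : a ≠ b := by simpa using h.nodup hnd
  refine (pair_sublist_or_of_ne ha hb hab).resolve_right fun hba =>
    not_pair_sublist_swap hnd h (hba.trans ?_)
  exact List.sublist_flatten_of_mem (List.mem_map_of_mem hi)

end FlatMap

section GoodOrder

variable {X : Type*} {G : SimpleGraph X} {M S : Set X}

theorem IsP4.nodup {a b c d : X} (h : IsP4 G a b c d) : [a, b, c, d].Nodup := by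
  obtain ⟨hab, hbc, hcd, -, hbd, had⟩ := h
  have hab' := hab.ne
  have hbc' := hbc.ne
  have hcd' := hcd.ne
  have := G.adj_comm
  grind [List.nodup_cons]

theorem IsP4.subset_or_subsingleton_of_isModuleOn {a b c d : X} (h : IsP4 G a b c d)
    (hM : ∀ x ∈ [a, b, c, d], x ∈ M) (hS : IsModuleOn G M S) :
    (∀ x ∈ [a, b, c, d], x ∈ S) ∨
      ∀ x ∈ [a, b, c, d], ∀ y ∈ [a, b, c, d], x ∈ S → y ∈ S → x = y := by
  obtain ⟨hab, hbc, hcd, hac, hbd, had⟩ := h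
  have hS' := hS.2
  have hcomm := G.adj_comm
  simp only [List.forall_mem_cons, List.not_mem_nil, false_imp_iff, implies_true] at hM ⊢
  by_cases hA : a ∈ S <;> by_cases hB : b ∈ S <;> by_cases hC : c ∈ S <;>
    by_cases hD : d ∈ S <;> grind

theorem isGoodOrder_singleton {x : X} (hS : S = {x}) : IsGoodOrder G S [x] := by
  subst hS
  exact ⟨⟨List.nodup_singleton x, by simp⟩, fun a b c d _ hab =>
    absurd hab.length_le (by simp)⟩

theorem enumerates_flatMap {ι : Type*} {ks : List ι} {S : ι → Set X} {g : ι → List X}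
    (hdisj : ks.Pairwise (Function.onFun Disjoint S)) (hg : ∀ i ∈ ks, Enumerates (g i) (S i))
    (hM : ∀ x, x ∈ M ↔ ∃ i ∈ ks, x ∈ S i) : Enumerates (ks.flatMap g) M := by
  refine ⟨List.nodup_flatMap.2 ⟨fun i hi => (hg i hi).1, hdisj.imp_of_mem fun hi hj hij x hxi hxj =>
    disjoint_left.1 hij (((hg _ hi).2 x).1 hxi) (((hg _ hj).2 x).1 hxj)⟩, fun x => ?_⟩
  rw [List.mem_flatMap, hM]
  exact exists_congr fun i => and_congr_right fun hi => (hg i hi).2 x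

/-- By modularity an induced path on four vertices lies in a single block or meets four of them. -/
theorem isGoodOrder_flatMap {ι : Type*} {ks : List ι} {S : ι → Set X} {g : ι → List X}
    (hmod : ∀ i ∈ ks, IsModuleOn G M (S i)) (hdisj : ks.Pairwise (Function.onFun Disjoint S))
    (hcov : ∀ x ∈ M, ∃ i ∈ ks, x ∈ S i) (hg : ∀ i ∈ ks, IsGoodOrder G (S i) (g i))
    (hobs : ∀ i ∈ ks, ∀ j ∈ ks, ∀ k ∈ ks, ∀ m ∈ ks, [i, j, k, m].Nodup →
      [i, j] <+ ks → [m, k] <+ ks → ∀ a ∈ S i, ∀ b ∈ S j, ∀ c ∈ S k, ∀ d ∈ S m,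
        ¬ IsP4 G a b c d) :
    IsGoodOrder G M (ks.flatMap g) := by
  have henum : Enumerates (ks.flatMap g) M := enumerates_flatMap hdisj (fun i hi => (hg i hi).1)
    fun x => ⟨hcov x, fun ⟨i, hi, hx⟩ => (hmod i hi).1 hx⟩
  refine ⟨henum, fun a b c d hP hab hdc => ?_⟩
  have hmem_g : ∀ {x i}, i ∈ ks → x ∈ S i → x ∈ g i := fun hi => ((hg _ hi).1.2 _).2
  by_cases hone : ∃ i ∈ ks, ∀ x ∈ [a, b, c, d], x ∈ S i
  · obtain ⟨i, hi, hPi⟩ := hone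
    have hlocal : ∀ {x y}, x ∈ [a, b, c, d] → y ∈ [a, b, c, d] → [x, y] <+ ks.flatMap g →
        [x, y] <+ g i := fun hx hy =>
      pair_sublist_of_flatMap_of_mem henum.1 hi (hmem_g hi (hPi _ hx)) (hmem_g hi (hPi _ hy))
    exact (hg i hi).2 a b c d hP (hlocal (by simp) (by simp) hab) (hlocal (by simp) (by simp) hdc)
  have ha : a ∈ M := (henum.2 a).1 (hab.subset (by simp))
  have hb : b ∈ M := (henum.2 b).1 (hab.subset (by simp))
  have hc : c ∈ M := (henum.2 c).1 (hdc.subset (by simp))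
  have hd : d ∈ M := (henum.2 d).1 (hdc.subset (by simp))
  have hPM : ∀ x ∈ [a, b, c, d], x ∈ M := by simp [ha, hb, hc, hd]
  have : Nonempty ι := ⟨(hcov a ha).choose⟩
  choose! β hβ hmemβ using hcov
  have hβnd : [β a, β b, β c, β d].Nodup :=
    hP.nodup.map_on (f := β) fun x hx y hy hxy =>
      (hP.subset_or_subsingleton_of_isModuleOn hPM (hmod _ (hβ x (hPM x hx)))).resolve_left
        (fun h => hone ⟨_, hβ x (hPM x hx), h⟩) x hx y hy (hmemβ x (hPM x hx))
        (hxy ▸ hmemβ y (hPM y hy))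
  have hblocks : ∀ {x y}, x ∈ M → y ∈ M → β x ≠ β y → [x, y] <+ ks.flatMap g →
      [β x, β y] <+ ks := fun hx hy hxy => pair_sublist_of_flatMap henum.1 (hβ _ hx) (hβ _ hy) hxy
    (hmem_g (hβ _ hx) (hmemβ _ hx)) (hmem_g (hβ _ hy) (hmemβ _ hy))
  have hne : β a ≠ β b ∧ β d ≠ β c := by
    simp only [List.nodup_cons, List.mem_cons, not_or, List.not_mem_nil] at hβnd
    exact ⟨hβnd.1.1, Ne.symm hβnd.2.2.1.1⟩
  exact hobs _ (hβ a ha) _ (hβ b hb) _ (hβ c hc) _ (hβ d hd) hβnd (hblocks ha hb hne.1 hab)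
    (hblocks hd hc hne.2 hdc) a (hmemβ a ha) b (hmemβ b hb) c (hmemβ c hc) d (hmemβ d hd) hP

end GoodOrder

/-! ### Elementary galled-trees -/

section Infix

variable {α : Type*} {l : List α} {a b u u' v : α}

theorem mem_of_pair_infix_cons_concat (h : [u, v] <:+: a :: (l ++ [b])) :
    u ∈ a :: l ∧ v ∈ l ++ [b] := by
  obtain ⟨s, t, hst⟩ := h
  have hu : u ∈ (a :: l ++ [b]).dropLast := by
    rw [List.cons_append, ← hst, List.append_assoc, List.dropLast_append_of_ne_nil (by simp)]
    simp
  have hv : v ∈ (a :: (l ++ [b])).tail := by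
    rw [← hst]
    cases s <;> simp
  rw [List.dropLast_concat] at hu
  exact ⟨hu, hv⟩

theorem pair_infix_left_unique (hl : l.Nodup) (h : [u, v] <:+: l) (h' : [u', v] <:+: l) :
    u = u' := by
  obtain ⟨s, t, rfl⟩ := h
  obtain ⟨s', t', hst⟩ := h'
  have hsplit : (s' ++ [u']) ++ v :: t' = (s ++ [u]) ++ v :: t := by simpa using hst
  have hnd : ((s ++ [u]) ++ v :: t).Nodup := by simpa using hl
  have hnd' : ((s' ++ [u']) ++ v :: t').Nodup := hsplit ▸ hnd
  rw [List.nodup_middle, List.nodup_cons, List.mem_append, not_or] at hnd hnd'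
  have hs : s' ++ [u'] = s ++ [u] :=
    ((List.append_cons_inj_of_notMem hnd'.1.1 hnd'.1.2).1 hsplit).1
  exact (List.concat_inj.1 (by simpa using hs)).2.symm

theorem exists_pair_infix_of_mem_tail (hv : v ∈ l.tail) : ∃ u, [u, v] <:+: l := by
  obtain ⟨s, t, hst⟩ := List.append_of_mem hv
  obtain ⟨a, l, rfl⟩ := List.exists_cons_of_ne_nil (List.ne_nil_of_mem (List.mem_of_mem_tail hv))
  obtain rfl : l = s ++ v :: t := hst
  rw [← List.cons_append, ← List.dropLast_concat_getLast (List.cons_ne_nil a s)]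
  exact ⟨(a :: s).getLast (List.cons_ne_nil a s), (a :: s).dropLast, t, by simp⟩

theorem exists_pair_infix_of_mem_dropLast (hu : u ∈ l.dropLast) : ∃ v, [u, v] <:+: l := by
  rw [← List.mem_reverse, ← List.tail_reverse] at hu
  obtain ⟨v, hv⟩ := exists_pair_infix_of_mem_tail hu
  exact ⟨v, by simpa using List.reverse_infix.2 hv⟩

theorem isChain_pair_infix (l : List α) : l.IsChain fun u v => [u, v] <:+: l :=
  List.isChain_iff_forall_rel_of_append_cons_cons.2 fun _ _ s t h => ⟨s, t, by simp [h]⟩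

theorem eq_nil_of_pair_infix (hl : (a :: (l ++ [b])).Nodup) (h : [a, b] <:+: a :: (l ++ [b])) :
    l = [] := by
  obtain ⟨s, t, hst⟩ := h
  cases s <;> cases l <;> grind [List.nodup_cons]

end Infix

section InducedPath

variable {V : Type*} {G : SimpleGraph V} {a b c d x : V}

theorem IsP4.compl (h : IsP4 G a b c d) : IsP4 Gᶜ b d a c := by
  have := h.nodup
  obtain ⟨hab, hbc, hcd, hac, hbd, had⟩ := h
  constructor <;> grind [SimpleGraph.compl_adj, G.adj_comm]

theorem IsP4.not_forall_adj_iff (h : IsP4 G a b c d) (hx : x ∈ [a, b, c, d]) :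
    ¬ ∃ p : Prop, ∀ y ∈ [a, b, c, d], y ≠ x → (G.Adj x y ↔ p) := by
  rintro ⟨p, hp⟩
  have hnodup := h.nodup
  obtain ⟨hab, hbc, hcd, hac, hbd, had⟩ := h
  grind [G.adj_comm]

theorem IsP4.notMem_of_cut (h : IsP4 G a b c d) {A B : Set V}
    (hcut : ∀ x ∈ A, ∀ y ∈ B, ¬ G.Adj x y) (hA : ∃ x ∈ [a, b, c, d], x ∈ A)
    (hB : ∃ x ∈ [a, b, c, d], x ∈ B) (hb : b ∈ A ∨ b ∈ B) : ¬ (c ∈ A ∨ c ∈ B) := by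
  obtain ⟨hab, hbc, hcd, -, -, -⟩ := h
  grind [G.adj_comm]

end InducedPath

section Elementary

variable {W : Type*} {N : Digraph W}

namespace RootedCycle

variable {C : RootedCycle N} {p q r u u' v : W}

/-- The same cycle with the order of its two sides exchanged. -/
def swap (C : RootedCycle N) : RootedCycle N where
  root := C.root
  hybrid := C.hybrid
  inner₁ := C.inner₂
  inner₂ := C.inner₁
  path₁ := C.path₂
  path₂ := C.path₁
  nodup := ((List.perm_append_comm.cons _).cons _).nodup_iff.1 C.nodup
  nontrivial := C.nontrivial.symm

theorem mem_verts (C : RootedCycle N) :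
    v ∈ C.verts ↔ v = C.root ∨ v = C.hybrid ∨ v ∈ C.inner₁ ∨ v ∈ C.inner₂ := by
  simp only [verts, mem_ofPred_eq, List.mem_cons, List.mem_append]

theorem swap_verts (C : RootedCycle N) : C.swap.verts = C.verts := by
  ext v
  simp only [mem_verts, swap, or_comm (a := v ∈ C.inner₂)]

theorem swap_isEdge : C.swap.IsEdge u v ↔ C.IsEdge u v := or_comm

theorem root_mem (C : RootedCycle N) : C.root ∈ C.verts := C.mem_verts.2 (Or.inl rfl)

theorem hybrid_mem (C : RootedCycle N) : C.hybrid ∈ C.verts :=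
  C.mem_verts.2 (Or.inr (Or.inl rfl))

theorem root_ne_hybrid (C : RootedCycle N) : C.root ≠ C.hybrid :=
  fun h => (List.nodup_cons.1 C.nodup).1 (h ▸ List.mem_cons_self)

theorem disjoint (C : RootedCycle N) : C.inner₁.Disjoint C.inner₂ :=
  List.disjoint_of_nodup_append (List.nodup_cons.1 (List.nodup_cons.1 C.nodup).2).2

theorem root_notMem₁ (C : RootedCycle N) : C.root ∉ C.inner₁ := fun h =>
  (List.nodup_cons.1 C.nodup).1 (List.mem_cons_of_mem _ (List.mem_append_left _ h))

theorem hybrid_notMem₁ (C : RootedCycle N) : C.hybrid ∉ C.inner₁ := fun h =>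
  (List.nodup_cons.1 (List.nodup_cons.1 C.nodup).2).1 (List.mem_append_left _ h)

theorem nodup₁ (C : RootedCycle N) : (C.root :: (C.inner₁ ++ [C.hybrid])).Nodup :=
  ((List.perm_append_singleton _ _).cons _).nodup_iff.2
    (C.nodup.sublist (((List.sublist_append_left _ _).cons_cons _).cons_cons _))

theorem ncard_verts (C : RootedCycle N) :
    C.verts.ncard = C.inner₁.length + C.inner₂.length + 2 := by
  classical
  have hverts : C.verts = (C.root :: C.hybrid :: (C.inner₁ ++ C.inner₂)).toFinset :=
    (List.coe_toFinset _).symm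
  rw [hverts, ncard_coe_finset, List.toFinset_card_of_nodup C.nodup]
  simp only [List.length_cons, List.length_append]

theorem pairwise_transGen₁ (C : RootedCycle N) :
    (C.root :: (C.inner₁ ++ [C.hybrid])).Pairwise (Relation.TransGen N.Adj) :=
  (C.path₁.imp fun _ _ => Relation.TransGen.single).pairwise

theorem IsEdge.adj (h : C.IsEdge u v) : N.Adj u v :=
  h.elim (fun h => List.isChain_pair.1 (C.path₁.infix h))
    fun h => List.isChain_pair.1 (C.path₂.infix h)

theorem IsEdge.mem_left (h : C.IsEdge u v) : u ∈ C.verts := by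
  rw [mem_verts]
  rcases h with h | h <;>
    rcases List.mem_cons.1 (mem_of_pair_infix_cons_concat h).1 with hu | hu <;>
    simp only [hu, true_or, or_true]

theorem IsEdge.mem_right (h : C.IsEdge u v) : v ∈ C.verts := by
  rw [mem_verts]
  rcases h with h | h <;>
    rcases List.mem_append.1 (mem_of_pair_infix_cons_concat h).2 with hv | hv <;>
    simp_all only [List.mem_singleton, true_or, or_true]

theorem IsEdge.eq_or_eq_or_eq (hp : C.IsEdge p v) (hq : C.IsEdge q v) (hr : C.IsEdge r v) :
    p = q ∨ p = r ∨ q = r := by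
  have h₁ : ∀ {u u'}, [u, v] <:+: _ → [u', v] <:+: _ → u = u' := pair_infix_left_unique C.nodup₁
  have h₂ : ∀ {u u'}, [u, v] <:+: _ → [u', v] <:+: _ → u = u' :=
    pair_infix_left_unique C.swap.nodup₁
  rcases hp with hp | hp <;> rcases hq with hq | hq <;> rcases hr with hr | hr <;> grind [swap]

theorem IsEdge.left_unique (h : C.IsEdge u v) (h' : C.IsEdge u' v) (hv : v ≠ C.hybrid) :
    u = u' := by
  have hmem : ∀ {l w}, [w, v] <:+: C.root :: (l ++ [C.hybrid]) → v ∈ l := fun h => by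
    simpa [hv] using (mem_of_pair_infix_cons_concat h).2
  rcases h with h | h <;> rcases h' with h' | h'
  · exact pair_infix_left_unique C.nodup₁ h h'
  · exact (C.disjoint (hmem h) (hmem h')).elim
  · exact (C.disjoint (hmem h') (hmem h)).elim
  · exact pair_infix_left_unique C.swap.nodup₁ h h'

theorem exists_isEdge (hv : v ∈ C.verts) (hne : v ≠ C.root) : ∃ u, C.IsEdge u v := by
  have hmem : v ∈ C.inner₁ ++ [C.hybrid] ∨ v ∈ C.inner₂ ++ [C.hybrid] := by
    rcases (C.mem_verts.1 hv).resolve_left hne with h | h | h <;> simp [h]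
  exact hmem.elim (fun h => (exists_pair_infix_of_mem_tail h).imp fun _ => Or.inl)
    fun h => (exists_pair_infix_of_mem_tail h).imp fun _ => Or.inr

theorem exists_isEdge_of_ne_hybrid (hv : v ∈ C.verts) (hne : v ≠ C.hybrid) :
    ∃ u, C.IsEdge v u := by
  have hmem : v ∈ (C.root :: C.inner₁ ++ [C.hybrid]).dropLast ∨
      v ∈ (C.root :: C.inner₂ ++ [C.hybrid]).dropLast := by
    simp only [List.dropLast_concat]
    rcases C.mem_verts.1 hv with h | h | h | h <;> simp_all
  exact hmem.elim (fun h => (exists_pair_infix_of_mem_dropLast h).imp fun _ => Or.inl)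
    fun h => (exists_pair_infix_of_mem_dropLast h).imp fun _ => Or.inr

theorem exists_parents (C : RootedCycle N) :
    ∃ p q, p ≠ q ∧ C.IsEdge p C.hybrid ∧ C.IsEdge q C.hybrid := by
  obtain ⟨p, hp⟩ := exists_pair_infix_of_mem_tail
    (l := C.root :: (C.inner₁ ++ [C.hybrid])) (v := C.hybrid) (by simp)
  obtain ⟨q, hq⟩ := exists_pair_infix_of_mem_tail
    (l := C.root :: (C.inner₂ ++ [C.hybrid])) (v := C.hybrid) (by simp)
  refine ⟨p, q, ?_, Or.inl hp, Or.inr hq⟩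
  rintro rfl
  rcases List.mem_cons.1 (mem_of_pair_infix_cons_concat hp).1 with rfl | h₁
  · exact C.nontrivial.elim (fun h => h (eq_nil_of_pair_infix C.nodup₁ hp))
      fun h => h (eq_nil_of_pair_infix C.swap.nodup₁ hq)
  rcases List.mem_cons.1 (mem_of_pair_infix_cons_concat hq).1 with rfl | h₂
  · exact C.root_notMem₁ h₁
  · exact C.disjoint h₁ h₂

theorem exists_children (C : RootedCycle N) :
    ∃ p q, p ≠ q ∧ C.IsEdge C.root p ∧ C.IsEdge C.root q := by
  obtain ⟨p, hp⟩ := exists_pair_infix_of_mem_dropLast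
    (l := C.root :: C.inner₁ ++ [C.hybrid]) (u := C.root) (by rw [List.dropLast_concat]; simp)
  obtain ⟨q, hq⟩ := exists_pair_infix_of_mem_dropLast
    (l := C.root :: C.inner₂ ++ [C.hybrid]) (u := C.root) (by rw [List.dropLast_concat]; simp)
  refine ⟨p, q, ?_, Or.inl hp, Or.inr hq⟩
  rintro rfl
  rcases List.mem_append.1 (mem_of_pair_infix_cons_concat hp).2 with h₁ | h₁
  · rcases List.mem_append.1 (mem_of_pair_infix_cons_concat hq).2 with h₂ | h₂
    · exact C.disjoint h₁ h₂
    · exact C.hybrid_notMem₁ (List.mem_singleton.1 h₂ ▸ h₁)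
  · obtain rfl := List.mem_singleton.1 h₁
    exact C.nontrivial.elim (fun h => h (eq_nil_of_pair_infix C.nodup₁ hp))
      fun h => h (eq_nil_of_pair_infix C.swap.nodup₁ hq)

end RootedCycle

theorem indeg_eq_zero_iff [Finite W] {v : W} : indeg N v = 0 ↔ ∀ u, ¬ N.Adj u v :=
  (ncard_eq_zero (toFinite _)).trans eq_empty_iff_forall_notMem

theorem outdeg_eq_zero_iff [Finite W] {v : W} : outdeg N v = 0 ↔ ∀ u, ¬ N.Adj v u :=
  (ncard_eq_zero (toFinite _)).trans eq_empty_iff_forall_notMem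

theorem indeg_eq_one_iff {v : W} : indeg N v = 1 ↔ ∃! u, N.Adj u v :=
  ncard_eq_one.trans singleton_iff_unique_mem

theorem two_le_outdeg_iff [Finite W] {v : W} :
    2 ≤ outdeg N v ↔ ∃ a b, N.Adj v a ∧ N.Adj v b ∧ a ≠ b :=
  (one_lt_ncard (toFinite _)).trans (by simp only [mem_ofPred_eq, exists_and_left])

theorem ancestor_antisymm (hdag : IsDAG N) {u v : W} (h : IsAncestor N u v)
    (h' : IsAncestor N v u) : u = v := by
  rcases Relation.reflTransGen_iff_eq_or_transGen.1 h with e | h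
  · exact e.symm
  · exact absurd (h.trans_left h') (hdag u)

/-- The adjacencies in an elementary galled-tree with cycle `C` and leaf set `X`. -/
structure IsElementaryWith (N : Digraph W) (X : Set W) (C : RootedCycle N) : Prop where
  dag : IsDAG N
  not_adj_root : ∀ u, ¬ N.Adj u C.root
  leaf_not_adj : ∀ x ∈ X, ∀ u, ¬ N.Adj x u
  leaf_parent : ∀ x ∈ X, ∃! u, N.Adj u x
  cover : ∀ v, v ∈ C.verts ∨ v ∈ X
  exists_leaf : ∀ v ∈ C.verts, v ≠ C.root → ∃! x, x ∈ X ∧ N.Adj v x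
  edge : ∀ u v, N.Adj u v → C.IsEdge u v ∨ (u ∈ C.verts ∧ u ≠ C.root ∧ v ∈ X)

theorem IsElementary.exists_cycle [Finite W] {X : Set W} (h : IsElementary N X) :
    ∃ C : RootedCycle N, IsElementaryWith N X C := by
  obtain ⟨⟨hdag, ⟨x, hx, -⟩ | hN⟩, C, hroot, -, hcover, hleaf, hedge⟩ := h
  · have heq : ∀ v, v = x := fun v => hx.le (mem_univ v)
    exact absurd ((heq C.root).trans (heq C.hybrid).symm) C.root_ne_hybrid
  · exact ⟨C, hdag, indeg_eq_zero_iff.1 hroot,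
      fun x hx => outdeg_eq_zero_iff.1 ((hN.leaves x).1 hx).1,
      fun x hx => indeg_eq_one_iff.1 ((hN.leaves x).1 hx).2,
      fun v => hcover.ge (mem_univ v), hleaf, hedge⟩

namespace IsElementaryWith

variable {X : Set W} {C : RootedCycle N} {u v w x y : W}

theorem swap (h : IsElementaryWith N X C) : IsElementaryWith N X C.swap where
  dag := h.dag
  not_adj_root := h.not_adj_root
  leaf_not_adj := h.leaf_not_adj
  leaf_parent := h.leaf_parent
  cover := C.swap_verts ▸ h.cover
  exists_leaf := C.swap_verts ▸ h.exists_leaf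
  edge u v huv := by rw [RootedCycle.swap_isEdge, C.swap_verts]; exact h.edge u v huv

theorem notMem_leaves (h : IsElementaryWith N X C) (hv : v ∈ C.verts) : v ∉ X := by
  intro hvX
  by_cases hne : v = C.hybrid
  · obtain ⟨x, ⟨-, hx⟩, -⟩ := h.exists_leaf v hv (hne ▸ C.root_ne_hybrid.symm)
    exact h.leaf_not_adj v hvX x hx
  · obtain ⟨u, hu⟩ := C.exists_isEdge_of_ne_hybrid hv hne
    exact h.leaf_not_adj v hvX u hu.adj

theorem isEdge (h : IsElementaryWith N X C) (huv : N.Adj u v) (hv : v ∈ C.verts) :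
    C.IsEdge u v :=
  (h.edge u v huv).resolve_right fun h' => h.notMem_leaves hv h'.2.2

theorem parent_mem (h : IsElementaryWith N X C) (hx : x ∈ X) (hux : N.Adj u x) :
    u ∈ C.verts ∧ u ≠ C.root :=
  ((h.edge u x hux).resolve_left fun h' => h.notMem_leaves h'.mem_right hx).imp_right And.left

theorem parent_mem_inner (h : IsElementaryWith N X C) (hx : x ∈ X) (hux : N.Adj u x)
    (hne : u ≠ C.hybrid) : u ∈ C.inner₁ ∨ u ∈ C.inner₂ :=
  have ⟨hmem, hroot⟩ := h.parent_mem hx hux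
  ((C.mem_verts.1 hmem).resolve_left hroot).resolve_left hne

theorem hybrid_eq (h : IsElementaryWith N X C) (C' : RootedCycle N) : C'.hybrid = C.hybrid := by
  obtain ⟨p, q, hne, hp, hq⟩ := C'.exists_parents
  by_contra hhyb
  rcases h.cover C'.hybrid with hv | hv
  · exact hne ((h.isEdge hp.adj hv).left_unique (h.isEdge hq.adj hv) hhyb)
  · exact hne ((h.leaf_parent _ hv).unique hp.adj hq.adj)

theorem mem_cycle_of_isEdge (h : IsElementaryWith N X C) (C' : RootedCycle N)
    (huv : C.IsEdge u v) (hv : v ∈ C'.verts) (hroot : v ≠ C'.root) : u ∈ C'.verts := by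
  by_cases hvh : v = C.hybrid
  · obtain ⟨p, q, hne, hp, hq⟩ := C'.exists_parents
    rw [h.hybrid_eq C', ← hvh] at hp hq
    rcases (h.isEdge hp.adj huv.mem_right).eq_or_eq_or_eq (h.isEdge hq.adj huv.mem_right) huv
      with e | rfl | rfl
    · exact absurd e hne
    · exact hp.mem_left
    · exact hq.mem_left
  · obtain ⟨p, hp⟩ := C'.exists_isEdge hv hroot
    rw [huv.left_unique (h.isEdge hp.adj huv.mem_right) hvh]
    exact hp.mem_left

theorem side_subset (h : IsElementaryWith N X C) (C' : RootedCycle N)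
    (hroot : C'.root ∉ C.inner₁) : ∀ x ∈ C.root :: C.inner₁, x ∈ C'.verts := by
  have hchain : (C.root :: C.inner₁ ++ [C.hybrid]).IsChain
      fun u v => [u, v] <:+: C.root :: (C.inner₁ ++ [C.hybrid]) := isChain_pair_infix _
  refine hchain.backwards_concat_induction _ _ (fun u v huv hv => ?_)
    (h.hybrid_eq C' ▸ C'.hybrid_mem)
  refine h.mem_cycle_of_isEdge C' (Or.inl huv) hv ?_
  rintro rfl
  rcases List.mem_append.1 (mem_of_pair_infix_cons_concat huv).2 with hmem | hmem
  · exact hroot hmem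
  · exact C'.root_ne_hybrid ((List.mem_singleton.1 hmem).trans (h.hybrid_eq C').symm)

theorem root_eq (h : IsElementaryWith N X C) (C' : RootedCycle N) : C'.root = C.root := by
  have hmem : C.root ∈ C'.verts := by
    by_cases h₁ : C'.root ∈ C.inner₁
    · exact h.swap.side_subset C' (C.disjoint h₁) _ List.mem_cons_self
    · exact h.side_subset C' h₁ _ List.mem_cons_self
  by_contra hne
  obtain ⟨u, hu⟩ := C'.exists_isEdge hmem (Ne.symm hne)
  exact h.not_adj_root u hu.adj

theorem verts_eq (h : IsElementaryWith N X C) (C' : RootedCycle N) : C'.verts = C.verts := by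
  have hroot := h.root_eq C'
  refine subset_antisymm (fun v hv => ?_) fun v hv => ?_
  · by_cases hvh : v = C'.hybrid
    · rw [hvh, h.hybrid_eq C']
      exact C.hybrid_mem
    · obtain ⟨u, hu⟩ := C'.exists_isEdge_of_ne_hybrid hv hvh
      exact (h.cover v).resolve_right fun hvX => h.leaf_not_adj v hvX u hu.adj
  · rcases C.mem_verts.1 hv with rfl | rfl | hv | hv
    · exact hroot ▸ C'.root_mem
    · exact h.hybrid_eq C' ▸ C'.hybrid_mem
    · exact h.side_subset C' (hroot ▸ C.root_notMem₁) v (List.mem_cons_of_mem _ hv)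
    · exact h.swap.side_subset C' (hroot ▸ C.swap.root_notMem₁) v (List.mem_cons_of_mem _ hv)

theorem isStrong (h : IsElementaryWith N X C) (h₁ : C.inner₁ ≠ []) (h₂ : C.inner₂ ≠ [])
    (hlen : ¬ (C.inner₁.length = 1 ∧ C.inner₂.length = 1)) : IsStrong N := by
  have hnot_adj : ¬ N.Adj C.root C.hybrid := fun hadj =>
    (h.isEdge hadj C.hybrid_mem).elim (fun h' => h₁ (eq_nil_of_pair_infix C.nodup₁ h'))
      fun h' => h₂ (eq_nil_of_pair_infix C.swap.nodup₁ h')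
  intro C'
  rw [← h.root_eq C', ← h.hybrid_eq C'] at hnot_adj
  refine ⟨fun e => hnot_adj ?_, fun e => hnot_adj ?_, fun e => hlen ?_⟩
  · simpa [e] using C'.path₁
  · simpa [e] using C'.path₂
  · have hcard := congrArg ncard (h.verts_eq C')
    rw [C'.ncard_verts, C.ncard_verts] at hcard
    have := List.length_pos_iff.2 h₁
    have := List.length_pos_iff.2 h₂
    omega

theorem ancestor_leaf (h : IsElementaryWith N X C) (hx : x ∈ X) (hux : N.Adj u x)
    (hw : IsAncestor N w x) : w = x ∨ IsAncestor N w u := by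
  rcases Relation.ReflTransGen.cases_tail hw with e | ⟨p, hp, hpx⟩
  · exact Or.inl e.symm
  · exact Or.inr ((h.leaf_parent x hx).unique hux hpx ▸ hp)

theorem eq_of_leaf_ancestor (h : IsElementaryWith N X C) (hx : x ∈ X) (hxy : IsAncestor N x y) :
    y = x := by
  rcases Relation.ReflTransGen.cases_head hxy with e | ⟨p, hp, -⟩
  · exact e.symm
  · exact absurd hp (h.leaf_not_adj x hx p)

theorem isLCA_iff_above (h : IsElementaryWith N X C) (hx : x ∈ X) (hux : N.Adj u x)
    (hyx : y ≠ x) (huy : IsAncestor N u y) : IsLCA N {x, y} w ↔ w = u := by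
  have hcommon : ∀ v, (∀ a ∈ ({x, y} : Set W), IsAncestor N v a) ↔ IsAncestor N v u := by
    simp only [mem_insert_iff, mem_singleton_iff, forall_eq_or_imp, forall_eq]
    refine fun v => ⟨fun ⟨hvx, hvy⟩ => ?_, fun hvu => ⟨hvu.tail hux, hvu.trans huy⟩⟩
    refine (h.ancestor_leaf hx hux hvx).resolve_left ?_
    rintro rfl
    exact hyx (h.eq_of_leaf_ancestor hx hvy)
  simp only [IsLCA, hcommon]
  refine ⟨fun ⟨hwu, hmin⟩ => (hmin u .refl hwu).symm, ?_⟩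
  rintro rfl
  exact ⟨.refl, fun w' hw' hww' => ancestor_antisymm h.dag hw' hww'⟩

theorem ancestor_inner (h : IsElementaryWith N X C) (hu : u ∈ C.inner₁) (hw : IsAncestor N w u) :
    w ∈ C.root :: C.inner₁ := by
  induction hw using Relation.ReflTransGen.head_induction_on with
  | refl => exact List.mem_cons_of_mem _ hu
  | @head a b hab _ ih =>
    rcases List.mem_cons.1 ih with rfl | hb
    · exact absurd hab (h.not_adj_root a)
    · rcases h.isEdge hab (C.mem_verts.2 (.inr (.inr (.inl hb)))) with h' | h'
      · exact (mem_of_pair_infix_cons_concat h').1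
      · rcases List.mem_append.1 (mem_of_pair_infix_cons_concat h').2 with h'' | h''
        · exact (C.disjoint hb h'').elim
        · exact absurd (List.mem_singleton.1 h'' ▸ hb) C.hybrid_notMem₁

theorem isLCA_iff_opposite (h : IsElementaryWith N X C) (hx : x ∈ X) (hy : y ∈ X)
    (hux : N.Adj u x) (hvy : N.Adj v y) (hu : u ∈ C.inner₁) (hv : v ∈ C.inner₂) :
    IsLCA N {x, y} w ↔ w = C.root := by
  have hxy : x ≠ y := by
    rintro rfl
    exact C.disjoint hu ((h.leaf_parent x hy).unique hux hvy ▸ hv)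
  have hroot_le : IsAncestor N C.root u ∧ IsAncestor N C.root v :=
    ⟨((List.pairwise_cons.1 C.pairwise_transGen₁).1 u
        (List.mem_append_left _ hu)).to_reflTransGen,
      ((List.pairwise_cons.1 C.swap.pairwise_transGen₁).1 v
        (List.mem_append_left _ hv)).to_reflTransGen⟩
  have hcommon : ∀ w', (∀ a ∈ ({x, y} : Set W), IsAncestor N w' a) ↔ w' = C.root := by
    simp only [mem_insert_iff, mem_singleton_iff, forall_eq_or_imp, forall_eq]
    refine fun w' => ⟨fun ⟨hw'x, hw'y⟩ => ?_, ?_⟩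
    · rcases h.ancestor_leaf hx hux hw'x with rfl | hw'u
      · exact absurd (h.eq_of_leaf_ancestor hx hw'y).symm hxy
      rcases h.ancestor_leaf hy hvy hw'y with rfl | hw'v
      · exact absurd (h.eq_of_leaf_ancestor hy hw'x) hxy
      rcases List.mem_cons.1 (h.ancestor_inner hu hw'u) with e | h₁
      · exact e
      exact (List.mem_cons.1 (h.swap.ancestor_inner hv hw'v)).resolve_right (C.disjoint h₁)
    · rintro rfl
      exact ⟨hroot_le.1.tail hux, hroot_le.2.tail hvy⟩
  simp only [IsLCA, hcommon]
  exact ⟨And.left, fun hw => ⟨hw, fun w' hw' _ => hw'.trans hw.symm⟩⟩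

end IsElementaryWith

theorem explainedGraph_adj {V : Type*} {t : W → VLabel} {ℓ : V → W} {x y : V} :
    (explainedGraph N t ℓ).Adj x y ↔
      x ≠ y ∧ ∃ w, IsLCA N {ℓ x, ℓ y} w ∧ t w = VLabel.one := by
  simp only [explainedGraph, SimpleGraph.fromRel_adj, pair_comm (ℓ y) (ℓ x), or_self]

namespace IsElementaryWith

variable {C : RootedCycle N} {V : Type*} {ℓ : V → W} {t : W → VLabel} {k : V → W}
  {a b c d x y : V} {u v : W}

theorem adj_iff_above (h : IsElementaryWith N (range ℓ) C) (hℓ : Function.Injective ℓ)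
    (hu : N.Adj u (ℓ x)) (hv : N.Adj v (ℓ y)) (hne : x ≠ y) (huv : Relation.TransGen N.Adj u v) :
    (explainedGraph N t ℓ).Adj x y ↔ t u = VLabel.one := by
  rw [explainedGraph_adj]
  simp only [h.isLCA_iff_above (mem_range_self x) hu (hℓ.ne hne.symm)
    (huv.to_reflTransGen.tail hv), hne, ne_eq, not_false_eq_true, true_and, exists_eq_left]

theorem adj_iff_opposite (h : IsElementaryWith N (range ℓ) C) (hu : N.Adj u (ℓ x))
    (hv : N.Adj v (ℓ y)) (hu₁ : u ∈ C.inner₁) (hv₂ : v ∈ C.inner₂) :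
    (explainedGraph N t ℓ).Adj x y ↔ t C.root = VLabel.one := by
  have hne : x ≠ y := by
    rintro rfl
    exact C.disjoint hu₁ ((h.leaf_parent _ (mem_range_self x)).unique hu hv ▸ hv₂)
  rw [explainedGraph_adj]
  simp only [h.isLCA_iff_opposite (mem_range_self x) (mem_range_self y) hu hv hu₁ hv₂, hne, ne_eq,
    not_false_eq_true, true_and, exists_eq_left]

theorem parent_injective (h : IsElementaryWith N (range ℓ) C) (hℓ : Function.Injective ℓ)
    (hk : ∀ x, N.Adj (k x) (ℓ x)) : Function.Injective k := fun x y hxy => by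
  obtain ⟨hmem, hne⟩ := h.parent_mem (mem_range_self x) (hk x)
  exact hℓ ((h.exists_leaf _ hmem hne).unique ⟨mem_range_self x, hk x⟩
    ⟨mem_range_self y, hxy ▸ hk y⟩)

/-- The leaf hanging from the first of the four path vertices sees the other three leaves alike. -/
theorem not_isP4_of_chain (h : IsElementaryWith N (range ℓ) C) (hℓ : Function.Injective ℓ)
    (hk : ∀ x, N.Adj (k x) (ℓ x)) {P : List W} (hP : P.Pairwise (Relation.TransGen N.Adj))
    (hmem : ∀ x ∈ [a, b, c, d], k x ∈ P) : ¬ IsP4 (explainedGraph N t ℓ) a b c d := by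
  classical
  intro hp4
  have hnodup : P.Nodup :=
    List.Pairwise.imp (S := (· ≠ ·)) (fun huv e => h.dag _ (e ▸ huv)) hP
  obtain ⟨v, hv, hfirst⟩ := exists_first_mem hnodup (C := [a, b, c, d].toFinset.image k)
    ⟨k a, by simp⟩ (by simpa using hmem)
  obtain ⟨x, hx, rfl⟩ := Finset.mem_image.1 hv
  refine hp4.not_forall_adj_iff (List.mem_toFinset.1 hx) ⟨t (k x) = VLabel.one, fun y hy hyx => ?_⟩
  refine h.adj_iff_above hℓ (hk x) (hk y) (Ne.symm hyx) (List.pairwise_iff_forall_sublist.1 hP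
    (hfirst (k y) (Finset.mem_image_of_mem k (List.mem_toFinset.2 hy)) fun e => hyx ?_))
  exact h.parent_injective hℓ hk e

theorem exists_mem_inner₂ (h : IsElementaryWith N (range ℓ) C) (hℓ : Function.Injective ℓ)
    (hk : ∀ x, N.Adj (k x) (ℓ x)) (hp4 : IsP4 (explainedGraph N t ℓ) a b c d) :
    ∃ x ∈ [a, b, c, d], k x ∈ C.inner₂ := by
  by_contra! hside
  refine h.not_isP4_of_chain hℓ hk (List.pairwise_cons.1 C.pairwise_transGen₁).2
    (fun x hx => ?_) hp4
  by_cases e : k x = C.hybrid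
  · exact e ▸ List.mem_append_right _ (List.mem_singleton_self _)
  · exact List.mem_append_left _ ((h.parent_mem_inner (mem_range_self x) (hk x) e).resolve_right
      (hside x hx))

theorem hybrid_of_isP4_of_root_ne_one (h : IsElementaryWith N (range ℓ) C)
    (hℓ : Function.Injective ℓ) (hk : ∀ x, N.Adj (k x) (ℓ x)) (hr : t C.root ≠ VLabel.one)
    (hp4 : IsP4 (explainedGraph N t ℓ) a b c d) : k b = C.hybrid ∨ k c = C.hybrid := by
  by_contra! hne
  exact hp4.notMem_of_cut (A := {x | k x ∈ C.inner₁}) (B := {x | k x ∈ C.inner₂})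
    (fun x hx y hy hxy => hr ((h.adj_iff_opposite (hk x) (hk y) hx hy).1 hxy))
    (h.swap.exists_mem_inner₂ hℓ hk hp4) (h.exists_mem_inner₂ hℓ hk hp4)
    (h.parent_mem_inner (mem_range_self b) (hk b) hne.1)
    (h.parent_mem_inner (mem_range_self c) (hk c) hne.2)

theorem hybrid_of_isP4_of_root_eq_one (h : IsElementaryWith N (range ℓ) C)
    (hℓ : Function.Injective ℓ) (hk : ∀ x, N.Adj (k x) (ℓ x)) (hr : t C.root = VLabel.one)
    (hp4 : IsP4 (explainedGraph N t ℓ) a b c d) : k a = C.hybrid ∨ k d = C.hybrid := by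
  by_contra! hne
  have hperm : ∀ x, x ∈ [a, b, c, d] → x ∈ [b, d, a, c] := fun x => by simp; tauto
  exact hp4.compl.notMem_of_cut (A := {x | k x ∈ C.inner₁}) (B := {x | k x ∈ C.inner₂})
    (fun x hx y hy hxy => hxy.2 ((h.adj_iff_opposite (hk x) (hk y) hx hy).2 hr))
    ((h.swap.exists_mem_inner₂ hℓ hk hp4).imp fun x hx => ⟨hperm x hx.1, hx.2⟩)
    ((h.exists_mem_inner₂ hℓ hk hp4).imp fun x hx => ⟨hperm x hx.1, hx.2⟩)
    (h.parent_mem_inner (mem_range_self d) (hk d) hne.2)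
    (h.parent_mem_inner (mem_range_self a) (hk a) hne.1)

end IsElementaryWith

end Elementary

/-! ### Cycles of pvr-networks -/

section Transport

variable {A B : Type*} {N₁ : Digraph A} {N₂ : Digraph B}

/-- The image of a rooted cycle under an injective homomorphism. -/
def RootedCycle.map (ψ : A → B) (hinj : Function.Injective ψ)
    (hadj : ∀ a b, N₁.Adj a b → N₂.Adj (ψ a) (ψ b)) (C : RootedCycle N₁) : RootedCycle N₂ where
  root := ψ C.root
  hybrid := ψ C.hybrid
  inner₁ := C.inner₁.map ψ
  inner₂ := C.inner₂.map ψ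
  path₁ := by simpa using List.isChain_map_of_isChain ψ hadj C.path₁
  path₂ := by simpa using List.isChain_map_of_isChain ψ hadj C.path₂
  nodup := by simpa using C.nodup.map hinj
  nontrivial := by simpa using C.nontrivial

theorem RootedCycle.verts_map {ψ : A → B} {hinj : Function.Injective ψ}
    {hadj : ∀ a b, N₁.Adj a b → N₂.Adj (ψ a) (ψ b)} (C : RootedCycle N₁) :
    (C.map ψ hinj hadj).verts = ψ '' C.verts := by
  have hlist : (C.map ψ hinj hadj).root :: (C.map ψ hinj hadj).hybrid ::
      ((C.map ψ hinj hadj).inner₁ ++ (C.map ψ hinj hadj).inner₂) =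
        (C.root :: C.hybrid :: (C.inner₁ ++ C.inner₂)).map ψ := by
    simp [RootedCycle.map]
  ext v
  simp only [RootedCycle.verts, hlist, List.mem_map, mem_image, mem_ofPred_eq]

theorem RootedCycle.exists_map_eq {ψ : A → B} (hinj : Function.Injective ψ)
    (hadj : ∀ a b, N₁.Adj a b ↔ N₂.Adj (ψ a) (ψ b)) (C : RootedCycle N₂)
    (hC : C.verts ⊆ range ψ) :
    ∃ C' : RootedCycle N₁, C'.map ψ hinj (fun a b => (hadj a b).1) = C := by
  obtain ⟨root, hybrid, inner₁, inner₂, path₁, path₂, nodup, nontrivial⟩ := C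
  have hmem : ∀ v, v ∈ root :: hybrid :: (inner₁ ++ inner₂) → v ∈ range ψ := fun v hv => hC hv
  obtain ⟨r, rfl⟩ := hmem root (by simp)
  obtain ⟨h, rfl⟩ := hmem hybrid (by simp)
  obtain ⟨l₁, rfl⟩ : inner₁ ∈ range (List.map ψ) := by
    rw [Set.range_list_map]
    exact fun x hx => hmem x (by simp [hx])
  obtain ⟨l₂, rfl⟩ : inner₂ ∈ range (List.map ψ) := by
    rw [Set.range_list_map]
    exact fun x hx => hmem x (by simp [hx])
  have hchain : ∀ l : List A, List.IsChain N₂.Adj (ψ r :: (l.map ψ ++ [ψ h])) →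
      List.IsChain N₁.Adj (r :: (l ++ [h])) := by
    intro l hl
    have : List.IsChain N₂.Adj ((r :: (l ++ [h])).map ψ) := by simpa using hl
    exact List.isChain_of_isChain_map ψ (fun a b => (hadj a b).2) this
  refine ⟨⟨r, h, l₁, l₂, hchain l₁ path₁, hchain l₂ path₂, ?_, ?_⟩, rfl⟩
  · have : ((r :: h :: (l₁ ++ l₂)).map ψ).Nodup := by simpa using nodup
    exact this.of_map
  · simpa using nontrivial

end Transport

section Labels

variable {X : Type*} {G : SimpleGraph X} {M : MDVertex G}

theorem mdLabel_eq_leaf_iff : mdLabel G M = VLabel.leaf ↔ M.1.ncard = 1 := by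
  unfold mdLabel
  split_ifs <;> simp_all

theorem mdLabel_eq_zero_iff :
    mdLabel G M = VLabel.zero ↔ M.1.ncard ≠ 1 ∧ ¬ (G.induce M.1).Connected := by
  unfold mdLabel
  split_ifs <;> simp_all

theorem mdLabel_eq_one_iff : mdLabel G M = VLabel.one ↔
    M.1.ncard ≠ 1 ∧ (G.induce M.1).Connected ∧ ¬ (G.induce M.1)ᶜ.Connected := by
  unfold mdLabel
  split_ifs <;> simp_all

theorem mdLabel_eq_prime_iff : mdLabel G M = VLabel.prime ↔
    M.1.ncard ≠ 1 ∧ (G.induce M.1).Connected ∧ (G.induce M.1)ᶜ.Connected := by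
  unfold mdLabel
  split_ifs <;> simp_all

theorem adj_of_adj_of_mem_maxStrong {M S T : Set X} (hS : S ∈ maxStrong G M)
    (hT : T ∈ maxStrong G M) (hne : S ≠ T) {a a' b b' : X} (ha : a ∈ S) (ha' : a' ∈ S)
    (hb : b ∈ T) (hb' : b' ∈ T) (hab : G.Adj a b) : G.Adj a' b' := by
  have hbS : b ∉ S := fun h => hne (maxStrong_eq_of_mem hS hT h hb)
  have haT : a' ∉ T := fun h => hne (maxStrong_eq_of_mem hS hT ha' h)
  have ha'b := ((maxStrong_isModuleOn hS).2 a ha a' ha' b (maxStrong_subset hT hb) hbS).1 hab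
  exact (((maxStrong_isModuleOn hT).2 b hb b' hb' a' (maxStrong_subset hS ha') haT).1
    ha'b.symm).symm

theorem quotientGraph_adj {M : Set X} {S T : maxStrong G M} (hne : S ≠ T) {x y : X}
    (hx : x ∈ S.1) (hy : y ∈ T.1) : (quotientGraph G M).Adj S T ↔ G.Adj x y := by
  have hne' : S.1 ≠ T.1 := Subtype.coe_ne_coe.2 hne
  simp only [quotientGraph, SimpleGraph.fromRel_adj, ne_eq, hne, not_false_eq_true, true_and]
  refine ⟨?_, fun h => Or.inl ⟨x, hx, y, hy, h⟩⟩
  rintro (⟨a, ha, b, hb, hab⟩ | ⟨b, hb, a, ha, hab⟩)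
  · exact adj_of_adj_of_mem_maxStrong S.2 T.2 hne' ha hx hb hy hab
  · exact adj_of_adj_of_mem_maxStrong S.2 T.2 hne' ha hx hb hy hab.symm

end Labels

section PvrCycles

variable {X : Type*} {G : SimpleGraph X} {R : PvrChoice G}

/-- The vertices of the replacement of `P` that are neither the root nor a leaf. -/
abbrev InnerVertex (R : PvrChoice G) (P : PrimeVertex G) : Type :=
  {w : (R P).W // w ≠ (R P).root ∧ w ∉ range (R P).leaf}

/-- The non-leaf vertices of the replacement of `P`; `none` is the root. -/
def toReplacement (R : PvrChoice G) (P : PrimeVertex G) : Option (InnerVertex R P) → (R P).W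
  | none => (R P).root
  | some w => w.1

/-- The non-leaf vertices of the replacement of `P` as vertices of the pvr-network. -/
def toPvr (R : PvrChoice G) (P : PrimeVertex G) : Option (InnerVertex R P) → PvrVertex R
  | none => Sum.inl P.1
  | some w => Sum.inr ⟨P, w⟩

theorem toReplacement_injective (P : PrimeVertex G) :
    Function.Injective (toReplacement R P) := by
  rintro (_ | a) (_ | b) h
  · rfl
  · exact absurd h.symm b.2.1
  · exact absurd h a.2.1
  · exact congrArg some (Subtype.ext h)

theorem toPvr_injective (P : PrimeVertex G) : Function.Injective (toPvr R P) := by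
  rintro (_ | a) (_ | b) h
  · rfl
  · exact absurd h (by simp [toPvr])
  · exact absurd h (by simp [toPvr])
  · simpa [toPvr] using h

theorem Glue.eq_toPvr_or_eq_leaf {P : PrimeVertex G} {w : (R P).W} {a : PvrVertex R}
    (h : Glue R P w a) :
    (∃ o, w = toReplacement R P o ∧ a = toPvr R P o) ∨
      ∃ S, w = (R P).leaf S ∧ a = Sum.inl (childVertex P.1 S) := by
  cases h with
  | root => exact Or.inl ⟨none, rfl, rfl⟩
  | leaf S => exact Or.inr ⟨S, rfl, rfl⟩
  | inner w => exact Or.inl ⟨some w, rfl, rfl⟩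

theorem glue_toPvr (P : PrimeVertex G) (o : Option (InnerVertex R P)) :
    Glue R P (toReplacement R P o) (toPvr R P o) := by
  cases o with
  | none => exact Glue.root
  | some w => exact Glue.inner w

theorem eq_of_toPvr_eq {P P' : PrimeVertex G} {o : Option (InnerVertex R P)}
    {o' : Option (InnerVertex R P')} (h : toPvr R P o = toPvr R P' o') : P = P' := by
  rcases o with _ | a <;> rcases o' with _ | b
  · exact Subtype.ext (Sum.inl.inj h)
  · simp [toPvr] at h
  · simp [toPvr] at h
  · simp only [toPvr, Sum.inr.injEq, Sigma.mk.injEq] at h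
    exact h.1

theorem Replacement.exists_cycle {M : Set X} (r : Replacement G M) :
    ∃ C : RootedCycle r.N, IsElementaryWith r.N (range r.leaf) C ∧ C.root = r.root := by
  have := r.finite
  obtain ⟨C, hC⟩ := r.elementary.exists_cycle
  have hno := indeg_eq_zero_iff.1 r.indeg_root
  refine ⟨C, hC, ?_⟩
  by_contra hne
  rcases hC.cover r.root with h | h
  · obtain ⟨u, hu⟩ := C.exists_isEdge h (Ne.symm hne)
    exact hno u hu.adj
  · obtain ⟨u, hu⟩ := (hC.leaf_parent _ h).exists
    exact hno u hu

/-- The cycle of a replacement. -/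
noncomputable def Replacement.cycle {M : Set X} (r : Replacement G M) : RootedCycle r.N :=
  r.exists_cycle.choose

theorem Replacement.isElementaryWith_cycle {M : Set X} (r : Replacement G M) :
    IsElementaryWith r.N (range r.leaf) r.cycle :=
  r.exists_cycle.choose_spec.1

theorem Replacement.cycle_root {M : Set X} (r : Replacement G M) : r.cycle.root = r.root :=
  r.exists_cycle.choose_spec.2

theorem Replacement.not_adj_leaf {M : Set X} (r : Replacement G M) (S : maxStrong G M) (w : r.W) :
    ¬ r.N.Adj (r.leaf S) w :=
  r.isElementaryWith_cycle.leaf_not_adj _ (mem_range_self S) w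

theorem adj_toPvr {P : PrimeVertex G} {o : Option (InnerVertex R P)} {b : PvrVertex R} :
    (pvrNetwork R).Adj (toPvr R P o) b ↔
      ∃ w, (R P).N.Adj (toReplacement R P o) w ∧ Glue R P w b := by
  constructor
  · generalize ha : toPvr R P o = a
    rintro (⟨M, c, hM, hc⟩ | ⟨P', w, w', a, b, hadj, hg, hg'⟩)
    · cases o with
      | none =>
        simp only [toPvr, Sum.inl.injEq] at ha
        exact absurd (ha ▸ P.2) hM
      | some w => simp [toPvr] at ha
    · rcases hg.eq_toPvr_or_eq_leaf with ⟨o', rfl, ha'⟩ | ⟨S, rfl, -⟩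
      · obtain rfl := eq_of_toPvr_eq (ha.trans ha')
        obtain rfl := toPvr_injective P (ha.trans ha')
        exact ⟨w', hadj, hg'⟩
      · exact absurd hadj ((R P').not_adj_leaf S _)
  · rintro ⟨w, hadj, hg⟩
    exact PvrAdj.replaced P _ w _ b hadj (glue_toPvr P o) hg

theorem adj_toPvr_toPvr {P : PrimeVertex G} {o o' : Option (InnerVertex R P)} :
    (pvrNetwork R).Adj (toPvr R P o) (toPvr R P o') ↔
      (R P).N.Adj (toReplacement R P o) (toReplacement R P o') := by
  rw [adj_toPvr]
  constructor
  · rintro ⟨w, hadj, hg⟩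
    rcases hg.eq_toPvr_or_eq_leaf with ⟨o'', rfl, h⟩ | ⟨S, rfl, h⟩
    · rwa [toPvr_injective P h]
    · cases o' with
      | some w => simp [toPvr] at h
      | none =>
        simp only [toPvr, Sum.inl.injEq] at h
        exact absurd (congrArg Subtype.val h).symm (maxStrong_ne S.2)
  · exact fun h => ⟨_, h, glue_toPvr P _⟩

/-- The module below which a vertex of the pvr-network lies. -/
def supp : PvrVertex R → Set X
  | Sum.inl M => M.1
  | Sum.inr ⟨P, _⟩ => P.1.1

theorem supp_toPvr (P : PrimeVertex G) (o : Option (InnerVertex R P)) :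
    supp (toPvr R P o) = P.1.1 := by
  cases o <;> rfl

theorem supp_nonempty (a : PvrVertex R) : (supp a).Nonempty := by
  rcases a with M | ⟨P, _⟩
  · exact M.2.1
  · exact P.1.2.1

theorem supp_subset {a b : PvrVertex R} (h : (pvrNetwork R).Adj a b) : supp b ⊆ supp a := by
  rcases h with ⟨M, c, hM, hc⟩ | ⟨P, w, w', a, b, hadj, hg, hg'⟩
  · exact hc.le
  · rcases hg.eq_toPvr_or_eq_leaf with ⟨o, rfl, rfl⟩ | ⟨S, rfl, -⟩
    · rw [supp_toPvr]
      rcases hg'.eq_toPvr_or_eq_leaf with ⟨o', rfl, rfl⟩ | ⟨S, rfl, rfl⟩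
      · rw [supp_toPvr]
      · exact maxStrong_subset S.2
    · exact absurd hadj ((R P).not_adj_leaf S _)

theorem supp_subset_of_chain {l : List (PvrVertex R)} {a b : PvrVertex R}
    (h : List.IsChain (pvrNetwork R).Adj (a :: l)) (hb : b ∈ a :: l) : supp b ⊆ supp a :=
  h.induction (fun c => supp c ⊆ supp a) _ (fun _ _ hcd hc => (supp_subset hcd).trans hc)
    (fun _ => subset_rfl) b hb

theorem path_stays_or_leaves {P : PrimeVertex G} {η : PvrVertex R} (l : List (PvrVertex R))
    (o : Option (InnerVertex R P))
    (h : List.IsChain (pvrNetwork R).Adj (toPvr R P o :: (l ++ [η]))) :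
    (∀ v ∈ l ++ [η], v ∈ range (toPvr R P)) ∨
      ∃ (S : maxStrong G P.1.1) (o' : Option (InnerVertex R P)), toPvr R P o' ∈ toPvr R P o :: l ∧
        (R P).N.Adj (toReplacement R P o') ((R P).leaf S) ∧ supp η ⊆ S.1 := by
  induction l generalizing o with
  | nil =>
    simp only [List.nil_append, List.isChain_cons_cons] at h
    obtain ⟨w, hadj, hg⟩ := adj_toPvr.1 h.1
    rcases hg.eq_toPvr_or_eq_leaf with ⟨o', rfl, rfl⟩ | ⟨S, rfl, rfl⟩
    · left; simp
    · exact Or.inr ⟨S, o, List.mem_singleton_self _, hadj, subset_rfl⟩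
  | cons b l ih =>
    rw [List.cons_append, List.isChain_cons_cons] at h
    obtain ⟨w, hadj, hg⟩ := adj_toPvr.1 h.1
    rcases hg.eq_toPvr_or_eq_leaf with ⟨o', rfl, rfl⟩ | ⟨S, rfl, rfl⟩
    · rcases ih o' h.2 with hstay | ⟨S, o'', ho'', hS, hη⟩
      · exact Or.inl (List.forall_mem_cons.2 ⟨mem_range_self _, hstay⟩)
      · exact Or.inr ⟨S, o'', List.mem_cons_of_mem _ ho'', hS, hη⟩
    · exact Or.inr ⟨S, o, List.mem_cons_self, hadj, supp_subset_of_chain h.2 (by simp)⟩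

/-- Two sides that left the replacement would leave it through the same leaf, hence pass through
the parent of that leaf. -/
theorem RootedCycle.verts_subset_range_toPvr {P : PrimeVertex G} (C : RootedCycle (pvrNetwork R))
    (hroot : C.root = Sum.inl P.1) : C.verts ⊆ range (toPvr R P) := by
  have hroot' : C.root = toPvr R P none := hroot
  have hin : ∀ S : maxStrong G P.1.1, C.hybrid ∈ range (toPvr R P) → ¬ supp C.hybrid ⊆ S.1 := by
    rintro S ⟨o, ho⟩ hsub
    rw [← ho, supp_toPvr] at hsub
    exact maxStrong_ne S.2 (subset_antisymm (maxStrong_subset S.2) hsub)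
  rcases path_stays_or_leaves _ none (hroot' ▸ C.path₁) with hstay₁ | ⟨S, o, ho, hoS, hηS⟩ <;>
    rcases path_stays_or_leaves _ none (hroot' ▸ C.path₂) with hstay₂ | ⟨S', o', ho', hoS', hηS'⟩
  · intro v hv
    rcases C.mem_verts.1 hv with rfl | rfl | hv | hv
    · exact ⟨none, hroot'.symm⟩
    · exact hstay₁ _ (by simp)
    · exact hstay₁ _ (by simp [hv])
    · exact hstay₂ _ (by simp [hv])
  · exact (hin S' (hstay₁ _ (by simp)) hηS').elim
  · exact (hin S (hstay₂ _ (by simp)) hηS).elim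
  · obtain ⟨x, hx⟩ := supp_nonempty C.hybrid
    obtain rfl : S = S' := Subtype.ext (maxStrong_eq_of_mem S.2 S'.2 (hηS hx) (hηS' hx))
    have hC := (R P).isElementaryWith_cycle
    obtain rfl : o = o' := toReplacement_injective P
      ((hC.leaf_parent _ (mem_range_self S)).unique hoS hoS')
    have hne : toPvr R P o ≠ toPvr R P none := fun e => by
      obtain rfl := toPvr_injective P e
      exact (hC.parent_mem (mem_range_self S) hoS).2 (R P).cycle_root.symm
    exact (C.disjoint ((List.mem_cons.1 ho).resolve_left hne)
      ((List.mem_cons.1 ho').resolve_left hne)).elim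

/-- The non-leaf vertices of the replacement of `P`, as a directed graph. It embeds both into the
replacement and into the pvr-network, which carries cycles from one to the other. -/
def innerDigraph (R : PvrChoice G) (P : PrimeVertex G) : Digraph (Option (InnerVertex R P)) where
  Adj u v := (R P).N.Adj (toReplacement R P u) (toReplacement R P v)

/-- A cycle of non-leaf vertices, as a cycle of the replacement. -/
def RootedCycle.toReplacement {P : PrimeVertex G} (C : RootedCycle (innerDigraph R P)) :
    RootedCycle (R P).N :=
  C.map (GaTEx.toReplacement R P) (toReplacement_injective P) fun _ _ h => h

/-- A cycle of non-leaf vertices, as a cycle of the pvr-network. -/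
def RootedCycle.toPvr {P : PrimeVertex G} (C : RootedCycle (innerDigraph R P)) :
    RootedCycle (pvrNetwork R) :=
  C.map (GaTEx.toPvr R P) (toPvr_injective P) fun _ _ h => adj_toPvr_toPvr.2 h

theorem exists_pvr_cycle (P : PrimeVertex G) :
    ∃ C : RootedCycle (pvrNetwork R), C.root = Sum.inl P.1 := by
  have hrange : (R P).cycle.verts ⊆ range (toReplacement R P) := fun v hv => by
    by_cases hvr : v = (R P).root
    · exact ⟨none, hvr.symm⟩
    · exact ⟨some ⟨v, hvr, (R P).isElementaryWith_cycle.notMem_leaves hv⟩, rfl⟩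
  obtain ⟨C, hC⟩ := RootedCycle.exists_map_eq (N₁ := innerDigraph R P)
    (toReplacement_injective P) (fun _ _ => Iff.rfl) (R P).cycle hrange
  have hroot : C.root = none :=
    toReplacement_injective P ((congrArg RootedCycle.root hC).trans (R P).cycle_root)
  exact ⟨C.toPvr, congrArg (toPvr R P) hroot⟩

theorem RootedCycle.exists_toPvr_eq {P : PrimeVertex G} (C : RootedCycle (pvrNetwork R))
    (hroot : C.root = Sum.inl P.1) :
    ∃ C' : RootedCycle (innerDigraph R P), C'.root = none ∧ C'.toPvr = C := by
  obtain ⟨C', rfl⟩ := RootedCycle.exists_map_eq (N₁ := innerDigraph R P) (toPvr_injective P)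
    (fun _ _ => adj_toPvr_toPvr.symm) C (C.verts_subset_range_toPvr hroot)
  exact ⟨C', toPvr_injective P hroot, rfl⟩

theorem RootedCycle.exists_hybrid_eq {P : PrimeVertex G} {C : RootedCycle (pvrNetwork R)}
    (hroot : C.root = Sum.inl P.1) :
    ∃ η : InnerVertex R P, C.hybrid = Sum.inr ⟨P, η⟩ ∧ η.1 = (R P).cycle.hybrid := by
  obtain ⟨C', hroot', rfl⟩ := C.exists_toPvr_eq hroot
  obtain ⟨η, hη⟩ := Option.ne_none_iff_exists'.1 (hroot' ▸ C'.root_ne_hybrid).symm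
  refine ⟨η, congrArg (GaTEx.toPvr R P) hη, ?_⟩
  exact (congrArg (GaTEx.toReplacement R P) hη).symm.trans
    ((R P).isElementaryWith_cycle.hybrid_eq C'.toReplacement)

theorem RootedCycle.mem_verts_and_ne_root_iff {P : PrimeVertex G}
    {C : RootedCycle (pvrNetwork R)} (hroot : C.root = Sum.inl P.1) {v : PvrVertex R} :
    (v ∈ C.verts ∧ v ≠ C.root) ↔ ∃ w : InnerVertex R P, v = Sum.inr ⟨P, w⟩ := by
  obtain ⟨C', -, rfl⟩ := C.exists_toPvr_eq hroot
  have hverts : GaTEx.toReplacement R P '' C'.verts = (R P).cycle.verts :=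
    C'.verts_map.symm.trans ((R P).isElementaryWith_cycle.verts_eq C'.toReplacement)
  rw [hroot, RootedCycle.toPvr, RootedCycle.verts_map]
  constructor
  · rintro ⟨⟨_ | w, -, rfl⟩, hne⟩
    · exact absurd rfl hne
    · exact ⟨w, rfl⟩
  · rintro ⟨w, rfl⟩
    have hw : w.1 ∈ (R P).cycle.verts :=
      ((R P).isElementaryWith_cycle.cover w.1).resolve_right w.2.2
    obtain ⟨o, ho, how⟩ := hverts.symm ▸ hw
    obtain rfl : o = some w := toReplacement_injective P how
    exact ⟨⟨some w, ho, rfl⟩, Sum.inr_ne_inl⟩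

end PvrCycles

/-! ### The algorithm -/

section Blocks

variable {X : Type*} {G : SimpleGraph X} {R : PvrChoice G} {P : PrimeVertex G}

theorem exists_adj_leaf (w : InnerVertex R P) : ∃ S, (R P).N.Adj w.1 ((R P).leaf S) := by
  have hC := (R P).isElementaryWith_cycle
  obtain ⟨_, ⟨⟨S, rfl⟩, hS⟩, -⟩ := hC.exists_leaf w.1 ((hC.cover w.1).resolve_right w.2.2)
    (w.2.1.trans_eq (R P).cycle_root.symm)
  exact ⟨S, hS⟩

/-- The maximal strong module whose leaf hangs from an inner vertex of the replacement. -/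
noncomputable def block (w : InnerVertex R P) : maxStrong G P.1.1 := (exists_adj_leaf w).choose

theorem adj_leaf_block (w : InnerVertex R P) : (R P).N.Adj w.1 ((R P).leaf (block w)) :=
  (exists_adj_leaf w).choose_spec

theorem block_eq_of_adj_leaf {w : InnerVertex R P} {S : maxStrong G P.1.1}
    (h : (R P).N.Adj w.1 ((R P).leaf S)) : block w = S := by
  have hC := (R P).isElementaryWith_cycle
  have hw := hC.parent_mem (mem_range_self S) h
  exact (R P).leaf_injective ((hC.exists_leaf w.1 hw.1 hw.2).unique
    ⟨mem_range_self _, adj_leaf_block w⟩ ⟨mem_range_self _, h⟩)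

theorem block_injective : Function.Injective (block (R := R) (P := P)) := fun w w' h =>
  Subtype.ext (((R P).isElementaryWith_cycle.leaf_parent _ (mem_range_self (block w))).unique
    (adj_leaf_block w) (h ▸ adj_leaf_block w'))

theorem block_surjective : Function.Surjective (block (R := R) (P := P)) := by
  intro S
  have hC := (R P).isElementaryWith_cycle
  obtain ⟨u, hu⟩ := (hC.leaf_parent _ (mem_range_self S)).exists
  have hmem := hC.parent_mem (mem_range_self S) hu
  exact ⟨⟨u, (R P).cycle_root ▸ hmem.2, hC.notMem_leaves hmem.1⟩, block_eq_of_adj_leaf hu⟩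

theorem adj_and_notMem_verts_iff {C : RootedCycle (pvrNetwork R)} (hroot : C.root = Sum.inl P.1)
    {w : InnerVertex R P} {b : PvrVertex R} :
    (pvrNetwork R).Adj (Sum.inr ⟨P, w⟩) b ∧ b ∉ C.verts ↔
      b = Sum.inl (childVertex P.1 (block w)) := by
  have hverts := fun v => C.mem_verts_and_ne_root_iff hroot (v := v)
  constructor
  · rintro ⟨hadj, hb⟩
    obtain ⟨u, hu, hg⟩ := (adj_toPvr (o := some w)).1 hadj
    rcases hg.eq_toPvr_or_eq_leaf with ⟨o, rfl, rfl⟩ | ⟨S, rfl, rfl⟩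
    · cases o with
      | none =>
        have hmem := C.root_mem
        rw [hroot] at hmem
        exact absurd hmem hb
      | some w' => exact absurd ((hverts _).2 ⟨w', rfl⟩).1 hb
    · rw [block_eq_of_adj_leaf hu]
  · rintro rfl
    refine ⟨(adj_toPvr (o := some w)).2 ⟨_, adj_leaf_block w, Glue.leaf _⟩, fun hmem => ?_⟩
    have hne : Sum.inl (childVertex P.1 (block w)) ≠ C.root := fun e =>
      maxStrong_ne (block w).2 (congrArg Subtype.val (Sum.inl.inj (e.trans hroot)))
    obtain ⟨w', hw'⟩ := (hverts _).1 ⟨hmem, hne⟩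
    exact Sum.inl_ne_inr hw'

end Blocks

section Correctness

variable {X : Type*} {G : SimpleGraph X} {R : PvrChoice G}

theorem Enumerates.perm {α : Type*} {l l' : List α} {s : Set α} (h : Enumerates l s)
    (hl : l.Perm l') : Enumerates l' s :=
  ⟨hl.nodup h.1, fun a => hl.mem_iff.symm.trans (h.2 a)⟩

theorem isGoodOrder_nonprime [Finite X] {M : MDVertex G} {ζ : AlgState R}
    {cs : List (MDVertex G)} (hM : mdLabel G M = VLabel.zero ∨ mdLabel G M = VLabel.one)
    (hcs : Enumerates cs {c | c ⋖ M})
    (hch : ∀ c, c ⋖ M → IsGoodOrder G c.1 (ζ (Sum.inl c))) :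
    IsGoodOrder G M.1 (cs.flatMap fun c => ζ (Sum.inl c)) := by
  have hcard : M.1.ncard ≠ 1 := hM.elim (fun h => (mdLabel_eq_zero_iff.1 h).1)
    fun h => (mdLabel_eq_one_iff.1 h).1
  have hmax : ∀ c ∈ cs, c.1 ∈ maxStrong G M.1 := fun c hc =>
    (covBy_iff_mem_maxStrong c M).1 ((hcs.2 c).1 hc)
  refine isGoodOrder_flatMap (S := Subtype.val) (fun c hc => maxStrong_isModuleOn (hmax c hc))
    (hcs.1.imp_of_mem fun hc hc' hne => maxStrong_disjoint (hmax _ hc) (hmax _ hc')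
      (Subtype.coe_ne_coe.2 hne))
    (fun x hx => ?_) (fun c hc => hch c ((hcs.2 c).1 hc)) ?_
  · obtain ⟨T, hT, hxT⟩ := exists_mem_maxStrong hcard hx
    exact ⟨childVertex M ⟨T, hT⟩, (hcs.2 _).2 ((covBy_iff_mem_maxStrong _ _).2 hT), hxT⟩
  · intro i hi j hj k hk m _ hnd _ _ a ha b hb c hc d _ hP
    simp only [List.nodup_cons, List.mem_cons, not_or] at hnd
    rcases hM with h | h
    · exact not_adj_of_not_connected (mdLabel_eq_zero_iff.1 h).2 (hmax i hi) (hmax j hj)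
        (Subtype.coe_ne_coe.2 hnd.1.1) ha hb hP.ab
    · exact hP.ac (adj_of_not_compl_connected (mdLabel_eq_one_iff.1 h).2.2 (hmax i hi) (hmax k hk)
        (Subtype.coe_ne_coe.2 hnd.1.2.1) ha hc)

theorem IsP4.quotientGraph {M : Set X} {S T U V : maxStrong G M} {a b c d : X}
    (h : IsP4 G a b c d) (hnd : [S, T, U, V].Nodup) (ha : a ∈ S.1) (hb : b ∈ T.1) (hc : c ∈ U.1)
    (hd : d ∈ V.1) : IsP4 (quotientGraph G M) S T U V := by
  simp only [List.nodup_cons, List.mem_cons, not_or, List.not_mem_nil, not_false_eq_true,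
    and_true] at hnd
  obtain ⟨⟨hST, hSU, hSV⟩, ⟨hTU, hTV⟩, hUV, -⟩ := hnd
  exact
    { ab := (quotientGraph_adj hST ha hb).2 h.ab
      bc := (quotientGraph_adj hTU hb hc).2 h.bc
      cd := (quotientGraph_adj hUV hc hd).2 h.cd
      ac := fun hadj => h.ac ((quotientGraph_adj hSU ha hc).1 hadj)
      bd := fun hadj => h.bd ((quotientGraph_adj hTV hb hd).1 hadj)
      ad := fun hadj => h.ad ((quotientGraph_adj hSV ha hd).1 hadj) }

section Prime

variable {P : PrimeVertex G} {η : InnerVertex R P} {ws : List (InnerVertex R P)}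
  {g : InnerVertex R P → List X}

theorem hybrid_of_isP4_block (hη : η.1 = (R P).cycle.hybrid) {i j l m : InnerVertex R P}
    (hP : IsP4 (quotientGraph G P.1.1) (block i) (block j) (block l) (block m)) :
    ((R P).t (R P).root ≠ VLabel.one → j = η ∨ l = η) ∧
      ((R P).t (R P).root = VLabel.one → i = η ∨ m = η) := by
  let parent := (Equiv.ofBijective (block (R := R) (P := P))
    ⟨block_injective, block_surjective⟩).symm
  have hparent : ∀ w, parent (block w) = w := Equiv.ofBijective_symm_apply_apply _ _
  have hadj : ∀ S, (R P).N.Adj (parent S).1 ((R P).leaf S) := fun S => by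
    obtain ⟨w, rfl⟩ := block_surjective (R := R) S
    rw [hparent]
    exact adj_leaf_block w
  have hhybrid : ∀ w, (parent (block w)).1 = (R P).cycle.hybrid → w = η := fun w hw =>
    Subtype.ext ((hparent w ▸ hw).trans hη.symm)
  have hC := (R P).isElementaryWith_cycle
  rw [← (R P).explains] at hP
  rw [← (R P).cycle_root]
  exact ⟨fun hr => (hC.hybrid_of_isP4_of_root_ne_one (R P).leaf_injective hadj hr hP).imp
      (hhybrid j) (hhybrid l),
    fun hr => (hC.hybrid_of_isP4_of_root_eq_one (R P).leaf_injective hadj hr hP).imp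
      (hhybrid i) (hhybrid m)⟩

theorem isGoodOrder_flatMap_block [Finite X] (hη : η.1 = (R P).cycle.hybrid)
    (hws : Enumerates ws univ) (hg : ∀ w, IsGoodOrder G (block w).1 (g w))
    (hlast : (R P).t (R P).root = VLabel.one → ∀ w, ¬ [η, w] <+ ws)
    (hfirst : (R P).t (R P).root ≠ VLabel.one → ∀ w, ¬ [w, η] <+ ws) :
    IsGoodOrder G P.1.1 (ws.flatMap g) := by
  refine isGoodOrder_flatMap (S := fun w => (block w).1)
    (fun w _ => maxStrong_isModuleOn (block w).2)
    (hws.1.imp fun hne => maxStrong_disjoint (block _).2 (block _).2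
      (Subtype.coe_ne_coe.2 (block_injective.ne hne))) (fun x hx => ?_) (fun w _ => hg w) ?_
  · obtain ⟨S, hS, hxS⟩ := exists_mem_maxStrong (mdLabel_eq_prime_iff.1 P.2).1 hx
    obtain ⟨w, hw⟩ := block_surjective (R := R) ⟨S, hS⟩
    exact ⟨w, (hws.2 w).2 (mem_univ w), hw ▸ hxS⟩
  · intro i _ j _ l _ m _ hnd hij hml a ha b hb c hc d hd hp4
    have hhybrid := hybrid_of_isP4_block hη
      (hp4.quotientGraph (hnd.map block_injective) ha hb hc hd)
    by_cases hr : (R P).t (R P).root = VLabel.one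
    · rcases hhybrid.2 hr with rfl | rfl
      exacts [hlast hr j hij, hlast hr l hml]
    · rcases hhybrid.1 hr with rfl | rfl
      exacts [hfirst hr i hij, hfirst hr m hml]

theorem isGoodOrder_block_cons [Finite X] (hη : η.1 = (R P).cycle.hybrid)
    (hws : Enumerates (η :: ws) univ) (hg : ∀ w, IsGoodOrder G (block w).1 (g w))
    (hr : (R P).t (R P).root ≠ VLabel.one) : IsGoodOrder G P.1.1 (g η ++ ws.flatMap g) :=
  isGoodOrder_flatMap_block hη hws hg (fun h => absurd h hr) fun _ _ =>
    not_pair_sublist_cons hws.1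

theorem isGoodOrder_block_concat [Finite X] (hη : η.1 = (R P).cycle.hybrid)
    (hws : Enumerates (ws ++ [η]) univ) (hg : ∀ w, IsGoodOrder G (block w).1 (g w))
    (hr : (R P).t (R P).root = VLabel.one) : IsGoodOrder G P.1.1 (ws.flatMap g ++ g η) := by
  simpa using isGoodOrder_flatMap_block hη hws hg (fun _ _ => not_pair_sublist_concat hws.1)
    (absurd hr)

theorem label_root_eq_zero_or_one :
    (R P).t (R P).root = VLabel.zero ∨ (R P).t (R P).root = VLabel.one := by
  have hleaf : (R P).t (R P).root ≠ VLabel.leaf := fun h =>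
    (R P).isElementaryWith_cycle.notMem_leaves ((R P).cycle_root ▸ (R P).cycle.root_mem)
      (((R P).labeling.1 _).1 h)
  have hprime := (R P).labeling.2 (R P).root
  cases h : (R P).t (R P).root <;> simp_all

theorem exists_enumerates_inner {C : RootedCycle (pvrNetwork R)} {vs : List (PvrVertex R)}
    (hroot : C.root = Sum.inl P.1) (hη : C.hybrid = Sum.inr ⟨P, η⟩)
    (hvs : Enumerates vs (C.verts \ {C.root, C.hybrid})) :
    ∃ ws : List (InnerVertex R P), ws.map (fun w => Sum.inr ⟨P, w⟩) = vs ∧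
      Enumerates (η :: ws) univ := by
  have hverts := fun v => C.mem_verts_and_ne_root_iff hroot (v := v)
  have hinj : Function.Injective fun w : InnerVertex R P => (Sum.inr ⟨P, w⟩ : PvrVertex R) :=
    Sum.inr_injective.comp sigma_mk_injective
  obtain ⟨ws, rfl⟩ : vs ∈ range (List.map fun w : InnerVertex R P => Sum.inr ⟨P, w⟩) := by
    rw [Set.range_list_map]
    intro v hv
    have hv' := (hvs.2 v).1 hv
    obtain ⟨w, rfl⟩ := (hverts v).1 ⟨hv'.1, fun h => hv'.2 (Or.inl h)⟩
    exact mem_range_self w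
  have hmem : ∀ w, w ∈ ws ↔ w ≠ η := fun w => by
    have hw := (hverts (Sum.inr ⟨P, w⟩)).2 ⟨w, rfl⟩
    rw [← List.mem_map_of_injective hinj, hvs.2]
    simp [hw.1, hw.2, hη]
  refine ⟨ws, rfl, List.nodup_cons.2 ⟨fun h => (hmem η).1 h rfl, hvs.1.of_map⟩, fun w => ?_⟩
  simp [hmem, em]

open Classical in
theorem isGoodOrder_prime [Finite X] {ζ ζ₁ : AlgState R} {C : RootedCycle (pvrNetwork R)}
    {vs : List (PvrVertex R)} (hroot : C.root = Sum.inl P.1)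
    (hcopy : ∀ w ∈ C.verts, w ≠ C.root →
      ∃ w', (pvrNetwork R).Adj w w' ∧ w' ∉ C.verts ∧ ζ₁ w = ζ w')
    (hvs : Enumerates vs (C.verts \ {C.root, C.hybrid}))
    (hch : ∀ c, c ⋖ P.1 → IsGoodOrder G c.1 (ζ (Sum.inl c))) :
    IsGoodOrder G P.1.1
      (if pvrLabel R C.root = VLabel.zero then ζ₁ C.hybrid ++ vs.flatMap ζ₁
        else vs.flatMap ζ₁ ++ ζ₁ C.hybrid) := by
  obtain ⟨η, hη, hηC⟩ := C.exists_hybrid_eq hroot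
  obtain ⟨ws, rfl, hws⟩ := exists_enumerates_inner hroot hη hvs
  have hblock : ∀ w : InnerVertex R P, IsGoodOrder G (block w).1 (ζ₁ (Sum.inr ⟨P, w⟩)) := by
    intro w
    have hw := (C.mem_verts_and_ne_root_iff hroot).2 ⟨w, rfl⟩
    obtain ⟨w', hadj, hnot, hζ⟩ := hcopy _ hw.1 hw.2
    rw [hζ, (adj_and_notMem_verts_iff hroot).1 ⟨hadj, hnot⟩]
    exact hch _ ((covBy_iff_mem_maxStrong _ _).2 (block w).2)
  have hlabel : pvrLabel R C.root = (R P).t (R P).root := by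
    simp [hroot, pvrLabel, P.2]
  rw [hlabel, hη, List.flatMap_map]
  split_ifs with hr
  · exact isGoodOrder_block_cons hηC hws hblock (by simp [hr])
  · exact isGoodOrder_block_concat hηC (hws.perm (List.perm_append_singleton _ _).symm) hblock
      (label_root_eq_zero_or_one.resolve_left hr)

end Prime

theorem Step.eq_of_ne {M M' : MDVertex G} {ζ ζ' : AlgState R} (h : Step R M ζ ζ')
    (hne : M' ≠ M) : ζ' (Sum.inl M') = ζ (Sum.inl M') := by
  classical
  have hne' : (Sum.inl M' : PvrVertex R) ≠ Sum.inl M := Sum.inl_injective.ne hne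
  cases h with
  | leaf hl => rfl
  | nonprime cs hM hcs => exact Function.update_of_ne hne' _ _
  | prime ζ₁ C vs hM hroot hcopy hkeep hvs =>
    rw [Function.update_of_ne hne']
    refine hkeep _ fun hv => ?_
    obtain ⟨w, hw⟩ := (C.mem_verts_and_ne_root_iff (P := ⟨M, hM⟩) hroot).1 hv
    exact Sum.inl_ne_inr hw

theorem Step.isGoodOrder [Finite X] {M : MDVertex G} {ζ ζ' : AlgState R} (h : Step R M ζ ζ')
    (hch : ∀ c, c ⋖ M → IsGoodOrder G c.1 (ζ (Sum.inl c)))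
    (hleaf : mdLabel G M = VLabel.leaf → IsGoodOrder G M.1 (ζ (Sum.inl M))) :
    IsGoodOrder G M.1 (ζ' (Sum.inl M)) := by
  classical
  cases h with
  | leaf hl => exact hleaf hl
  | nonprime cs hM hcs =>
    rw [Function.update_self]
    exact isGoodOrder_nonprime hM hcs hch
  | prime ζ₁ C vs hM hroot hcopy hkeep hvs =>
    rw [Function.update_self]
    exact isGoodOrder_prime (P := ⟨M, hM⟩) hroot hcopy hvs hch

/-- All leaves and all elements of `D` have good orders in the state `ζ`: the loop invariant, where
`D` is the set of processed vertices. -/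
def GoodState (R : PvrChoice G) (D : Set (MDVertex G)) (ζ : AlgState R) : Prop :=
  ∀ M, mdLabel G M = VLabel.leaf ∨ M ∈ D → IsGoodOrder G M.1 (ζ (Sum.inl M))

theorem GoodState.mono {D E : Set (MDVertex G)} {ζ : AlgState R} (h : GoodState R E ζ)
    (hDE : D ⊆ E) : GoodState R D ζ := fun M hM => h M (hM.imp_right fun hMD => hDE hMD)

theorem Step.goodState [Finite X] {M : MDVertex G} {ζ ζ' : AlgState R} (h : Step R M ζ ζ')
    {D : Set (MDVertex G)} (hζ : GoodState R D ζ) (hch : ∀ c, c ⋖ M → c ∈ D) :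
    GoodState R (insert M D) ζ' := by
  intro M' hM'
  by_cases hne : M' = M
  · subst hne
    exact h.isGoodOrder (fun c hc => hζ c (Or.inr (hch c hc))) fun hl => hζ M' (Or.inl hl)
  · rw [h.eq_of_ne hne]
    exact hζ M' (hM'.imp_right fun hMD => mem_of_mem_insert_of_ne hMD hne)

theorem Loop.exists_of_append {l₁ l₂ : List (MDVertex G)} {ζ ζ' : AlgState R}
    (h : Loop R (l₁ ++ l₂) ζ ζ') : ∃ ζ₁, Loop R l₁ ζ ζ₁ ∧ Loop R l₂ ζ₁ ζ' := by
  induction l₁ generalizing ζ with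
  | nil => exact ⟨ζ, Loop.nil ζ, h⟩
  | cons M l ih =>
    cases h with
    | cons _ _ _ ζ₂ _ hstep hloop =>
      obtain ⟨ζ₁, h₁, h₂⟩ := ih hloop
      exact ⟨ζ₁, Loop.cons _ _ _ _ _ hstep h₁, h₂⟩

theorem goodState_flatMap {cs : List (MDVertex G)} {f : MDVertex G → List (MDVertex G)}
    (hf : ∀ c ∈ cs, ∀ {D ζ ζ'}, Loop R (f c) ζ ζ' → GoodState R D ζ →
      GoodState R (insert c D) ζ') {D : Set (MDVertex G)} {ζ ζ' : AlgState R}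
    (hloop : Loop R (cs.flatMap f) ζ ζ') (hζ : GoodState R D ζ) :
    GoodState R (D ∪ {c | c ∈ cs}) ζ' := by
  induction cs generalizing D ζ with
  | nil =>
    cases hloop
    simpa using hζ
  | cons c cs ih =>
    rw [List.flatMap_cons] at hloop
    obtain ⟨ζ₁, hc, hcs⟩ := hloop.exists_of_append
    refine (ih (fun c' hc' => hf c' (List.mem_cons_of_mem _ hc')) hcs
      (hf c List.mem_cons_self hc hζ)).mono ?_
    rintro M (hM | hM)
    · exact Or.inl (Or.inr hM)
    · exact (List.mem_cons.1 hM).imp Or.inl id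

theorem Postorder.goodState [Finite X] {M : MDVertex G} {l : List (MDVertex G)}
    (h : Postorder M l) {D : Set (MDVertex G)} {ζ ζ' : AlgState R} (hloop : Loop R l ζ ζ')
    (hζ : GoodState R D ζ) : GoodState R (insert M D) ζ' := by
  induction h generalizing D ζ ζ' with
  | mk M cs f hcs _ ih =>
    obtain ⟨ζ₁, hchildren, hM⟩ := hloop.exists_of_append
    have hζ₁ := goodState_flatMap ih hchildren hζ
    cases hM with
    | cons _ _ _ _ _ hstep hnil =>
      cases hnil
      exact (hstep.goodState hζ₁ fun c hc => Or.inr ((hcs.2 c).2 hc)).mono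
        (insert_subset_insert subset_union_left)

theorem AlgReturns.isPerfectOrder [Finite X] {o : List X} (h : AlgReturns R o) :
    IsPerfectOrder G o := by
  obtain ⟨root, l, ζ, ζ', hroot, hpost, hinit, hloop, rfl⟩ := h
  have hζ : GoodState R ∅ ζ := by
    rintro M (hM | hM)
    · obtain ⟨x, hx⟩ := Set.ncard_eq_one.1 (mdLabel_eq_leaf_iff.1 hM)
      rw [hinit x M hx]
      exact isGoodOrder_singleton hx
    · exact absurd hM (notMem_empty M)
  have hgood := hpost.goodState hloop hζ root (Or.inr (mem_insert _ _))
  rw [hroot] at hgood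
  exact hgood.isPerfectOrder

end Correctness

section Termination

variable {X : Type*} {G : SimpleGraph X}

theorem exists_enumerates {α : Type*} {s : Set α} (hs : s.Finite) : ∃ l : List α, Enumerates l s :=
  ⟨hs.toFinset.toList, Finset.nodup_toList _, by simp⟩

theorem exists_step [Finite X] (R : PvrChoice G) (M : MDVertex G) (ζ : AlgState R) :
    ∃ ζ', Step R M ζ ζ' := by
  classical
  obtain ⟨cs, hcs⟩ := exists_enumerates (toFinite {c | c ⋖ M})
  cases hM : mdLabel G M with
  | leaf => exact ⟨ζ, Step.leaf M ζ hM⟩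
  | zero => exact ⟨_, Step.nonprime M ζ cs (Or.inl hM) hcs⟩
  | one => exact ⟨_, Step.nonprime M ζ cs (Or.inr hM) hcs⟩
  | prime =>
    obtain ⟨C, hroot⟩ := exists_pvr_cycle (R := R) ⟨M, hM⟩
    have hchild : ∀ w ∈ C.verts, w ≠ C.root → ∃ w', (pvrNetwork R).Adj w w' ∧ w' ∉ C.verts := by
      intro w hw hne
      obtain ⟨v, rfl⟩ := (C.mem_verts_and_ne_root_iff hroot).1 ⟨hw, hne⟩
      exact ⟨_, (adj_and_notMem_verts_iff hroot).2 rfl⟩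
    have : Nonempty (PvrVertex R) := ⟨Sum.inl M⟩
    choose! child hadj hnot using hchild
    have hfin : (C.verts \ {C.root, C.hybrid}).Finite := (List.finite_toSet _).sdiff
    obtain ⟨vs, hvs⟩ := exists_enumerates hfin
    exact ⟨_, Step.prime M ζ (fun w => if w ∈ C.verts ∧ w ≠ C.root then ζ (child w) else ζ w) C vs
      hM hroot (fun w hw hne => ⟨child w, hadj w hw hne, hnot w hw hne, if_pos ⟨hw, hne⟩⟩)
      (fun w hw => if_neg hw) hvs⟩

theorem exists_loop [Finite X] (R : PvrChoice G) (l : List (MDVertex G)) (ζ : AlgState R) :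
    ∃ ζ', Loop R l ζ ζ' := by
  induction l generalizing ζ with
  | nil => exact ⟨ζ, Loop.nil ζ⟩
  | cons M l ih =>
    obtain ⟨ζ₁, hstep⟩ := exists_step R M ζ
    obtain ⟨ζ₂, hloop⟩ := ih ζ₁
    exact ⟨ζ₂, Loop.cons _ _ _ _ _ hstep hloop⟩

theorem exists_postorder [Finite X] (M : MDVertex G) : ∃ l, Postorder M l := by
  induction M using WellFoundedLT.induction with
  | ind M ih =>
    obtain ⟨cs, hcs⟩ := exists_enumerates (toFinite {c | c ⋖ M})
    have hpost : ∀ c ∈ cs, ∃ l, Postorder c l := fun c hc => ih c ((hcs.2 c).1 hc).lt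
    choose! f hf using hpost
    exact ⟨_, Postorder.mk M cs f hcs hf⟩

theorem exists_algReturns [Finite X] [Nonempty X] (R : PvrChoice G) :
    ∃ o, AlgReturns R o := by
  classical
  let root : MDVertex G := ⟨univ, univ_nonempty, isStrongModuleOn_self⟩
  obtain ⟨l, hl⟩ := exists_postorder root
  obtain ⟨ζ', hζ'⟩ := exists_loop R l
    (Sum.elim (fun M : MDVertex G => [M.2.1.some]) fun _ => [])
  refine ⟨_, root, l, _, ζ', rfl, hl, fun x M hM => ?_, hζ', rfl⟩
  have hsome : M.2.1.some ∈ ({x} : Set X) := hM ▸ M.2.1.some_mem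
  exact congrArg (fun y => [y]) hsome

end Termination

/-! ### Biconnected vertex sets -/

section Biconnected

variable {W : Type*} {N : Digraph W} {A B P Q S T : Set W} {u v w x y z : W}

/-- There is a walk from `u` to `w` inside `A`, ignoring directions. In contrast to reachability in
an induced subgraph, `u` and `w` are vertices of `N`, so that `A` can be varied. -/
def Reach (N : Digraph W) (A : Set W) (u w : W) : Prop :=
  Relation.ReflTransGen (fun a b => (N.Adj a b ∨ N.Adj b a) ∧ a ∈ A ∧ b ∈ A) u w

theorem Reach.refl (u : W) : Reach N A u u := Relation.ReflTransGen.refl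

theorem Reach.trans (h : Reach N A u v) (h' : Reach N A v w) : Reach N A u w :=
  Relation.ReflTransGen.trans h h'

theorem Reach.symm (h : Reach N A u v) : Reach N A v u := by
  induction h with
  | refl => exact Reach.refl u
  | tail _ h ih => exact Relation.ReflTransGen.head ⟨h.1.symm, h.2.2, h.2.1⟩ ih

theorem Reach.mono (h : Reach N A u v) (hAB : A ⊆ B) : Reach N B u v :=
  Relation.ReflTransGen.mono (fun _ _ h => ⟨h.1, hAB h.2.1, hAB h.2.2⟩) _ _ h

theorem Reach.mono_remove (h : Reach N (A \ {v}) u w) (hAB : A ⊆ B) : Reach N (B \ {v}) u w :=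
  h.mono (sdiff_subset_sdiff_left hAB)

theorem Reach.remove (h : Reach N A u w) (hAB : A ⊆ B) (hv : v ∉ A) : Reach N (B \ {v}) u w :=
  h.mono (subset_sdiff_singleton hAB hv)

theorem reachable_induce_iff (u w : A) :
    ((SimpleGraph.fromRel N.Adj).induce A).Reachable u w ↔ Reach N A u w := by
  rw [SimpleGraph.reachable_iff_reflTransGen]
  constructor
  · intro h
    refine Relation.ReflTransGen.lift Subtype.val (fun b c hbc => ?_) _ _ h
    exact ⟨((SimpleGraph.fromRel_adj _ _ _).1 hbc).2, b.2, c.2⟩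
  · obtain ⟨w, hw⟩ := w
    intro h
    change Reach N A u w at h
    induction h with
    | refl => exact Relation.ReflTransGen.refl
    | @tail b c _ hbc ih =>
      rcases eq_or_ne b c with rfl | hne
      · exact ih hw
      · exact (ih hbc.2.1).tail ((SimpleGraph.fromRel_adj _ _ _).2 ⟨hne, hbc.1⟩)

theorem isBiconnected_iff : IsBiconnected N S ↔
    S.Nonempty ∧ (∀ u ∈ S, ∀ w ∈ S, Reach N S u w) ∧
      ∀ v, ∀ u ∈ S, ∀ w ∈ S, u ≠ v → w ≠ v → Reach N (S \ {v}) u w := by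
  constructor
  · rintro ⟨hconn, hcut⟩
    have hreach : ∀ u ∈ S, ∀ w ∈ S, Reach N S u w := fun u hu w hw =>
      (reachable_induce_iff ⟨u, hu⟩ ⟨w, hw⟩).1 (hconn.preconnected _ _)
    refine ⟨nonempty_coe_sort.1 hconn.nonempty, hreach, fun v u hu w hw huv hwv => ?_⟩
    by_cases hv : v ∈ S
    · exact (reachable_induce_iff (A := S \ {v}) ⟨u, hu, huv⟩ ⟨w, hw, hwv⟩).1 (hcut v hv _ _)
    · exact (hreach u hu w hw).remove subset_rfl hv
  · rintro ⟨hS, hreach, hcut⟩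
    have := hS.to_subtype
    refine ⟨⟨fun u w => (reachable_induce_iff u w).2 (hreach u u.2 w w.2)⟩, fun v _ u w => ?_⟩
    exact (reachable_induce_iff u w).2 (hcut v u u.2.1 w w.2.1 u.2.2 w.2.2)

theorem isBiconnected_of_hubs (hS : S.Nonempty) (h : ∃ c, ∀ u ∈ S, Reach N S u c)
    (hcut : ∀ v, ∃ c, ∀ u ∈ S, u ≠ v → Reach N (S \ {v}) u c) : IsBiconnected N S := by
  obtain ⟨c, hc⟩ := h
  refine isBiconnected_iff.2 ⟨hS, fun u hu w hw => (hc u hu).trans (hc w hw).symm, ?_⟩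
  intro v u hu w hw huv hwv
  obtain ⟨c, hc⟩ := hcut v
  exact (hc u hu huv).trans (hc w hw hwv).symm

theorem IsBiconnected.union (hS : IsBiconnected N S) (hT : IsBiconnected N T)
    (hST : (S ∩ T).Nontrivial) : IsBiconnected N (S ∪ T) := by
  rw [isBiconnected_iff] at hS hT
  obtain ⟨p, hp⟩ := hST.nonempty
  refine isBiconnected_of_hubs ⟨p, Or.inl hp.1⟩ ⟨p, ?_⟩ fun v => ?_
  · rintro u (hu | hu)
    · exact (hS.2.1 u hu p hp.1).mono subset_union_left
    · exact (hT.2.1 u hu p hp.2).mono subset_union_right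
  · obtain ⟨c, hc, hcv⟩ := hST.exists_ne v
    refine ⟨c, ?_⟩
    rintro u (hu | hu) huv
    · exact (hS.2.2 v u hu c hc.1 huv hcv).mono_remove subset_union_left
    · exact (hT.2.2 v u hu c hc.2 huv hcv).mono_remove subset_union_right

/-- `P` behaves like the vertex set of a path from `x` to `y`: it connects `x` and `y`, and
after the removal of a vertex, every other vertex is still connected to `x` or `y`. -/
structure Linked (N : Digraph W) (x y : W) (P : Set W) : Prop where
  left_mem : x ∈ P
  right_mem : y ∈ P
  reach : Reach N P x y
  remove : ∀ v, ∀ u ∈ P, u ≠ v →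
    (x ≠ v ∧ Reach N (P \ {v}) u x) ∨ (y ≠ v ∧ Reach N (P \ {v}) u y)

namespace Linked

theorem symm (h : Linked N x y P) : Linked N y x P :=
  ⟨h.right_mem, h.left_mem, h.reach.symm, fun v u hu huv => (h.remove v u hu huv).symm⟩

theorem refl (x : W) : Linked N x x {x} := by
  refine ⟨rfl, rfl, Reach.refl _, ?_⟩
  rintro v u rfl huv
  exact Or.inl ⟨huv, Reach.refl _⟩

theorem edge (h : N.Adj x y) : Linked N x y {x, y} := by
  refine ⟨mem_insert x {y}, mem_insert_of_mem x rfl,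
    Relation.ReflTransGen.single ⟨Or.inl h, mem_insert x {y}, mem_insert_of_mem x rfl⟩, ?_⟩
  rintro v u (rfl | rfl) huv
  · exact Or.inl ⟨huv, Reach.refl _⟩
  · exact Or.inr ⟨huv, Reach.refl _⟩

theorem trans (h : Linked N x y P) (h' : Linked N y z Q) (hPQ : ∀ v ∈ P, v ∈ Q → v = y) :
    Linked N x z (P ∪ Q) := by
  refine ⟨Or.inl h.left_mem, Or.inr h'.right_mem,
    (h.reach.mono subset_union_left).trans (h'.reach.mono subset_union_right), ?_⟩
  have hmid : ∀ v, y ≠ v → ∀ u, Reach N ((P ∪ Q) \ {v}) u y →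
      (x ≠ v ∧ Reach N ((P ∪ Q) \ {v}) u x) ∨ (z ≠ v ∧ Reach N ((P ∪ Q) \ {v}) u z) := by
    intro v hyv u hu
    by_cases hvP : v ∈ P
    · have hvQ : v ∉ Q := fun hvQ => hyv (hPQ v hvP hvQ).symm
      exact Or.inr ⟨fun e => hvQ (e ▸ h'.right_mem),
        hu.trans (h'.reach.remove subset_union_right hvQ)⟩
    · exact Or.inl ⟨fun e => hvP (e ▸ h.left_mem),
        hu.trans (h.reach.remove subset_union_left hvP).symm⟩
  rintro v u (hu | hu) huv
  · rcases h.remove v u hu huv with ⟨hx, hux⟩ | ⟨hy, huy⟩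
    · exact Or.inl ⟨hx, hux.mono_remove subset_union_left⟩
    · exact hmid v hy u (huy.mono_remove subset_union_left)
  · rcases h'.remove v u hu huv with ⟨hy, huy⟩ | ⟨hz, huz⟩
    · exact hmid v hy u (huy.mono_remove subset_union_right)
    · exact Or.inr ⟨hz, huz.mono_remove subset_union_right⟩

theorem union (hP : Linked N x y P) (hQ : Linked N x y Q) : Linked N x y (P ∪ Q) := by
  refine ⟨Or.inl hP.left_mem, Or.inl hP.right_mem, hP.reach.mono subset_union_left, ?_⟩
  rintro v u (hu | hu) huv
  · exact (hP.remove v u hu huv).imp (And.imp_right fun h => h.mono_remove subset_union_left)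
      (And.imp_right fun h => h.mono_remove subset_union_left)
  · exact (hQ.remove v u hu huv).imp (And.imp_right fun h => h.mono_remove subset_union_right)
      (And.imp_right fun h => h.mono_remove subset_union_right)

theorem isBiconnected (hP : Linked N x y P)
    (hxy : ∀ v, x ≠ v → y ≠ v → Reach N (P \ {v}) x y) : IsBiconnected N P := by
  refine isBiconnected_of_hubs ⟨x, hP.left_mem⟩ ⟨x, fun u hu => ?_⟩ fun v => ?_
  · rcases eq_or_ne u y with rfl | huy
    · exact hP.reach.symm
    · exact ((hP.remove y u hu huy).resolve_right fun h => h.1 rfl).2.mono sdiff_subset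
  · by_cases hx : x = v
    · exact ⟨y, fun u hu huv => ((hP.remove v u hu huv).resolve_left fun h => h.1 hx).2⟩
    · refine ⟨x, fun u hu huv => ?_⟩
      rcases hP.remove v u hu huv with h | h
      · exact h.2
      · exact h.2.trans (hxy v hx h.1).symm

theorem isBiconnected_union (hP : Linked N x y P) (hQ : Linked N x y Q)
    (hPQ : ∀ v ∈ P, v ∈ Q → v = x ∨ v = y) : IsBiconnected N (P ∪ Q) := by
  refine (hP.union hQ).isBiconnected fun v hx hy => ?_
  by_cases hvP : v ∈ P
  · exact hQ.reach.remove subset_union_right fun hvQ => (hPQ v hvP hvQ).elim hx.symm hy.symm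
  · exact hP.reach.remove subset_union_left hvP

end Linked

end Biconnected

/-! ### The ancestor order of a galled-tree -/

section AncestorOrder

variable {W : Type*} {N : Digraph W} {a b c h p q : W}

theorem IsDAG.ne_of_adj (hdag : IsDAG N) (hab : N.Adj a b) : a ≠ b := by
  rintro rfl
  exact hdag a (.single hab)

theorem not_ancestor_of_adj (hdag : IsDAG N) (hab : N.Adj a b) : ¬ IsAncestor N b a :=
  fun hba => hdag a (Relation.TransGen.head' hab hba)

theorem exists_linked_of_ancestor (hdag : IsDAG N) (hab : IsAncestor N a b) :
    ∃ P, Linked N a b P ∧ (∀ v ∈ P, IsAncestor N a v ∧ IsAncestor N v b) ∧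
      (a ≠ b → ∃ p ∈ P, N.Adj p b) := by
  induction hab with
  | refl =>
    refine ⟨{a}, Linked.refl a, ?_, fun h => absurd rfl h⟩
    rintro v rfl
    exact ⟨.refl, .refl⟩
  | @tail c b hac hcb ih =>
    obtain ⟨P, hP, hbet, -⟩ := ih
    refine ⟨P ∪ {c, b}, hP.trans (Linked.edge hcb) ?_, ?_, fun _ => ⟨c, by simp, hcb⟩⟩
    · rintro v hv (rfl | rfl)
      · rfl
      · exact absurd (hbet v hv).2 (not_ancestor_of_adj hdag hcb)
    · rintro v (hv | rfl | rfl)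
      · exact ⟨(hbet v hv).1, (hbet v hv).2.tail hcb⟩
      · exact ⟨hac, .single hcb⟩
      · exact ⟨hac.tail hcb, .refl⟩

theorem IsLCA.eq_of_ancestor (ha : IsLCA N {a, b} c) (hpa : IsAncestor N p a)
    (hpb : IsAncestor N p b) (hcp : IsAncestor N c p) : p = c :=
  ha.2 p (by rintro v (rfl | rfl) <;> assumption) hcp

theorem exists_linked_of_isLCA (hdag : IsDAG N) (hc : IsLCA N {a, b} c) :
    ∃ P, Linked N a b P ∧ (c ≠ a → ∃ s ∈ P, N.Adj s a) ∧
      ∀ v ∈ P, IsAncestor N c v ∧ (IsAncestor N v a ∨ IsAncestor N v b) := by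
  obtain ⟨P, hP, hPbet, hs⟩ := exists_linked_of_ancestor hdag (hc.1 a (by simp))
  obtain ⟨Q, hQ, hQbet, -⟩ := exists_linked_of_ancestor hdag (hc.1 b (by simp))
  refine ⟨P ∪ Q, hP.symm.trans hQ fun v hvP hvQ => ?_, fun hne => ?_, ?_⟩
  · exact hc.eq_of_ancestor (hPbet v hvP).2 (hQbet v hvQ).2 (hPbet v hvP).1
  · exact (hs hne).imp fun s hs => ⟨Or.inl hs.1, hs.2⟩
  · rintro v (hv | hv)
    · exact ⟨(hPbet v hv).1, Or.inl (hPbet v hv).2⟩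
    · exact ⟨(hQbet v hv).1, Or.inr (hQbet v hv).2⟩

/-- `h` is a maximal common descendant of `a` and `b`. -/
structure IsMaxDesc (N : Digraph W) (a b h : W) : Prop where
  left : IsAncestor N a h
  right : IsAncestor N b h
  max : ∀ h', IsAncestor N a h' → IsAncestor N b h' → IsAncestor N h' h → h' = h

namespace IsMaxDesc

theorem symm (hh : IsMaxDesc N a b h) : IsMaxDesc N b a h :=
  ⟨hh.right, hh.left, fun h' h1 h2 => hh.max h' h2 h1⟩

theorem not_ancestor_of_adj (hdag : IsDAG N) (hh : IsMaxDesc N a b h) (hp : N.Adj p h)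
    (hap : IsAncestor N a p) : ¬ IsAncestor N b p := fun hbp =>
  hdag.ne_of_adj hp (hh.max p hap hbp (.single hp))

theorem exists_linked (hdag : IsDAG N) (hab : IncompRel (IsAncestor N) a b)
    (hh : IsMaxDesc N a b h) :
    ∃ P, Linked N a b P ∧ h ∈ P ∧
      (∃ p ∈ P, N.Adj p h ∧ IsAncestor N a p ∧ ¬ IsAncestor N b p) ∧
      (∃ q ∈ P, N.Adj q h ∧ IsAncestor N b q ∧ ¬ IsAncestor N a q) ∧
      ∀ v ∈ P, (IsAncestor N a v ∨ IsAncestor N b v) ∧ IsAncestor N v h := by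
  obtain ⟨P, hP, hPbet, hp⟩ := exists_linked_of_ancestor hdag hh.left
  obtain ⟨Q, hQ, hQbet, hq⟩ := exists_linked_of_ancestor hdag hh.right
  obtain ⟨p, hpP, hp⟩ := hp fun e => hab.2 (e ▸ hh.right)
  obtain ⟨q, hqQ, hq⟩ := hq fun e => hab.1 (e ▸ hh.left)
  refine ⟨P ∪ Q, hP.trans hQ.symm fun v hvP hvQ => ?_, Or.inl hP.right_mem,
    ⟨p, Or.inl hpP, hp, (hPbet p hpP).1, hh.not_ancestor_of_adj hdag hp (hPbet p hpP).1⟩,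
    ⟨q, Or.inr hqQ, hq, (hQbet q hqQ).1, hh.symm.not_ancestor_of_adj hdag hq (hQbet q hqQ).1⟩, ?_⟩
  · exact hh.max v (hPbet v hvP).1 (hQbet v hvQ).1 (hPbet v hvP).2
  · rintro v (hv | hv)
    · exact ⟨Or.inl (hPbet v hv).1, (hPbet v hv).2⟩
    · exact ⟨Or.inr (hQbet v hv).1, (hQbet v hv).2⟩

end IsMaxDesc

variable [Finite W]

theorem wellFounded_adj (hdag : IsDAG N) : WellFounded (Relation.TransGen N.Adj) := by
  have : Std.Irrefl (Relation.TransGen N.Adj) := ⟨hdag⟩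
  exact Finite.wellFounded_of_trans_of_irrefl _

theorem wellFounded_adj_swap (hdag : IsDAG N) :
    WellFounded (Function.swap (Relation.TransGen N.Adj)) := by
  have : Std.Irrefl (Function.swap (Relation.TransGen N.Adj)) := ⟨hdag⟩
  have : IsTrans W (Function.swap (Relation.TransGen N.Adj)) := ⟨fun _ _ _ h h' => h'.trans h⟩
  exact Finite.wellFounded_of_trans_of_irrefl _

theorem exists_isMaxDesc (hdag : IsDAG N) (hac : IsAncestor N a c) (hbc : IsAncestor N b c) :
    ∃ h, IsMaxDesc N a b h ∧ IsAncestor N h c := by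
  obtain ⟨h, ⟨hah, hbh, hhc⟩, hmin⟩ := (wellFounded_adj hdag).has_min
    {h | IsAncestor N a h ∧ IsAncestor N b h ∧ IsAncestor N h c} ⟨c, hac, hbc, .refl⟩
  refine ⟨h, ⟨hah, hbh, fun h' hah' hbh' hle => ?_⟩, hhc⟩
  exact ((Relation.reflTransGen_iff_eq_or_transGen.1 hle).resolve_right
    (hmin _ ⟨hah', hbh', hle.trans hhc⟩)).symm

theorem exists_isLCA_below (hdag : IsDAG N) {A : Set W} (hc : ∀ a ∈ A, IsAncestor N c a) :
    ∃ w, IsLCA N A w ∧ IsAncestor N c w := by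
  obtain ⟨w, ⟨hw, hcw⟩, hmin⟩ := (wellFounded_adj_swap hdag).has_min
    {w | (∀ a ∈ A, IsAncestor N w a) ∧ IsAncestor N c w} ⟨c, hc, .refl⟩
  refine ⟨w, ⟨hw, fun w' hw' hww' => ?_⟩, hcw⟩
  exact (Relation.reflTransGen_iff_eq_or_transGen.1 hww').resolve_right
    (hmin w' ⟨hw', hcw.trans hww'⟩)

end AncestorOrder

section GalledTree

variable {W : Type*} {N : Digraph W} {L S T : Set W} {a b c h h' p q w w' x y z z' z'' : W}

/-- `S` contains the vertex `h` and two of its parents. In a galled-tree such an `h` is the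
hybrid-vertex of every biconnected component that contains `S`. -/
def IsHybridWithin (N : Digraph W) (S : Set W) (h : W) : Prop :=
  h ∈ S ∧ ∃ p ∈ S, ∃ q ∈ S, p ≠ q ∧ N.Adj p h ∧ N.Adj q h

theorem IsHybridWithin.mono (hh : IsHybridWithin N S h) (hST : S ⊆ T) : IsHybridWithin N T h := by
  obtain ⟨hS, p, hp, q, hq, hpq⟩ := hh
  exact ⟨hST hS, p, hST hp, q, hST hq, hpq⟩

variable [Finite W]

theorem exists_root (hdag : IsDAG N) (hN : IsProperGalledTree N L) :
    ∃ ρ, ∀ v, IsAncestor N ρ v := by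
  obtain ⟨ρ, -, -, hρ⟩ := hN.root
  refine ⟨ρ, fun v => ?_⟩
  induction v using (wellFounded_adj hdag).induction with
  | _ v ih =>
    by_cases h : indeg N v = 0
    · rw [hρ v h]
      exact .refl
    · obtain ⟨u, hu⟩ := nonempty_of_ncard_ne_zero h
      exact (ih u (.single hu)).tail hu

theorem exists_isLCA (hdag : IsDAG N) (hN : IsProperGalledTree N L) (x y : W) :
    ∃ w, IsLCA N {x, y} w := by
  obtain ⟨ρ, hρ⟩ := exists_root hdag hN
  obtain ⟨w, hw, -⟩ := exists_isLCA_below hdag (A := {x, y}) fun v _ => hρ v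
  exact ⟨w, hw⟩

theorem isHybrid_of_parents (hN : IsProperGalledTree N L) (hpq : p ≠ q) (hp : N.Adj p h)
    (hq : N.Adj q h) : IsHybrid N h ∧ ∀ u, N.Adj u h → u = p ∨ u = q := by
  have hne_one : indeg N h ≠ 1 := fun e =>
    hpq ((indeg_eq_one_iff.1 e).unique hp hq)
  have hhyb : IsHybrid N h :=
    (hN.inner h (fun hL => hne_one ((hN.leaves h).1 hL).2)
      fun e => indeg_eq_zero_iff.1 e p hp).resolve_left fun ht => hne_one ht.1
  have hparents : ({p, q} : Set W) = {u | N.Adj u h} :=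
    eq_of_subset_of_ncard_le (pair_subset hp hq) (hhyb.1.trans (ncard_pair hpq).symm).le
  exact ⟨hhyb, fun u hu => hparents.ge hu⟩

theorem IsHybridWithin.parent_mem (hN : IsProperGalledTree N L) (hh : IsHybridWithin N S h)
    (hp : N.Adj p h) : p ∈ S := by
  obtain ⟨-, p', hp'S, q', hq'S, hpq', hp', hq'⟩ := hh
  rcases (isHybrid_of_parents hN hpq' hp' hq').2 p hp with rfl | rfl <;> assumption

theorem IsHybridWithin.isHybrid (hN : IsProperGalledTree N L) (hh : IsHybridWithin N S h) :
    IsHybrid N h := by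
  obtain ⟨-, p, -, q, -, hpq, hp, hq⟩ := hh
  exact (isHybrid_of_parents hN hpq hp hq).1

theorem IsHybridWithin.eq (hN : IsProperGalledTree N L) (hS : IsBiconnected N S)
    (hh : IsHybridWithin N S h) (hh' : IsHybridWithin N S h') : h = h' := by
  obtain ⟨T, hST, hT⟩ := (toFinite {S | IsBiconnected N S}).exists_le_maximal hS
  exact hN.level_one T hT h (hST hh.1) h' (hST hh'.1) (hh.isHybrid hN) (hh'.isHybrid hN)
    (fun _ hu => hST (hh.parent_mem hN hu)) fun _ hu => hST (hh'.parent_mem hN hu)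

theorem isLCA_unique (hdag : IsDAG N) (hN : IsProperGalledTree N L) (hw : IsLCA N {x, y} w)
    (hw' : IsLCA N {x, y} w') : w = w' := by
  by_contra hne
  have hinc : IncompRel (IsAncestor N) w w' :=
    ⟨fun h => hne (hw.2 w' hw'.1 h).symm, fun h => hne (hw'.2 w hw.1 h)⟩
  obtain ⟨h₁, hm₁, hx⟩ := exists_isMaxDesc hdag (hw.1 x (by simp)) (hw'.1 x (by simp))
  obtain ⟨h₂, hm₂, hy⟩ := exists_isMaxDesc hdag (hw.1 y (by simp)) (hw'.1 y (by simp))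
  obtain ⟨P, hP, h₁P, ⟨p₁, hp₁P, hp₁, -, hwp₁⟩, ⟨q₁, hq₁P, hq₁, hwq₁, -⟩, hPbet⟩ :=
    hm₁.exists_linked hdag hinc
  obtain ⟨Q, hQ, h₂Q, ⟨p₂, hp₂Q, hp₂, -, hwp₂⟩, ⟨q₂, hq₂Q, hq₂, hwq₂, -⟩, hQbet⟩ :=
    hm₂.exists_linked hdag hinc
  have hbic := hP.isBiconnected_union hQ fun v hvP hvQ =>
    (hPbet v hvP).1.imp
      (hw.eq_of_ancestor ((hPbet v hvP).2.trans hx) ((hQbet v hvQ).2.trans hy))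
      (hw'.eq_of_ancestor ((hPbet v hvP).2.trans hx) ((hQbet v hvQ).2.trans hy))
  have hhyb₁ : IsHybridWithin N (P ∪ Q) h₁ := IsHybridWithin.mono
    ⟨h₁P, p₁, hp₁P, q₁, hq₁P, fun e => hwp₁ (e ▸ hwq₁), hp₁, hq₁⟩ subset_union_left
  have hhyb₂ : IsHybridWithin N (P ∪ Q) h₂ := IsHybridWithin.mono
    ⟨h₂Q, p₂, hp₂Q, q₂, hq₂Q, fun e => hwp₂ (e ▸ hwq₂), hp₂, hq₂⟩ subset_union_right
  have heq : h₁ = h₂ := hhyb₁.eq hN hbic hhyb₂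
  have hwh : h₁ = w := hw.eq_of_ancestor hx (heq ▸ hy) hm₁.left
  exact hinc.2 (hwh ▸ hm₁.right)

theorem exists_isBiconnected_of_isMaxDesc (hdag : IsDAG N) (hN : IsProperGalledTree N L)
    (hab : IncompRel (IsAncestor N) a b) (hh : IsMaxDesc N a b h) :
    ∃ S, IsBiconnected N S ∧ IsHybridWithin N S h ∧ a ∈ S ∧ ∃ s ∈ S, N.Adj s a := by
  obtain ⟨r, hr⟩ := exists_isLCA hdag hN a b
  obtain ⟨P, hP, hs, hPbet⟩ := exists_linked_of_isLCA hdag hr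
  obtain ⟨s, hsP, hs⟩ := hs fun e => hab.1 (e ▸ hr.1 b (by simp))
  obtain ⟨Q, hQ, hhQ, ⟨p, hpQ, hp, -, hbp⟩, ⟨q, hqQ, hq, hbq, -⟩, hQbet⟩ :=
    hh.exists_linked hdag hab
  have hbic := hP.isBiconnected_union hQ fun v hvP hvQ => by
    rcases (hPbet v hvP).2, (hQbet v hvQ).1 with ⟨hva | hvb, hav | hbv⟩
    · exact Or.inl (ancestor_antisymm hdag hva hav)
    · exact absurd (hbv.trans hva) hab.2
    · exact absurd (hav.trans hvb) hab.1
    · exact Or.inr (ancestor_antisymm hdag hvb hbv)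
  exact ⟨P ∪ Q, hbic, IsHybridWithin.mono
    ⟨hhQ, p, hpQ, q, hqQ, fun e => hbp (e ▸ hbq), hp, hq⟩ subset_union_right,
    Or.inl hP.left_mem, s, Or.inl hsP, hs⟩

theorem exists_isBiconnected_of_parents (hdag : IsDAG N) (hN : IsProperGalledTree N L)
    (hp : N.Adj p h) (hq : N.Adj q h) : ∃ S, IsBiconnected N S ∧ h ∈ S ∧ p ∈ S ∧ q ∈ S := by
  obtain ⟨r, hr⟩ := exists_isLCA hdag hN p q
  obtain ⟨P, hP, -, hPbet⟩ := exists_linked_of_isLCA hdag hr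
  have hhP : h ∉ P := fun hmem => (hPbet h hmem).2.elim (not_ancestor_of_adj hdag hp)
    (not_ancestor_of_adj hdag hq)
  have hPq := hP.trans (Linked.edge hq) fun v hvP hv =>
    hv.resolve_right fun e => hhP (e ▸ hvP)
  exact ⟨_, hPq.isBiconnected_union (Linked.edge hp) fun v _ hv => hv, by simp, by simp, by simp⟩

theorem isMaxDesc_unique (hdag : IsDAG N) (hN : IsProperGalledTree N L)
    (hab : IncompRel (IsAncestor N) a b) (hac : IncompRel (IsAncestor N) a c)
    (hh : IsMaxDesc N a b h) (hh' : IsMaxDesc N a c h') : h = h' := by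
  obtain ⟨S, hS, hhS, haS, s, hsS, hs⟩ := exists_isBiconnected_of_isMaxDesc hdag hN hab hh
  obtain ⟨S', hS', hhS', haS', s', hsS', hs'⟩ := exists_isBiconnected_of_isMaxDesc hdag hN hac hh'
  have hsa : s ≠ a := hdag.ne_of_adj hs
  by_cases hss : s = s'
  · have hU := hS.union hS' ⟨s, ⟨hsS, hss ▸ hsS'⟩, a, ⟨haS, haS'⟩, hsa⟩
    exact (hhS.mono subset_union_left).eq hN hU (hhS'.mono subset_union_right)
  · obtain ⟨T, hT, haT, hsT, hsT'⟩ := exists_isBiconnected_of_parents hdag hN hs hs'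
    have hU := hS.union hT ⟨s, ⟨hsS, hsT⟩, a, ⟨haS, haT⟩, hsa⟩
    have haU : IsHybridWithin N (S ∪ T) a :=
      ⟨Or.inl haS, s, Or.inl hsS, s', Or.inr hsT', hss, hs, hs'⟩
    have hah : a = h := haU.eq hN hU (hhS.mono subset_union_left)
    exact absurd (hah ▸ hh.right) hab.2

theorem ancestor_of_overlap (hdag : IsDAG N) (hN : IsProperGalledTree N L)
    (hab : IncompRel (IsAncestor N) a b) (hac : IncompRel (IsAncestor N) a c)
    (haz : IsAncestor N a z) (hbz : IsAncestor N b z) (haz' : IsAncestor N a z')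
    (hcz' : IsAncestor N c z') : IsAncestor N c z := by
  obtain ⟨h, hm, hz⟩ := exists_isMaxDesc hdag haz hbz
  obtain ⟨h', hm', -⟩ := exists_isMaxDesc hdag haz' hcz'
  rw [isMaxDesc_unique hdag hN hab hac hm hm'] at hz
  exact hm'.right.trans hz

theorem not_pairwise_overlap (hdag : IsDAG N) (hN : IsProperGalledTree N L)
    (hab : IncompRel (IsAncestor N) a b) (hac : IncompRel (IsAncestor N) a c)
    (hbc : IncompRel (IsAncestor N) b c) (haz : IsAncestor N a z) (hbz : IsAncestor N b z)
    (haz' : IsAncestor N a z') (hcz' : IsAncestor N c z') (hbz'' : IsAncestor N b z'')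
    (hcz'' : IsAncestor N c z'') : False := by
  obtain ⟨h, hm, -⟩ := exists_isMaxDesc hdag haz hbz
  obtain ⟨h', hm', -⟩ := exists_isMaxDesc hdag haz' hcz'
  obtain ⟨h'', hm'', -⟩ := exists_isMaxDesc hdag hbz'' hcz''
  obtain rfl := isMaxDesc_unique hdag hN hab hac hm hm'
  obtain rfl := isMaxDesc_unique hdag hN hab.symm hbc hm.symm hm''
  obtain ⟨-, -, -, ⟨p, -, hp, hap, hbp⟩, ⟨q, -, hq, hbq, haq⟩, -⟩ := hm.exists_linked hdag hab
  obtain ⟨-, -, -, -, ⟨r, -, hr, hcr, har⟩, -⟩ := hm'.exists_linked hdag hac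
  obtain ⟨-, -, -, ⟨s, -, hs, hbs, hcs⟩, -, -⟩ := hm''.exists_linked hdag hbc
  have hparents := (isHybrid_of_parents hN (fun e : p = q => hbp (e ▸ hbq)) hp hq).2
  have hcq : IsAncestor N c q := by
    rcases hparents r hr with rfl | rfl
    · exact absurd hap har
    · exact hcr
  rcases hparents s hs with rfl | rfl
  · exact hbp hbs
  · exact hcs hcq

end GalledTree

/-! ### Prime graphs explained by an order with few overlaps -/

/-- A graph is prime if it has at least two vertices, it and its complement are connected, and it
has no modules besides the trivial ones. -/
structure IsPrimeGraph {V : Type*} (H : SimpleGraph V) : Prop where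
  nontrivial : Nontrivial V
  connected : H.Connected
  connected_compl : Hᶜ.Connected
  subsingleton_or_eq_univ : ∀ U : Set V, IsModuleOn H univ U → U.Subsingleton ∨ U = univ

namespace IsPrimeGraph

variable {V : Type*} {H : SimpleGraph V} {T U : Set V} {v x y z : V}

theorem subsingleton (hH : IsPrimeGraph H) (hU : IsModuleOn H univ U) (hv : v ∉ U) :
    U.Subsingleton :=
  (hH.subsingleton_or_eq_univ U hU).resolve_right fun h => hv (h ▸ mem_univ v)

theorem exists_adj (hH : IsPrimeGraph H) (hx : x ∈ T) (hy : y ∉ T) :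
    ∃ a b, a ∈ T ∧ b ∉ T ∧ H.Adj a b :=
  exists_adj_across_cut hH.connected.preconnected hx hy

theorem exists_not_adj (hH : IsPrimeGraph H) (hx : x ∈ T) (hy : y ∉ T) :
    ∃ a b, a ∈ T ∧ b ∉ T ∧ ¬ H.Adj a b := by
  obtain ⟨a, b, ha, hb, hab⟩ :=
    exists_adj_across_cut hH.connected_compl.preconnected hx hy
  exact ⟨a, b, ha, hb, ((SimpleGraph.compl_adj _ _ _).1 hab).2⟩

theorem exists_distinguishing (hH : IsPrimeGraph H) (hxy : x ≠ y) (hzx : z ≠ x) (hzy : z ≠ y) :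
    ∃ q, q ≠ x ∧ q ≠ y ∧ ¬ (H.Adj x q ↔ H.Adj y q) := by
  by_contra! h
  have hmod : IsModuleOn H univ {x, y} := by
    refine ⟨subset_univ _, ?_⟩
    rintro a (rfl | rfl) b (rfl | rfl) q - hq <;>
      simp only [mem_insert_iff, mem_singleton_iff, not_or] at hq
    · exact Iff.rfl
    · exact h q hq.1 hq.2
    · exact (h q hq.1 hq.2).symm
    · exact Iff.rfl
  have hz : z ∉ ({x, y} : Set V) := by simp [hzx, hzy]
  exact hxy (hH.subsingleton hmod hz (mem_insert x {y}) (mem_insert_of_mem x rfl))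

theorem map_iso (hH : IsPrimeGraph H) {V' : Type*} {H' : SimpleGraph V'} (e : H ≃g H') :
    IsPrimeGraph H' where
  nontrivial := e.toEquiv.nontrivial_congr.1 hH.nontrivial
  connected := e.connected_iff.1 hH.connected
  connected_compl := by
    let e' : Hᶜ ≃g H'ᶜ := ⟨e.toEquiv, by simp [e.map_adj_iff]⟩
    exact e'.connected_iff.1 hH.connected_compl
  subsingleton_or_eq_univ U hU := by
    have hmod : IsModuleOn H univ (e ⁻¹' U) :=
      ⟨subset_univ _, fun x hx y hy z _ hz => by
        rw [← e.map_adj_iff, ← e.map_adj_iff (v := y)]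
        exact hU.2 _ hx _ hy _ (mem_univ _) hz⟩
    refine (hH.subsingleton_or_eq_univ _ hmod).imp (fun h x hx y hy => ?_) fun h => ?_
    · obtain ⟨x, rfl⟩ := e.surjective x
      obtain ⟨y, rfl⟩ := e.surjective y
      rw [h hx hy]
    · exact univ_subset_iff.1 (e.surjective.range_eq.ge.trans (preimage_eq_univ_iff.1 h))

end IsPrimeGraph

/-- The properties of the ancestor order of a galled-tree from which its cycles are recovered:
all elements overlapping a given element `a` meet it in the same lower bounds, and no three
elements overlap pairwise. -/
structure IsGalledOrder (L : Type*) [SemilatticeSup L] : Prop where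
  overlap : ∀ {a b c z z' : L}, IncompRel (· ≤ ·) a b → IncompRel (· ≤ ·) a c →
    z ≤ a → z ≤ b → z' ≤ a → z' ≤ c → z ≤ c
  not_three : ∀ {a b c z z' z'' : L}, IncompRel (· ≤ ·) a b → IncompRel (· ≤ ·) a c →
    IncompRel (· ≤ ·) b c → z ≤ a → z ≤ b → z' ≤ a → z' ≤ c → z'' ≤ b → z'' ≤ c → False

namespace IsGalledOrder

variable {L : Type*} [SemilatticeSup L] {a b q x y z z₀ : L}

theorem sup_common_le (hL : IsGalledOrder L) (hab : IncompRel (· ≤ ·) a b) (hz₀a : z₀ ≤ a)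
    (hz₀b : z₀ ≤ b) (hza : z ≤ a) (hzb : z ≤ b) (hxa : x ≤ a) (hxb : ¬ x ≤ b) : z₀ ≤ x ⊔ z := by
  refine hL.overlap (a := b) (b := a) (z' := z) hab.symm ⟨fun h => ?_, fun h => ?_⟩
    hz₀b hz₀a hzb le_sup_right
  · exact hab.2 (h.trans (sup_le hxa hza))
  · exact hxb (le_sup_left.trans h)

theorem sup_common_eq (hL : IsGalledOrder L) (hab : IncompRel (· ≤ ·) a b) (hz₀a : z₀ ≤ a)
    (hz₀b : z₀ ≤ b) (hza : z ≤ a) (hzb : z ≤ b) (hxa : x ≤ a) (hxb : ¬ x ≤ b) :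
    x ⊔ z = x ⊔ z₀ :=
  le_antisymm (sup_le le_sup_left (hL.sup_common_le hab hza hzb hz₀a hz₀b hxa hxb))
    (sup_le le_sup_left (hL.sup_common_le hab hz₀a hz₀b hza hzb hxa hxb))

theorem incompRel_sup (hab : IncompRel (· ≤ ·) a b) (hz₀a : z₀ ≤ a) (hxa : x ≤ a)
    (hxb : ¬ x ≤ b) : IncompRel (· ≤ ·) (x ⊔ z₀) b :=
  ⟨fun h => hxb (le_sup_left.trans h), fun h => hab.2 (h.trans (sup_le hxa hz₀a))⟩

theorem sup_le_sup_or_sup_le_sup (hL : IsGalledOrder L) (hab : IncompRel (· ≤ ·) a b)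
    (hz₀a : z₀ ≤ a) (hz₀b : z₀ ≤ b) (hxa : x ≤ a) (hxb : ¬ x ≤ b) (hya : y ≤ a)
    (hyb : ¬ y ≤ b) : x ⊔ z₀ ≤ y ⊔ z₀ ∨ y ⊔ z₀ ≤ x ⊔ z₀ := by
  by_contra! h
  exact hL.not_three h (incompRel_sup hab hz₀a hxa hxb) (incompRel_sup hab hz₀a hya hyb)
    le_sup_right le_sup_right le_sup_right hz₀b le_sup_right hz₀b

theorem sup_eq_of_lt (hL : IsGalledOrder L) (hab : IncompRel (· ≤ ·) a b) (hz₀a : z₀ ≤ a)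
    (hz₀b : z₀ ≤ b) (hya : y ≤ a) (hyb : ¬ y ≤ b) (hlt : y ⊔ z₀ < x ⊔ z₀) :
    x ⊔ y = x ⊔ z₀ := by
  refine le_antisymm (sup_le le_sup_left (le_sup_left.trans hlt.le)) (sup_le le_sup_left ?_)
  by_contra hz
  refine hyb (hL.overlap (a := y ⊔ z₀) (b := x ⊔ y) (z' := z₀) ⟨fun h => ?_, fun h => ?_⟩
    (incompRel_sup hab hz₀a hya hyb) le_sup_left le_sup_right le_sup_right hz₀b)
  · exact hz (le_sup_right.trans h)
  · exact hlt.not_ge (sup_le (le_sup_left.trans h) le_sup_right)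

theorem sup_congr_of_sup_eq (hL : IsGalledOrder L) (hab : IncompRel (· ≤ ·) a b) (hz₀a : z₀ ≤ a)
    (hz₀b : z₀ ≤ b) (hxa : x ≤ a) (hxb : ¬ x ≤ b) (hya : y ≤ a) (hyb : ¬ y ≤ b)
    (hxy : x ⊔ z₀ = y ⊔ z₀) (hqa : q ≤ a) (hq : ¬ q ≤ b → q ⊔ z₀ ≠ y ⊔ z₀) :
    x ⊔ q = y ⊔ q := by
  by_cases hqb : q ≤ b
  · rw [hL.sup_common_eq hab hz₀a hz₀b hqa hqb hxa hxb, hxy,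
      hL.sup_common_eq hab hz₀a hz₀b hqa hqb hya hyb]
  · rcases hL.sup_le_sup_or_sup_le_sup hab hz₀a hz₀b hqa hqb hya hyb with h | h
    · have hlt := lt_of_le_of_ne h (hq hqb)
      rw [hL.sup_eq_of_lt hab hz₀a hz₀b hqa hqb hlt,
        hL.sup_eq_of_lt hab hz₀a hz₀b hqa hqb (hxy ▸ hlt), hxy]
    · have hlt := lt_of_le_of_ne h (hq hqb).symm
      rw [sup_comm x, sup_comm y, hL.sup_eq_of_lt hab hz₀a hz₀b hya hyb hlt,
        hL.sup_eq_of_lt hab hz₀a hz₀b hxa hxb (hxy ▸ hlt)]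

end IsGalledOrder

theorem exists_list_pairwise_lt {V L : Type*} [PartialOrder L] {s : Set V} (hs : s.Finite)
    {u : V → L} (hu : InjOn u s) (hchain : ∀ x ∈ s, ∀ y ∈ s, u x ≤ u y ∨ u y ≤ u x) :
    ∃ l : List V, (∀ v, v ∈ l ↔ v ∈ s) ∧ l.Pairwise fun x y => u y < u x := by
  classical
  have := hs.fintype
  let _ : LinearOrder s :=
    { le x y := u y ≤ u x
      le_refl _ := le_rfl
      le_trans _ _ _ hxy hyz := hyz.trans hxy
      le_antisymm x y hxy hyx := Subtype.ext (hu x.2 y.2 (le_antisymm hyx hxy))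
      le_total x y := hchain y y.2 x x.2
      toDecidableLE := Classical.decRel _ }
  refine ⟨(Finset.univ.sort (α := s)).map Subtype.val, fun v => by simp, ?_⟩
  refine List.pairwise_map.2 ((Finset.sortedLT_sort _).pairwise.imp fun {x y} hxy => ?_)
  exact lt_of_le_of_ne hxy.le fun h => hxy.ne' (Subtype.ext (hu y.2 x.2 h))

section OverlappingCover

variable {V L : Type*} [SemilatticeSup L] {H : SimpleGraph V} {φ : V → L} {τ : L → Prop}
  {a b w : L} {x z : V}

/-- Two overlapping elements `a` and `b` of the order lie above the whole vertex set, with `z`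
below both of them, and `w` is the join of any two vertices that lie on different sides. In a
galled-tree, `a` and `b` are the children on a cycle of its root `w`, and `z` is below its
hybrid-vertex. -/
structure IsOverlappingCover (φ : V → L) (a b w : L) (z : V) : Prop where
  incomp : IncompRel (· ≤ ·) a b
  le_left : φ z ≤ a
  le_right : φ z ≤ b
  cover : ∀ v, φ v ≤ a ∨ φ v ≤ b
  sup_eq : ∀ x y, ¬ φ x ≤ b → ¬ φ y ≤ a → φ x ⊔ φ y = w

theorem isModuleOn_univ_of_sup_eq (hadj : ∀ x y, x ≠ y → (H.Adj x y ↔ τ (φ x ⊔ φ y)))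
    {U : Set V} (hU : ∀ v ∈ U, ∀ q ∉ U, φ v ⊔ φ q = φ x ⊔ φ q) : IsModuleOn H univ U := by
  refine ⟨subset_univ _, fun v hv v' hv' q _ hq => ?_⟩
  rw [hadj v q (ne_of_mem_of_not_mem hv hq), hadj v' q (ne_of_mem_of_not_mem hv' hq),
    hU v hv q hq, hU v' hv' q hq]

theorem exists_sup_lt_of_cut (hH : IsPrimeGraph H)
    (hadj : ∀ x y, x ≠ y → (H.Adj x y ↔ τ (φ x ⊔ φ y))) (hw : ∀ x, φ x ≤ w) {T : Set V}
    {x y : V} (hx : x ∈ T) (hy : y ∉ T) : ∃ x ∈ T, ∃ y ∉ T, φ x ⊔ φ y < w := by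
  by_contra! hcon
  have heq : ∀ x ∈ T, ∀ y ∉ T, (H.Adj x y ↔ τ w) := fun x hx y hy => by
    rw [hadj x y (ne_of_mem_of_not_mem hx hy),
      (sup_le (hw x) (hw y)).eq_of_not_lt (hcon x hx y hy)]
  obtain ⟨p, q, hp, hq, hpq⟩ := hH.exists_adj hx hy
  obtain ⟨p', q', hp', hq', hpq'⟩ := hH.exists_not_adj hx hy
  exact hpq' ((heq p' hp' q' hq').2 ((heq p hp q hq).1 hpq))

theorem incompRel_of_covBy (ha : a ⋖ w) (hb : b ⋖ w) (hab : a ≠ b) : IncompRel (· ≤ ·) a b :=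
  ⟨fun h => (ha.eq_or_eq h hb.le).elim hab.symm hb.ne, fun h =>
    (hb.eq_or_eq h ha.le).elim hab ha.ne⟩

theorem exists_isOverlappingCover [Nontrivial V] [IsStronglyCoatomic L] (hL : IsGalledOrder L)
    (hH : IsPrimeGraph H) (hadj : ∀ x y, x ≠ y → (H.Adj x y ↔ τ (φ x ⊔ φ y)))
    (hw : IsLUB (range φ) w) :
    ∃ a b z, a ⋖ w ∧ b ⋖ w ∧ IsOverlappingCover φ a b w z := by
  have hle : ∀ x, φ x ≤ w := fun x => hw.1 (mem_range_self x)
  have habove : ∀ {x y}, φ x ⊔ φ y < w → ∃ c, c ⋖ w ∧ φ x ≤ c ∧ φ y ≤ c := fun {x y} hxy => by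
    obtain ⟨c, hc, hcw⟩ := exists_le_covBy_of_lt hxy
    exact ⟨c, hcw, le_sup_left.trans hc, le_sup_right.trans hc⟩
  have hcross : ∀ {T : Set V} {x y : V}, x ∈ T → y ∉ T →
      ∃ c, c ⋖ w ∧ ∃ x ∈ T, ∃ y ∉ T, φ x ≤ c ∧ φ y ≤ c := fun hx hy => by
    obtain ⟨x, hx, y, hy, hxy⟩ := exists_sup_lt_of_cut hH hadj hle hx hy
    obtain ⟨c, hcw, hc⟩ := habove hxy
    exact ⟨c, hcw, x, hx, y, hy, hc⟩
  obtain ⟨x₀, y₀, hne₀⟩ := exists_pair_ne V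
  obtain ⟨a, ha, x₁, -, -, -, hx₁a, -⟩ := hcross (mem_singleton x₀) hne₀.symm
  obtain ⟨y₁, hy₁⟩ : ∃ y, ¬ φ y ≤ a := by
    by_contra! h
    exact ha.lt.not_ge (hw.2 (forall_mem_range.2 h))
  obtain ⟨b, hb, z, hza, y₂, hy₂, hzb, hy₂b⟩ := hcross (T := {x | φ x ≤ a}) hx₁a hy₁
  have hab : IncompRel (· ≤ ·) a b :=
    incompRel_of_covBy ha hb fun h => hy₂ (hy₂b.trans h.ge)
  have hcover : ∀ v, φ v ≤ a ∨ φ v ≤ b := by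
    by_contra! ⟨v, hva, hvb⟩
    obtain ⟨c, hc, x, hx, y, hy, hxc, hyc⟩ :=
      hcross (T := {x | φ x ≤ a ∨ φ x ≤ b}) (Or.inl hza) (not_or.2 ⟨hva, hvb⟩)
    have hac := incompRel_of_covBy ha hc fun h => hy (Or.inl (hyc.trans h.ge))
    have hbc := incompRel_of_covBy hb hc fun h => hy (Or.inr (hyc.trans h.ge))
    have hzc : φ z ≤ c := hx.elim (fun hx => hL.overlap hab hac hza hzb hx hxc)
      fun hx => hL.overlap hab.symm hbc hzb hza hx hxc
    exact hL.not_three hab hac hbc hza hzb hza hzc hzb hzc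
  refine ⟨a, b, z, ha, hb, hab, hza, hzb, hcover, fun x y hxb hya => ?_⟩
  refine (sup_le (hle x) (hle y)).eq_of_not_lt fun hlt => ?_
  obtain ⟨c, hc, hxc, hyc⟩ := habove hlt
  have hac := incompRel_of_covBy ha hc fun h => hya (hyc.trans h.ge)
  have hbc := incompRel_of_covBy hb hc fun h => hxb (hxc.trans h.ge)
  exact hL.not_three hab hac hbc hza hzb ((hcover x).resolve_right hxb) hxc
    ((hcover y).resolve_left hya) hyc

namespace IsOverlappingCover

theorem swap (h : IsOverlappingCover φ a b w z) : IsOverlappingCover φ b a w z where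
  incomp := h.incomp.symm
  le_left := h.le_right
  le_right := h.le_left
  cover v := (h.cover v).symm
  sup_eq x y hxa hyb := by rw [sup_comm, h.sup_eq y x hyb hxa]

theorem le_of_not_le (h : IsOverlappingCover φ a b w z) {x : V} (hx : ¬ φ x ≤ b) : φ x ≤ a :=
  (h.cover x).resolve_right hx

theorem injOn_sup (h : IsOverlappingCover φ a b w z) (hL : IsGalledOrder L)
    (hH : IsPrimeGraph H) (hadj : ∀ x y, x ≠ y → (H.Adj x y ↔ τ (φ x ⊔ φ y))) :
    InjOn (fun v => φ v ⊔ φ z) {v | ¬ φ v ≤ b} := by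
  intro x hxb y hyb hxy
  have hmod : IsModuleOn H univ {v | ¬ φ v ≤ b ∧ φ v ⊔ φ z = φ y ⊔ φ z} := by
    refine isModuleOn_univ_of_sup_eq hadj (x := y) fun v hv q hq => ?_
    by_cases hqa : φ q ≤ a
    · exact hL.sup_congr_of_sup_eq h.incomp h.le_left h.le_right (h.le_of_not_le hv.1) hv.1
        (h.le_of_not_le hyb) hyb hv.2 hqa fun hqb hqy => hq ⟨hqb, hqy⟩
    · rw [h.sup_eq v q hv.1 hqa, h.sup_eq y q hyb hqa]
  exact hH.subsingleton hmod (fun hz => hz.1 h.le_right) ⟨hxb, hxy⟩ ⟨hyb, rfl⟩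

theorem eq_of_le_of_le (h : IsOverlappingCover φ a b w z) (hL : IsGalledOrder L)
    (hH : IsPrimeGraph H) (hadj : ∀ x y, x ≠ y → (H.Adj x y ↔ τ (φ x ⊔ φ y)))
    {y : V} (hy : ¬ φ y ≤ a) (hxa : φ x ≤ a) (hxb : φ x ≤ b) : x = z := by
  have hmod : IsModuleOn H univ {v | φ v ≤ a ∧ φ v ≤ b} := by
    refine isModuleOn_univ_of_sup_eq hadj (x := z) fun v hv q hq => ?_
    rw [sup_comm, sup_comm (φ z)]
    by_cases hqb : φ q ≤ b
    · exact hL.sup_common_eq h.incomp.symm h.le_right h.le_left hv.2 hv.1 hqb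
        fun hqa => hq ⟨hqa, hqb⟩
    · exact hL.sup_common_eq h.incomp h.le_left h.le_right hv.1 hv.2 (h.le_of_not_le hqb) hqb
  exact hH.subsingleton hmod (fun hya => hy hya.1) ⟨hxa, hxb⟩ ⟨h.le_left, h.le_right⟩

theorem exists_side [Finite V] (h : IsOverlappingCover φ a b w z) (hL : IsGalledOrder L)
    (hH : IsPrimeGraph H) (hadj : ∀ x y, x ≠ y → (H.Adj x y ↔ τ (φ x ⊔ φ y))) :
    ∃ l : List V, (∀ v, v ∈ l ↔ ¬ φ v ≤ b) ∧ l.Nodup ∧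
      (l ++ [z]).Pairwise fun x y => (H.Adj x y ↔ τ (φ x ⊔ φ z)) := by
  obtain ⟨l, hl, hp⟩ := exists_list_pairwise_lt (toFinite _) (h.injOn_sup hL hH hadj)
    fun x hx y hy => hL.sup_le_sup_or_sup_le_sup h.incomp h.le_left h.le_right
      (h.le_of_not_le hx) hx (h.le_of_not_le hy) hy
  refine ⟨l, hl, hp.imp fun {x y} hlt (hxy : x = y) => lt_irrefl _ (hxy ▸ hlt),
    List.pairwise_append.2 ⟨hp.imp_of_mem fun {x y} _ hy hlt => ?_, List.pairwise_singleton _ _,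
      fun x hx y hy => ?_⟩⟩
  · have hyb : ¬ φ y ≤ b := (hl y).1 hy
    rw [hadj x y fun hxy => lt_irrefl _ (hxy ▸ hlt),
      hL.sup_eq_of_lt h.incomp h.le_left h.le_right (h.le_of_not_le hyb) hyb hlt]
  · obtain rfl := List.mem_singleton.1 hy
    exact hadj x y fun hxy => (hl x).1 hx (hxy ▸ h.le_right)

end IsOverlappingCover

end OverlappingCover

/-- The vertices of `H` other than `z` form two sequences `A` and `B`. The adjacency of two
vertices in `A ++ [z]` or in `B ++ [z]` depends on the earlier one, and all vertices in `A` are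
related in the same way to all vertices in `B`. These are the graphs explained by elementary
galled-trees: `A` and `B` list the leaves along the two sides of the cycle, and `z` is the leaf
at the hybrid-vertex. -/
structure IsTwoCaterpillar {V : Type*} (H : SimpleGraph V) (z : V) (A B : List V) (s : V → Prop)
    (r : Prop) : Prop where
  nodup : (z :: (A ++ B)).Nodup
  cover : ∀ v, v ∈ z :: (A ++ B)
  left_ne_nil : A ≠ []
  right_ne_nil : B ≠ []
  left : (A ++ [z]).Pairwise fun x y => (H.Adj x y ↔ s x)
  right : (B ++ [z]).Pairwise fun x y => (H.Adj x y ↔ s x)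
  cross : ∀ x ∈ A, ∀ y ∈ B, (H.Adj x y ↔ r)

theorem IsOverlappingCover.exists_isTwoCaterpillar {V L : Type*} [Finite V] [SemilatticeSup L]
    {H : SimpleGraph V} {φ : V → L} {τ : L → Prop} {a b w : L} {x y z : V}
    (h : IsOverlappingCover φ a b w z) (hL : IsGalledOrder L) (hH : IsPrimeGraph H)
    (hadj : ∀ x y, x ≠ y → (H.Adj x y ↔ τ (φ x ⊔ φ y))) (hx : ¬ φ x ≤ b) (hy : ¬ φ y ≤ a) :
    ∃ A B s r, IsTwoCaterpillar H z A B s r := by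
  obtain ⟨A, hA, hAnd, hAp⟩ := h.exists_side hL hH hadj
  obtain ⟨B, hB, hBnd, hBp⟩ := h.swap.exists_side hL hH hadj
  refine ⟨A, B, fun x => τ (φ x ⊔ φ z), τ w,
    { nodup := ?_
      cover := fun v => ?_
      left_ne_nil := List.ne_nil_of_mem ((hA x).2 hx)
      right_ne_nil := List.ne_nil_of_mem ((hB y).2 hy)
      left := hAp
      right := hBp
      cross := fun x hx y hy => ?_ }⟩
  · rw [List.nodup_cons, List.mem_append, hA, hB]
    refine ⟨not_or.2 ⟨not_not.2 h.le_right, not_not.2 h.le_left⟩, hAnd.append hBnd ?_⟩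
    exact fun x hxA hxB => (h.cover x).elim ((hB x).1 hxB) ((hA x).1 hxA)
  · rw [List.mem_cons, List.mem_append, hA, hB]
    by_cases hva : φ v ≤ a
    · exact (em (φ v ≤ b)).imp (h.eq_of_le_of_le hL hH hadj hy hva) Or.inl
    · exact Or.inr (Or.inr hva)
  · have hxb := (hA x).1 hx
    have hya := (hB y).1 hy
    rw [hadj x y fun hxy => hya (hxy ▸ h.le_of_not_le hxb), h.sup_eq x y hxb hya]

theorem IsPrimeGraph.exists_isTwoCaterpillar {V L : Type*} [Finite V] [SemilatticeSup L]
    [IsStronglyCoatomic L] {H : SimpleGraph V} {φ : V → L} {τ : L → Prop} (hH : IsPrimeGraph H)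
    (hL : IsGalledOrder L) (hadj : ∀ x y, x ≠ y → (H.Adj x y ↔ τ (φ x ⊔ φ y))) :
    ∃ z A B s r, IsTwoCaterpillar H z A B s r := by
  have := hH.nontrivial
  obtain ⟨w, hw⟩ : ∃ w, IsLUB (range φ) w := by
    have := Finset.isLUB_sup' ((finite_range φ).toFinset_nonempty.2 (range_nonempty φ))
    exact ⟨_, by rwa [Finite.coe_toFinset] at this⟩
  obtain ⟨a, b, z, ha, hb, h⟩ := exists_isOverlappingCover hL hH hadj hw
  have hnot : ∀ {c}, c ⋖ w → ∃ x, ¬ φ x ≤ c := fun {c} hc => by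
    by_contra! hall
    exact hc.lt.not_ge (hw.2 (forall_mem_range.2 hall))
  obtain ⟨x, hx⟩ := hnot hb
  obtain ⟨y, hy⟩ := hnot ha
  exact ⟨z, h.exists_isTwoCaterpillar hL hH hadj hx hy⟩

namespace IsTwoCaterpillar

variable {V : Type*} {H : SimpleGraph V} {x y z : V} {A B : List V} {s : V → Prop} {r : Prop}

theorem swap (h : IsTwoCaterpillar H z A B s r) : IsTwoCaterpillar H z B A s r where
  nodup := (List.Perm.cons z List.perm_append_comm).nodup_iff.1 h.nodup
  cover v := (List.Perm.cons z List.perm_append_comm).mem_iff.1 (h.cover v)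
  left_ne_nil := h.right_ne_nil
  right_ne_nil := h.left_ne_nil
  left := h.right
  right := h.left
  cross x hx y hy := by rw [H.adj_comm]; exact h.cross y hy x hx

theorem nodup_left (h : IsTwoCaterpillar H z A B s r) : A.Nodup :=
  (List.nodup_cons.1 h.nodup).2.of_append_left

theorem notMem_left (h : IsTwoCaterpillar H z A B s r) : z ∉ A :=
  fun hz => (List.nodup_cons.1 h.nodup).1 (List.mem_append_left B hz)

theorem not_iff_of_pair_infix (h : IsTwoCaterpillar H z A B s r) (hH : IsPrimeGraph H)
    (hxy : [x, y] <:+: A) : ¬ (s x ↔ s y) := by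
  intro hs
  have hz := h.notMem_left
  have hxyne : x ≠ y := by simpa using h.nodup_left.sublist hxy.sublist
  obtain ⟨l₁, l₂, rfl⟩ := hxy
  have hleft := h.left
  simp only [List.append_assoc, List.cons_append, List.nil_append, List.pairwise_append,
    List.pairwise_cons] at hleft
  obtain ⟨-, ⟨hx, hy, -⟩, hbefore⟩ := hleft
  have hafter : ∀ q ∈ l₂ ++ [z], (H.Adj x q ↔ H.Adj y q) := fun q hq => by
    rw [hx q (List.mem_cons_of_mem y hq), hy q hq, hs]
  have hzx : z ≠ x := by rintro rfl; simp at hz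
  have hzy : z ≠ y := by rintro rfl; simp at hz
  obtain ⟨q, hqx, hqy, hq⟩ := hH.exists_distinguishing hxyne hzx hzy
  have hqmem := h.cover q
  simp only [List.append_assoc, List.cons_append, List.nil_append, List.mem_cons,
    List.mem_append, hqx, hqy, false_or] at hqmem
  rcases hqmem with rfl | hql | hql | hqB
  · exact hq (hafter q (by simp))
  · rw [H.adj_comm x, H.adj_comm y, hbefore q hql x (by simp), hbefore q hql y (by simp)] at hq
    exact hq Iff.rfl
  · exact hq (hafter q (by simp [hql]))
  · rw [h.cross x (by simp) q hqB, h.cross y (by simp) q hqB] at hq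
    exact hq Iff.rfl

theorem not_iff_of_head (h : IsTwoCaterpillar H z A B s r) (hH : IsPrimeGraph H)
    (hx : A.head? = some x) : ¬ (s x ↔ r) := by
  intro hs
  have hz := h.notMem_left
  obtain ⟨l, rfl⟩ := List.head?_eq_some_iff.1 hx
  have hleft := h.left
  rw [List.cons_append, List.pairwise_cons] at hleft
  have key : ∀ q ∉ ({x} : Set V), (H.Adj x q ↔ r) := fun q hq => by
    have hqmem := h.cover q
    simp only [List.cons_append, List.mem_cons, List.mem_append,
      show q ≠ x from hq, false_or] at hqmem
    rcases hqmem with rfl | hql | hqB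
    · rw [hleft.1 q (by simp), hs]
    · rw [hleft.1 q (by simp [hql]), hs]
    · exact h.cross x (by simp) q hqB
  have hzx : z ∉ ({x} : Set V) := fun hzx => hz (by simp [mem_singleton_iff.1 hzx])
  obtain ⟨x₁, p, hx₁, hp, hadj⟩ := hH.exists_adj (mem_singleton x) hzx
  obtain ⟨x₂, q, hx₂, hq, hnadj⟩ := hH.exists_not_adj (mem_singleton x) hzx
  rw [mem_singleton_iff.1 hx₁, key p hp] at hadj
  rw [mem_singleton_iff.1 hx₂, key q hq] at hnadj
  exact hnadj hadj

theorem not_both_length_one (h : IsTwoCaterpillar H z A B s r) (hH : IsPrimeGraph H) :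
    ¬ (A.length = 1 ∧ B.length = 1) := by
  rintro ⟨hA, hB⟩
  obtain ⟨x, rfl⟩ := List.length_eq_one_iff.1 hA
  obtain ⟨y, rfl⟩ := List.length_eq_one_iff.1 hB
  have hs : s x ↔ s y :=
    not_iff_not.1 ((not_iff.1 (h.not_iff_of_head hH rfl)).trans
      (not_iff.1 (h.swap.not_iff_of_head hH rfl)).symm)
  have hxz : H.Adj x z ↔ s x := by simpa using h.left
  have hyz : H.Adj y z ↔ s y := by simpa using h.right
  have hnd : (z ≠ x ∧ z ≠ y) ∧ x ≠ y := by simpa using h.nodup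
  obtain ⟨q, hqx, hqy, hq⟩ := hH.exists_distinguishing hnd.2 hnd.1.1 hnd.1.2
  obtain rfl : q = z := by simpa [hqx, hqy] using h.cover q
  exact hq (hxz.trans (hs.trans hyz.symm))

end IsTwoCaterpillar

/-! ### The elementary galled-tree of a two-caterpillar -/

theorem RootedCycle.two_le_outdeg_root {W : Type*} [Finite W] {N : Digraph W}
    (C : RootedCycle N) : 2 ≤ outdeg N C.root := by
  obtain ⟨p, q, hpq, hp, hq⟩ := C.exists_children
  exact two_le_outdeg_iff.2 ⟨p, q, hp.adj, hq.adj, hpq⟩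

namespace IsElementaryWith

variable {W : Type*} {N : Digraph W} {X : Set W} {C : RootedCycle N} {v x : W}

theorem indeg_leaf (h : IsElementaryWith N X C) (hx : x ∈ X) : indeg N x = 1 :=
  indeg_eq_one_iff.2 (h.leaf_parent x hx)

theorem isEdge_iff (h : IsElementaryWith N X C) (hv : v ∈ C.verts) (u : W) :
    N.Adj u v ↔ C.IsEdge u v :=
  ⟨fun huv => h.isEdge huv hv, RootedCycle.IsEdge.adj⟩

theorem indeg_hybrid (h : IsElementaryWith N X C) : indeg N C.hybrid = 2 := by
  obtain ⟨p, q, hpq, hp, hq⟩ := C.exists_parents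
  refine ncard_eq_two.2 ⟨p, q, hpq, Set.ext fun u => ?_⟩
  simp only [mem_ofPred_eq, h.isEdge_iff C.hybrid_mem, mem_insert_iff, mem_singleton_iff]
  refine ⟨fun hu => ?_, fun hu => hu.elim (· ▸ hp) (· ▸ hq)⟩
  rcases hu.eq_or_eq_or_eq hp hq with e | e | e
  exacts [Or.inl e, Or.inr e, absurd e hpq]

variable [Finite W]

theorem indeg_root (h : IsElementaryWith N X C) : indeg N C.root = 0 :=
  indeg_eq_zero_iff.2 h.not_adj_root

theorem outdeg_leaf (h : IsElementaryWith N X C) (hx : x ∈ X) : outdeg N x = 0 :=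
  outdeg_eq_zero_iff.2 (h.leaf_not_adj x hx)

theorem isTreeVertex (h : IsElementaryWith N X C) (hv : v ∈ C.verts) (hroot : v ≠ C.root)
    (hhyb : v ≠ C.hybrid) : IsTreeVertex N v := by
  constructor
  · obtain ⟨p, hp⟩ := C.exists_isEdge hv hroot
    exact indeg_eq_one_iff.2
      ⟨p, hp.adj, fun u hu => ((h.isEdge_iff hv u).1 hu).left_unique hp hhyb⟩
  · obtain ⟨x, ⟨hx, hvx⟩, -⟩ := h.exists_leaf v hv hroot
    obtain ⟨u, hu⟩ := C.exists_isEdge_of_ne_hybrid hv hhyb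
    exact two_le_outdeg_iff.2
      ⟨x, u, hvx, hu.adj, fun e => h.notMem_leaves hu.mem_right (e ▸ hx)⟩

theorem isHybrid (h : IsElementaryWith N X C) : IsHybrid N C.hybrid := by
  obtain ⟨x, ⟨-, hx⟩, -⟩ := h.exists_leaf C.hybrid C.hybrid_mem C.root_ne_hybrid.symm
  exact ⟨h.indeg_hybrid, Nat.one_le_iff_ne_zero.2 fun e => outdeg_eq_zero_iff.1 e x hx⟩

theorem isHybrid_iff (h : IsElementaryWith N X C) : IsHybrid N v ↔ v = C.hybrid := by
  refine ⟨fun ⟨hin, _⟩ => ?_, fun e => e ▸ h.isHybrid⟩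
  by_contra hhyb
  rcases h.cover v with hv | hv
  · by_cases hroot : v = C.root
    · rw [hroot, h.indeg_root] at hin
      omega
    · rw [(h.isTreeVertex hv hroot hhyb).1] at hin
      omega
  · rw [h.indeg_leaf hv] at hin
    omega

theorem isTreeVertex_or_isHybrid (h : IsElementaryWith N X C) (hv : v ∉ X)
    (hroot : v ≠ C.root) : IsTreeVertex N v ∨ IsHybrid N v :=
  (em (v = C.hybrid)).elim (fun e => Or.inr (h.isHybrid_iff.2 e))
    fun e => Or.inl (h.isTreeVertex ((h.cover v).resolve_right hv) hroot e)

theorem isProperGalledTree (h : IsElementaryWith N X C) : IsProperGalledTree N X where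
  root := by
    refine ⟨C.root, h.indeg_root, C.two_le_outdeg_root, fun v hv => ?_⟩
    by_contra hroot
    by_cases hvX : v ∈ X
    · exact one_ne_zero ((h.indeg_leaf hvX).symm.trans hv)
    · rcases h.isTreeVertex_or_isHybrid hvX hroot with ht | ht <;>
        exact absurd (hv.symm.trans ht.1) (by decide)
  leaves v := by
    refine ⟨fun hv => ⟨h.outdeg_leaf hv, h.indeg_leaf hv⟩, fun ⟨hout, hin⟩ => ?_⟩
    by_contra hv
    by_cases hroot : v = C.root
    · exact one_ne_zero (hin.symm.trans (hroot ▸ h.indeg_root))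
    · rcases h.isTreeVertex_or_isHybrid hv hroot with ht | ht <;>
        exact absurd (hout ▸ ht.2) (by decide)
  inner v hv hin := h.isTreeVertex_or_isHybrid hv fun e => hin (e ▸ h.indeg_root)
  level_one _ _ _ _ _ _ hv hv' _ _ := (h.isHybrid_iff.1 hv).trans (h.isHybrid_iff.1 hv').symm

theorem ncard_verts (h : IsElementaryWith N X C) : C.verts.ncard = X.ncard + 1 := by
  have hleaf : ∀ v ∈ C.verts \ {C.root}, ∃ x ∈ X, N.Adj v x := fun v hv =>
    (h.exists_leaf v hv.1 hv.2).exists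
  choose leaf hmem hadj using hleaf
  rw [← ncard_sdiff_singleton_add_one C.root_mem, ncard_congr leaf hmem]
  · intro u v hu hv e
    exact (h.leaf_parent _ (hmem u hu)).unique (hadj u hu) (e ▸ hadj v hv)
  · intro x hx
    obtain ⟨u, hu, -⟩ := h.leaf_parent x hx
    have hmem_u : u ∈ C.verts \ {C.root} := h.parent_mem hx hu
    exact ⟨u, hmem_u, (h.exists_leaf u hmem_u.1 hmem_u.2).unique
      ⟨hmem u hmem_u, hadj u hmem_u⟩ ⟨hx, hu⟩⟩

theorem isElementary (h : IsElementaryWith N X C) : IsElementary N X :=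
  ⟨⟨h.dag, Or.inr h.isProperGalledTree⟩, C, h.indeg_root, h.ncard_verts,
    eq_univ_of_forall h.cover, h.exists_leaf, h.edge⟩

end IsElementaryWith

theorem isDAG_of_pair_sublist {W : Type*} {N : Digraph W} {l : List W} (hl : l.Nodup)
    (h : ∀ u v, N.Adj u v → [u, v] <+ l) : IsDAG N := by
  intro v hv
  have hsub : ∀ {u w}, Relation.TransGen N.Adj u w → [u, w] <+ l := fun huw => by
    induction huw with
    | single huw => exact h _ _ huw
    | tail _ hvw ih => exact pair_sublist_trans hl ih (h _ _ hvw)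
  simpa using (hsub hv).nodup hl

/-- The vertices of an elementary galled-tree with leaf set `V`: the root, the other vertices of
the cycle, each named after the leaf below it, and the leaves. -/
inductive ElementaryVertex (V : Type*)
  | root
  | cycle (v : V)
  | leaf (v : V)

namespace ElementaryVertex

variable {V : Type*} {z y : V} {A : List V} {a b : ElementaryVertex V}

theorem cycle_injective : Function.Injective (cycle : V → ElementaryVertex V) :=
  fun _ _ => cycle.inj

theorem leaf_injective : Function.Injective (leaf : V → ElementaryVertex V) :=
  fun _ _ => leaf.inj

instance [Finite V] : Finite (ElementaryVertex V) := by
  refine Finite.of_injective (β := Option (V ⊕ V))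
    (fun | root => none | cycle v => some (Sum.inl v) | leaf v => some (Sum.inr v)) ?_
  rintro (_ | _ | _) (_ | _ | _) h <;> simp_all

/-- The side of the cycle that leads from the root through `A` to the hybrid-vertex `z`. -/
def side (z : V) (A : List V) : List (ElementaryVertex V) := root :: (A.map cycle ++ [cycle z])

theorem left_ne_leaf (h : [a, b] <:+: side z A) (v : V) : a ≠ leaf v := by
  rintro rfl
  simpa using (mem_of_pair_infix_cons_concat h).1

theorem exists_right_eq_cycle (h : [a, b] <:+: side z A) : ∃ v, b = cycle v := by
  rcases List.mem_append.1 (mem_of_pair_infix_cons_concat h).2 with hb | hb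
  · obtain ⟨v, -, rfl⟩ := List.mem_map.1 hb
    exact ⟨v, rfl⟩
  · exact ⟨z, List.mem_singleton.1 hb⟩

theorem eq_root_or_eq_cycle (h : [a, cycle y] <:+: side z A) (hy : y ≠ z) :
    (a = root ∧ A.head? = some y) ∨ ∃ x, a = cycle x ∧ [x, y] <:+: A := by
  have hmem : [a, cycle y] <:+: root :: A.map cycle := by
    rw [side, ← List.cons_append, List.infix_concat_iff] at h
    refine h.resolve_left fun ⟨l, hl⟩ => hy ?_
    have hlast := congrArg List.getLast? hl
    rw [List.getLast?_append, List.getLast?_concat] at hlast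
    exact cycle.inj (Option.some.inj hlast)
  rcases List.infix_cons_iff.1 hmem with hpre | hinf
  · obtain ⟨rfl, hpre⟩ := List.cons_prefix_cons.1 hpre
    cases A with
    | nil => simp at hpre
    | cons x A => simp_all
  · obtain ⟨l, hl, e⟩ := List.infix_map_iff.1 hinf
    obtain ⟨x, l, rfl⟩ := List.exists_cons_of_ne_nil (l := l) (by rintro rfl; simp at e)
    obtain ⟨rfl, e⟩ := List.cons_eq_cons.1 e
    obtain rfl : l = [y] := by
      apply List.map_injective_iff.2 cycle_injective
      simpa using e.symm
    exact Or.inr ⟨x, rfl, hl⟩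

end ElementaryVertex

open ElementaryVertex

section Caterpillar

variable {V : Type*}

/-- The elementary galled-tree whose cycle has the sides `A` and `B` and the hybrid-vertex
`z`. -/
def elementaryDigraph (z : V) (A B : List V) : Digraph (ElementaryVertex V) where
  Adj a b := [a, b] <:+: side z A ∨ [a, b] <:+: side z B ∨ ∃ v, a = cycle v ∧ b = leaf v

open Classical in
/-- The labeling of an elementary galled-tree in which `s` holds at the cycle vertices with label
`1`, and `r` holds if the root has label `1`. -/
noncomputable def elementaryLabel (s : V → Prop) (r : Prop) : ElementaryVertex V → VLabel
  | root => if r then VLabel.one else VLabel.zero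
  | cycle v => if s v then VLabel.one else VLabel.zero
  | leaf _ => VLabel.leaf

variable {H : SimpleGraph V} {x y z : V} {A B : List V} {s : V → Prop} {r : Prop}
  {a : ElementaryVertex V} {v : V}

theorem elementaryDigraph_swap : elementaryDigraph z B A = elementaryDigraph z A B :=
  Digraph.ext (funext₂ fun _ _ => propext or_left_comm)

theorem elementaryDigraph_adj_leaf_iff :
    (elementaryDigraph z A B).Adj a (leaf v) ↔ a = cycle v := by
  refine ⟨?_, fun h => Or.inr (Or.inr ⟨v, h, rfl⟩)⟩
  rintro (h | h | ⟨u, rfl, h⟩)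
  · simpa using exists_right_eq_cycle h
  · simpa using exists_right_eq_cycle h
  · rw [leaf.inj h]

theorem not_elementaryDigraph_adj_root : ¬ (elementaryDigraph z A B).Adj a root := by
  rintro (h | h | ⟨u, -, h⟩)
  · simpa using exists_right_eq_cycle h
  · simpa using exists_right_eq_cycle h
  · cases h

theorem not_elementaryDigraph_leaf_adj : ¬ (elementaryDigraph z A B).Adj (leaf v) a := by
  rintro (h | h | ⟨u, h, -⟩)
  · exact left_ne_leaf h v rfl
  · exact left_ne_leaf h v rfl
  · cases h

theorem elementaryLabel_root_eq_one : elementaryLabel s r root = VLabel.one ↔ r := by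
  simp [elementaryLabel]

theorem elementaryLabel_cycle_eq_one : elementaryLabel s r (cycle v) = VLabel.one ↔ s v := by
  simp [elementaryLabel]

theorem elementaryLabel_isLabeling :
    IsLabeling (range (leaf : V → ElementaryVertex V)) (elementaryLabel s r) := by
  constructor <;> rintro (_ | v | v) <;> simp only [elementaryLabel] <;> grind

namespace IsTwoCaterpillar

theorem nodup_concat (h : IsTwoCaterpillar H z A B s r) : (A ++ B ++ [z]).Nodup :=
  (List.perm_append_singleton z (A ++ B)).nodup_iff.2 h.nodup

theorem mem_concat (h : IsTwoCaterpillar H z A B s r) (v : V) : v ∈ A ++ B ++ [z] :=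
  (List.perm_append_singleton z (A ++ B)).mem_iff.2 (h.cover v)

theorem isDAG (h : IsTwoCaterpillar H z A B s r) : IsDAG (elementaryDigraph z A B) := by
  let l := A ++ B ++ [z]
  have hl : (root :: (l.map cycle ++ l.map leaf)).Nodup := by
    refine List.nodup_cons.2 ⟨by simp, (h.nodup_concat.map cycle_injective).append
      (h.nodup_concat.map leaf_injective) ?_⟩
    refine List.disjoint_left.2 fun a ha ha' => ?_
    obtain ⟨u, -, rfl⟩ := List.mem_map.1 ha
    obtain ⟨v, -, hv⟩ := List.mem_map.1 ha'
    cases hv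
  have hside : ∀ {D a b}, D <+ A ++ B → [a, b] <:+: side z D →
      [a, b] <+ root :: (l.map cycle ++ l.map leaf) := fun {D a b} hD hab => by
    refine hab.sublist.trans (List.Sublist.cons_cons _ ?_)
    refine List.Sublist.trans ?_ (List.sublist_append_left _ _)
    simpa [l] using (hD.append_right [z]).map cycle
  refine isDAG_of_pair_sublist hl ?_
  rintro a b (hab | hab | ⟨v, rfl, rfl⟩)
  · exact hside (List.sublist_append_left A B) hab
  · exact hside (List.sublist_append_right A B) hab
  · exact List.sublist_cons_of_sublist _ (List.Sublist.append
      (List.singleton_sublist.2 (List.mem_map_of_mem (h.mem_concat v)))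
      (List.singleton_sublist.2 (List.mem_map_of_mem (h.mem_concat v))))

/-- The cycle of the elementary galled-tree of a two-caterpillar. -/
def rootedCycle (h : IsTwoCaterpillar H z A B s r) : RootedCycle (elementaryDigraph z A B) where
  root := root
  hybrid := cycle z
  inner₁ := A.map cycle
  inner₂ := B.map cycle
  path₁ := (isChain_pair_infix _).imp fun _ _ => Or.inl
  path₂ := (isChain_pair_infix _).imp fun _ _ huv => Or.inr (Or.inl huv)
  nodup := by
    rw [← List.map_append, ← List.map_cons, List.nodup_cons]
    exact ⟨by simp, h.nodup.map cycle_injective⟩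
  nontrivial := Or.inl (List.map_eq_nil_iff.not.2 h.left_ne_nil)

theorem mem_verts_iff (h : IsTwoCaterpillar H z A B s r) :
    a ∈ h.rootedCycle.verts ↔ a ∉ range leaf := by
  rw [RootedCycle.mem_verts]
  cases a with
  | root => simp [rootedCycle]
  | leaf v => simp [rootedCycle]
  | cycle v => simpa [rootedCycle] using h.cover v

theorem isElementaryWith (h : IsTwoCaterpillar H z A B s r) :
    IsElementaryWith (elementaryDigraph z A B) (range leaf) h.rootedCycle where
  dag := h.isDAG
  not_adj_root _ := not_elementaryDigraph_adj_root
  leaf_not_adj := forall_mem_range.2 fun _ _ => not_elementaryDigraph_leaf_adj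
  leaf_parent := forall_mem_range.2 fun v =>
    ⟨cycle v, elementaryDigraph_adj_leaf_iff.2 rfl, fun _ => elementaryDigraph_adj_leaf_iff.1⟩
  cover v := (em' (v ∈ range leaf)).imp_left h.mem_verts_iff.2
  exists_leaf v hv hroot := by
    cases v with
    | root => exact absurd rfl hroot
    | leaf v => exact absurd (mem_range_self v) (h.mem_verts_iff.1 hv)
    | cycle v =>
      refine ⟨leaf v, ⟨mem_range_self v, elementaryDigraph_adj_leaf_iff.2 rfl⟩, ?_⟩
      rintro _ ⟨⟨x, rfl⟩, hx⟩
      rw [cycle.inj (elementaryDigraph_adj_leaf_iff.1 hx)]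
  edge u v huv := by
    rcases huv with huv | huv | ⟨w, rfl, rfl⟩
    · exact Or.inl (Or.inl huv)
    · exact Or.inl (Or.inr huv)
    · exact Or.inr ⟨h.mem_verts_iff.2 (by simp), by simp [rootedCycle], mem_range_self w⟩

theorem isStrong (h : IsTwoCaterpillar H z A B s r) (hH : IsPrimeGraph H) :
    IsStrong (elementaryDigraph z A B) :=
  h.isElementaryWith.isStrong (List.map_eq_nil_iff.not.2 h.left_ne_nil)
    (List.map_eq_nil_iff.not.2 h.right_ne_nil)
    (by simpa [rootedCycle] using h.not_both_length_one hH)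

theorem elementaryLabel_ne_of_pair_infix (h : IsTwoCaterpillar H z A B s r)
    (hH : IsPrimeGraph H) (hy : y ≠ z) (hay : [a, cycle y] <:+: side z A) :
    elementaryLabel s r a ≠ elementaryLabel s r (cycle y) := by
  suffices ¬ (elementaryLabel s r a = VLabel.one ↔ elementaryLabel s r (cycle y) = VLabel.one) from
    fun e => this (e ▸ Iff.rfl)
  rcases eq_root_or_eq_cycle hay hy with ⟨rfl, hhead⟩ | ⟨x, rfl, hxy⟩
  · rw [elementaryLabel_root_eq_one, elementaryLabel_cycle_eq_one]
    exact fun e => h.not_iff_of_head hH hhead e.symm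
  · rw [elementaryLabel_cycle_eq_one, elementaryLabel_cycle_eq_one]
    exact h.not_iff_of_pair_infix hH hxy

theorem isQuasiDiscriminating [Finite V] (h : IsTwoCaterpillar H z A B s r)
    (hH : IsPrimeGraph H) :
    IsQuasiDiscriminating (elementaryDigraph z A B) (elementaryLabel s r) := by
  intro a b hab hb
  cases b with
  | root => exact absurd hab not_elementaryDigraph_adj_root
  | leaf v =>
    rw [elementaryDigraph_adj_leaf_iff.1 hab, elementaryLabel, elementaryLabel]
    split_ifs <;> simp
  | cycle y =>
    have hy : y ≠ z := fun e => hb (h.isElementaryWith.isHybrid_iff.2 (congrArg cycle e))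
    rcases hab with hab | hab | ⟨v, -, hv⟩
    · exact h.elementaryLabel_ne_of_pair_infix hH hy hab
    · exact h.swap.elementaryLabel_ne_of_pair_infix hH hy hab
    · cases hv

theorem explainedGraph_adj_iff_left (h : IsTwoCaterpillar H z A B s r) (hx : x ∈ A ++ [z])
    (hy : y ∈ A ++ [z]) (hxy : x ≠ y) :
    (explainedGraph (elementaryDigraph z A B) (elementaryLabel s r) leaf).Adj x y ↔
      H.Adj x y := by
  set K := explainedGraph (elementaryDigraph z A B) (elementaryLabel s r) leaf with hK
  have : Std.Symm fun x y => K.Adj x y ↔ H.Adj x y := ⟨fun x y hxy => by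
    rwa [K.adj_comm, H.adj_comm]⟩
  have habove : (A ++ [z]).Pairwise fun x y =>
      Relation.TransGen (elementaryDigraph z A B).Adj (cycle x) (cycle y) := by
    have := (List.pairwise_cons.1 h.rootedCycle.pairwise_transGen₁).2
    rw [← List.pairwise_map (f := cycle), List.map_append]
    exact this
  have hnodup : (A ++ [z]).Nodup :=
    h.nodup_concat.sublist ((List.sublist_append_left A B).append_right [z])
  refine List.Pairwise.forall (R := fun x y => K.Adj x y ↔ H.Adj x y)
    (((habove.and h.left).and hnodup).imp ?_) hx hy hxy
  rintro x y ⟨⟨hxy, hs⟩, hne⟩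
  rw [hs, hK, h.isElementaryWith.adj_iff_above leaf_injective
    (elementaryDigraph_adj_leaf_iff.2 rfl) (elementaryDigraph_adj_leaf_iff.2 rfl) hne hxy,
    elementaryLabel_cycle_eq_one]

theorem explainedGraph_adj_iff_cross (h : IsTwoCaterpillar H z A B s r) (hx : x ∈ A)
    (hy : y ∈ B) :
    (explainedGraph (elementaryDigraph z A B) (elementaryLabel s r) leaf).Adj x y ↔
      H.Adj x y := by
  rw [h.cross x hx y hy, h.isElementaryWith.adj_iff_opposite
    (elementaryDigraph_adj_leaf_iff.2 rfl) (elementaryDigraph_adj_leaf_iff.2 rfl)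
    (List.mem_map_of_mem hx) (List.mem_map_of_mem hy)]
  exact elementaryLabel_root_eq_one

theorem explainedGraph_eq (h : IsTwoCaterpillar H z A B s r) :
    explainedGraph (elementaryDigraph z A B) (elementaryLabel s r) leaf = H := by
  ext x y
  obtain rfl | hxy := eq_or_ne x y
  · simp only [SimpleGraph.irrefl]
  have hcases : (x ∈ A ++ [z] ∧ y ∈ A ++ [z]) ∨ (x ∈ B ++ [z] ∧ y ∈ B ++ [z]) ∨
      (x ∈ A ∧ y ∈ B) ∨ (x ∈ B ∧ y ∈ A) := by
    have hx := h.cover x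
    have hy := h.cover y
    simp only [List.mem_cons, List.mem_append, List.not_mem_nil] at hx hy ⊢
    tauto
  rcases hcases with ⟨hx, hy⟩ | ⟨hx, hy⟩ | ⟨hx, hy⟩ | ⟨hx, hy⟩
  · exact h.explainedGraph_adj_iff_left hx hy hxy
  · rw [← elementaryDigraph_swap]
    exact h.swap.explainedGraph_adj_iff_left hx hy hxy
  · exact h.explainedGraph_adj_iff_cross hx hy
  · rw [SimpleGraph.adj_comm, H.adj_comm]
    exact h.explainedGraph_adj_iff_cross hy hx

end IsTwoCaterpillar

end Caterpillar

/-! ### Existence of pvr-networks -/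

theorem connected_of_adj_imp_eq_or_adj {V V' : Type*} {H : SimpleGraph V} {H' : SimpleGraph V'}
    (hH : H.Connected) {f : V → V'} (hf : Function.Surjective f)
    (hadj : ∀ x y, H.Adj x y → f x = f y ∨ H'.Adj (f x) (f y)) : H'.Connected := by
  have := hH.nonempty.map f
  refine SimpleGraph.Connected.mk fun u v => ?_
  obtain ⟨x, rfl⟩ := hf u
  obtain ⟨y, rfl⟩ := hf v
  refine (SimpleGraph.reachable_iff_reflTransGen _ _).2 (Relation.ReflTransGen.lift' f ?_ _ _
    ((SimpleGraph.reachable_iff_reflTransGen _ _).1 (hH.preconnected x y)))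
  intro a b hab
  rcases hadj a b hab with e | e
  · rw [Function.onFun, e]
  · exact Relation.ReflTransGen.single e

section Quotient

variable {X : Type*} {G : SimpleGraph X} {M : Set X}

theorem exists_quotientGraph_embedding (G : SimpleGraph X) (M : Set X) :
    Nonempty (quotientGraph G M ↪g G) := by
  choose rep hrep using fun S : maxStrong G M => maxStrong_nonempty S.2
  have hinj : Function.Injective rep := fun S T h =>
    Subtype.ext (maxStrong_eq_of_mem S.2 T.2 (hrep S) (h ▸ hrep T))
  refine ⟨⟨⟨rep, hinj⟩, fun {S T} => ?_⟩⟩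
  obtain rfl | hST := eq_or_ne S T
  · simp only [SimpleGraph.irrefl]
  · exact (quotientGraph_adj hST (hrep S) (hrep T)).symm

variable [Finite X]

theorem exists_surjective_mem_maxStrong (hM : M.ncard ≠ 1) :
    ∃ f : M → maxStrong G M, Function.Surjective f ∧ ∀ x : M, x.1 ∈ (f x).1 := by
  choose f hf hxf using fun x : M => exists_mem_maxStrong (G := G) hM x.2
  refine ⟨fun x => ⟨f x, hf x⟩, fun S => ?_, hxf⟩
  obtain ⟨x, hx⟩ := maxStrong_nonempty S.2
  let x' : M := ⟨x, maxStrong_subset S.2 hx⟩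
  exact ⟨x', Subtype.ext (maxStrong_eq_of_mem (hf x') S.2 (hxf x') hx)⟩

theorem nontrivial_maxStrong (hM : M.ncard ≠ 1) (hne : M.Nonempty) :
    Nontrivial (maxStrong G M) := by
  obtain ⟨x, hx⟩ := hne
  obtain ⟨S, hS, -⟩ := exists_mem_maxStrong (G := G) hM hx
  obtain ⟨y, hy, hyS⟩ := exists_of_ssubset ((maxStrong_subset hS).ssubset_of_ne (maxStrong_ne hS))
  obtain ⟨T, hT, hyT⟩ := exists_mem_maxStrong (G := G) hM hy
  exact ⟨⟨S, hS⟩, ⟨T, hT⟩, fun h => hyS (Subtype.mk.inj h ▸ hyT)⟩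

theorem connected_quotientGraph (hM : M.ncard ≠ 1) (hG : (G.induce M).Connected) :
    (quotientGraph G M).Connected := by
  obtain ⟨f, hf, hmem⟩ := exists_surjective_mem_maxStrong (G := G) hM
  exact connected_of_adj_imp_eq_or_adj hG hf fun x y hxy =>
    or_iff_not_imp_left.2 fun hne => (quotientGraph_adj hne (hmem x) (hmem y)).2 hxy

theorem connected_compl_quotientGraph (hM : M.ncard ≠ 1) (hG : (G.induce M)ᶜ.Connected) :
    (quotientGraph G M)ᶜ.Connected := by
  obtain ⟨f, hf, hmem⟩ := exists_surjective_mem_maxStrong (G := G) hM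
  refine connected_of_adj_imp_eq_or_adj hG hf fun x y hxy => or_iff_not_imp_left.2 fun hne => ?_
  rw [SimpleGraph.compl_adj, quotientGraph_adj hne (hmem x) (hmem y)]
  exact ⟨hne, hxy.2⟩

theorem IsModuleOn.iUnion_maxStrong (hM : M.ncard ≠ 1) {U : Set (maxStrong G M)}
    (hU : IsModuleOn (quotientGraph G M) univ U) : IsModuleOn G M (⋃ S ∈ U, S.1) := by
  refine ⟨iUnion₂_subset fun S _ => maxStrong_subset S.2, fun x hx y hy w hw hwU => ?_⟩
  obtain ⟨S, hS, hxS⟩ := mem_iUnion₂.1 hx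
  obtain ⟨T, hT, hyT⟩ := mem_iUnion₂.1 hy
  obtain ⟨Q, hQ, hwQ⟩ := exists_mem_maxStrong (G := G) hM hw
  have hQU : ⟨Q, hQ⟩ ∉ U := fun h => hwU (mem_biUnion h hwQ)
  rw [← quotientGraph_adj (T := ⟨Q, hQ⟩) (fun h => hQU (h ▸ hS)) hxS hwQ,
    ← quotientGraph_adj (T := ⟨Q, hQ⟩) (fun h => hQU (h ▸ hT)) hyT hwQ]
  exact hU.2 S hS T hT _ (mem_univ _) hQU

theorem isPrimeGraph_quotientGraph (P : PrimeVertex G) :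
    IsPrimeGraph (quotientGraph G P.1.1) := by
  obtain ⟨hM, hcon, hco⟩ := mdLabel_eq_prime_iff.1 P.2
  refine ⟨nontrivial_maxStrong hM P.1.2.1, connected_quotientGraph hM hcon,
    connected_compl_quotientGraph hM hco, fun U hU => ?_⟩
  obtain rfl | hne := U.eq_empty_or_nonempty
  · exact Or.inl subsingleton_empty
  refine or_iff_not_imp_right.2 fun huniv => ?_
  obtain ⟨Q, hQ⟩ := (ne_univ_iff_exists_notMem U).1 huniv
  have hproper : ⋃ S ∈ U, S.1 ≠ P.1.1 := fun h => by
    obtain ⟨x, hx⟩ := maxStrong_nonempty Q.2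
    obtain ⟨S, hS, hxS⟩ := mem_iUnion₂.1 (h.ge (maxStrong_subset Q.2 hx))
    exact hQ (Subtype.ext (maxStrong_eq_of_mem S.2 Q.2 hxS hx) ▸ hS)
  have hnonempty : (⋃ S ∈ U, S.1).Nonempty :=
    nonempty_biUnion.2 (hne.imp fun S hS => ⟨hS, maxStrong_nonempty S.2⟩)
  obtain ⟨T, hT, hUT⟩ :=
    exists_maxStrong_superset_of_isModuleOn hcon hco hnonempty (hU.iUnion_maxStrong hM) hproper
  have heq : ∀ S ∈ U, S.1 = T := fun S hS => by
    obtain ⟨x, hx⟩ := maxStrong_nonempty S.2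
    exact maxStrong_eq_of_mem S.2 hT hx (hUT (mem_biUnion hS hx))
  exact fun S hS S' hS' => Subtype.ext ((heq S hS).trans (heq S' hS').symm)

end Quotient

section AncestorOrder

variable {W : Type*} [Finite W] {N : Digraph W} {L : Set W}

/-- The ancestor order of a galled-tree, with the root at the top; suprema are least common
ancestors. -/
noncomputable abbrev ancestorSemilattice (hdag : IsDAG N) (hN : IsProperGalledTree N L) :
    SemilatticeSup W where
  le u v := IsAncestor N v u
  le_refl _ := Relation.ReflTransGen.refl
  le_trans _ _ _ h h' := h'.trans h
  le_antisymm _ _ h h' := ancestor_antisymm hdag h' h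
  sup x y := (exists_isLCA hdag hN x y).choose
  le_sup_left x y := (exists_isLCA hdag hN x y).choose_spec.1 x (mem_insert _ _)
  le_sup_right x y := (exists_isLCA hdag hN x y).choose_spec.1 y (mem_insert_of_mem _ rfl)
  sup_le x y c hx hy := by
    obtain ⟨w, hw, hcw⟩ :=
      exists_isLCA_below hdag (A := {x, y}) (c := c) (by rintro a (rfl | rfl) <;> assumption)
    exact isLCA_unique hdag hN (exists_isLCA hdag hN x y).choose_spec hw ▸ hcw

theorem isGalledOrder_ancestorSemilattice (hdag : IsDAG N) (hN : IsProperGalledTree N L) :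
    @IsGalledOrder W (ancestorSemilattice hdag hN) :=
  let _ := ancestorSemilattice hdag hN
  { overlap := fun hab hac => ancestor_of_overlap hdag hN hab.symm hac.symm
    not_three := fun hab hac hbc => not_pairwise_overlap hdag hN hab.symm hac.symm hbc.symm }

theorem IsProperGalledTree.nonempty_leaves (hdag : IsDAG N) (hN : IsProperGalledTree N L) :
    L.Nonempty := by
  obtain ⟨ρ, -, hρ2, hρ⟩ := hN.root
  obtain ⟨v, -, hv⟩ := (wellFounded_adj_swap hdag).has_min univ ⟨ρ, mem_univ ρ⟩
  have hout : outdeg N v = 0 :=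
    outdeg_eq_zero_iff.2 fun u hu => hv u (mem_univ u) (Relation.TransGen.single hu)
  by_contra hL
  have hvL : v ∉ L := fun h => hL ⟨v, h⟩
  by_cases hin : indeg N v = 0
  · rw [hρ v hin] at hout
    omega
  · rcases hN.inner v hvL hin with ⟨-, h⟩ | ⟨-, h⟩ <;> omega

end AncestorOrder

theorem nonempty_of_isGaTEx {X : Type*} {G : SimpleGraph X} (hG : IsGaTEx G) : Nonempty X := by
  obtain ⟨W, _, N, t, ℓ, -, ⟨hdag, hN⟩, -⟩ := hG
  rw [← range_nonempty_iff_nonempty (f := ℓ)]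
  rcases hN with ⟨x, -, hx⟩ | hN
  · exact hx ▸ singleton_nonempty x
  · exact hN.nonempty_leaves hdag

theorem IsGaTEx.exists_isTwoCaterpillar {X V : Type*} [Finite V] {G : SimpleGraph X}
    {H : SimpleGraph V} (hG : IsGaTEx G) (hH : IsPrimeGraph H) (f : H ↪g G) :
    ∃ z A B s r, IsTwoCaterpillar H z A B s r := by
  obtain ⟨W, _, N, t, ℓ, hℓ, ⟨hdag, hN⟩, -, rfl⟩ := hG
  have := hH.nontrivial
  have hinj : Function.Injective (ℓ ∘ f) := hℓ.comp f.injective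
  rcases hN with ⟨w, hw, -⟩ | hN
  · obtain ⟨x, y, hxy⟩ := exists_pair_ne V
    exact absurd (hinj ((hw.le (mem_univ _)).trans (hw.le (mem_univ _)).symm)) hxy
  let _ : SemilatticeSup W := ancestorSemilattice hdag hN
  refine hH.exists_isTwoCaterpillar (isGalledOrder_ancestorSemilattice hdag hN) (φ := ℓ ∘ f)
    (τ := fun w => t w = VLabel.one) fun x y hxy => ?_
  have hsup : IsLCA N {ℓ (f x), ℓ (f y)} (ℓ (f x) ⊔ ℓ (f y)) :=
    (exists_isLCA hdag hN (ℓ (f x)) (ℓ (f y))).choose_spec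
  rw [← f.map_adj_iff, explainedGraph_adj]
  refine ⟨?_, fun h => ⟨f.injective.ne hxy, _, hsup, h⟩⟩
  rintro ⟨-, w, hw, hone⟩
  exact isLCA_unique hdag hN hw hsup ▸ hone

theorem explainedGraph_comp {W V V' : Type*} {N : Digraph W} {t : W → VLabel} {ℓ : V → W}
    {f : V' → V} (hf : Function.Injective f) :
    (explainedGraph N t fun x => ℓ (f x)) = (explainedGraph N t ℓ).comap f := by
  ext x y
  simp only [SimpleGraph.comap_adj, explainedGraph_adj, hf.ne_iff]

theorem exists_replacement {X : Type*} [Finite X] {G : SimpleGraph X} (hG : IsGaTEx G)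
    (P : PrimeVertex G) : Nonempty (Replacement G P.1.1) := by
  obtain ⟨n, ⟨e⟩⟩ := Finite.exists_equiv_fin (maxStrong G P.1.1)
  let iso := SimpleGraph.Iso.comap e.symm (quotientGraph G P.1.1)
  obtain ⟨f⟩ := exists_quotientGraph_embedding G P.1.1
  have hprime := (isPrimeGraph_quotientGraph P).map_iso iso.symm
  obtain ⟨z, A, B, s, r, h⟩ := hG.exists_isTwoCaterpillar hprime (f.comp iso.toEmbedding)
  have hrange : range (fun S => ElementaryVertex.leaf (e S)) = range ElementaryVertex.leaf :=
    e.surjective.range_comp ElementaryVertex.leaf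
  exact ⟨{
    W := ElementaryVertex (Fin n)
    finite := inferInstance
    N := elementaryDigraph z A B
    t := elementaryLabel s r
    root := ElementaryVertex.root
    leaf := fun S => ElementaryVertex.leaf (e S)
    leaf_injective := ElementaryVertex.leaf_injective.comp e.injective
    indeg_root := h.isElementaryWith.indeg_root
    elementary := hrange ▸ h.isElementaryWith.isElementary
    strong := h.isStrong hprime
    labeling := hrange ▸ elementaryLabel_isLabeling
    quasiDiscriminating := h.isQuasiDiscriminating hprime
    explains := by
      rw [explainedGraph_comp e.injective, h.explainedGraph_eq, SimpleGraph.comap_comap,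
        e.symm_comp_self, SimpleGraph.comap_id] }⟩

end GaTEx

theorem mainTheorem2 {X : Type*} [Finite X] (G : SimpleGraph X) (hG : GaTEx.IsGaTEx G) :
    Nonempty (GaTEx.PvrChoice G) ∧
      ∀ R : GaTEx.PvrChoice G,
        (∃ o : List X, GaTEx.AlgReturns R o) ∧
          ∀ o : List X, GaTEx.AlgReturns R o → GaTEx.IsPerfectOrder G o := by
  have := GaTEx.nonempty_of_isGaTEx hG
  exact ⟨⟨fun P => (GaTEx.exists_replacement hG P).some⟩,
    fun R => ⟨GaTEx.exists_algReturns R, fun _ ho => ho.isPerfectOrder⟩⟩
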